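/- Let $\mathbb E^4_1$ be $\mathbb R^4$ with the form $\langle x,y\rangle=-x_1y_1+x_2y_2+x_3y_3+x_4y_4$. For $r>0$ put $\mathbb S^3_1(r^2)=\{\langle x,x\rangle=r^{-2}\}$ and $\mathbb H^3(-r^2)=\{\langle x,x\rangle=-r^{-2}\}$. Let $x:M\to\mathbb E^4_1$ be a smooth, connected, oriented, space-like immersed surface that is marginally trapped, i.e. its mean curvature vector $H$ is light-like (non-zero with $\langle H,H\rangle=0$) at every point. Let $\nu=e_1\wedge e_2:M\to\Lambda^2\mathbb E^4_1$ be its Gauss map, where $(e_1,e_2)$ is a positively oriented orthonormal tangent frame. Let $\Delta=\sum_i(-e_ie_i+\nabla_{e_i}e_i)$ be the Laplace operator of the induced metric. The Gauss map is called pointwise 1-type if $\Delta\nu=f(\nu+C)$ on $M$ for some smooth function $f\not\equiv0$ on $M$ and some constant $C\in\Lambda^2\mathbb E^4_1$. **Theorem.** The set $\mathcal M=\{p\in M:\Delta\nu|_p\neq0\}$ is open, and $M$ has pointwise 1-type Gauss map if and only if $\mathcal M$ is of one of the following two types. (i) $\mathcal M$ is congruent to a non-flat surface lying in $\mathbb S^3_1(r^2)$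 or in $\mathbb H^3(-r^2)$ for some $r>0$. That is, the Gaussian curvature is not identically zero on $\mathcal M$, and an isometry of $\mathbb E^4_1$ carries $x(\mathcal M)$ into one of these quadrics. (ii) $\mathcal M$ is non-empty, and there are an isometry $T$ of $\mathbb E^4_1$ and constants $c_1,c_2\in\mathbb R$ such that every point of $\mathcal M$ has an open neighbourhood $U\subseteq\mathcal M$ which $T\circ x$ maps bijectively onto a surface $$\{(\phi(u,v),u,v,\phi(u,v)):(u,v)\in\Omega\},$$ where $\Omega\subset\mathbb R^2$ is open and bounded, $\phi,\psi:\Omega\to\mathbb R$ are smooth, and $$-\psi_{uu}-\psi_{vv}=F(\psi),\qquad \phi=\psi+c_1u+c_2v$$ for a non-constant differentiable function $F:\psi(\Omega)\to\mathbb R$ for which $F'\circ\psi$ is smooth on $\Omega$. Here $U,\Omega,\phi,\psi,F$ may depend on the point, but $T,c_1,c_2$ may not. -/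

import Mathlib

open scoped Manifold ContDiff

namespace MinkSurf

noncomputable section

/-- The underlying vector space of the Minkowski space-time. -/
abbrev E41 : Type := Fin 4 → ℝ

/-- The coordinate plane, which is the model space of all surfaces. -/
abbrev Plane : Type := EuclideanSpace ℝ (Fin 2)

/-- The indefinite inner product of signature (-,+,+,+). -/
def form (a b : E41) : ℝ := -(a 0 * b 0) + a 1 * b 1 + a 2 * b 2 + a 3 * b 3

/-- The de Sitter space of the vectors with square `1 / r ^ 2`. -/
def deSitter (r : ℝ) : Set E41 := {y | form y y = (r ^ 2)⁻¹}

/-- The hyperbolic space of the vectors with square `-1 / r ^ 2`. -/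
def hyperbolic (r : ℝ) : Set E41 := {y | form y y = -(r ^ 2)⁻¹}

/-- Isometries of the Minkowski space-time: affine maps whose linear part preserves the form. -/
def IsCongruence (T : E41 ≃ᵃ[ℝ] E41) : Prop :=
  ∀ a b : E41, form (T.linear a) (T.linear b) = form a b

/-- The six-dimensional space of 2-vectors: coordinates with respect to the basis of the
wedge products of the `i`-th and the `j`-th standard basis vector, for `i < j`. -/
abbrev Bivector : Type := {ij : Fin 4 × Fin 4 // ij.1 < ij.2} → ℝ

/-- The wedge product of two vectors. -/
def wedge (a b : E41) : Bivector := fun ij => a ij.1.1 * b ij.1.2 - a ij.1.2 * b ij.1.1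

/-! ### Geometry of a parametrized space-like surface `X`, in coordinates -/

/-- The `i`-th partial derivative. -/
def pd {V : Type*} [NormedAddCommGroup V] [NormedSpace ℝ V] (i : Fin 2) (G : Plane → V)
    (q : Plane) : V :=
  fderiv ℝ G q (EuclideanSpace.single i 1)

/-- The induced metric. -/
def metric (X : Plane → E41) (q : Plane) : Matrix (Fin 2) (Fin 2) ℝ :=
  Matrix.of fun i j => form (pd i X q) (pd j X q)

/-- The Christoffel symbols of the Levi-Civita connection of the induced metric; `k` is the
upper index. -/
def christoffel (X : Plane → E41) (k i j : Fin 2) (q : Plane) : ℝ :=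
  ∑ l, (metric X q)⁻¹ k l / 2 *
    (pd i (fun w => metric X w j l) q + pd j (fun w => metric X w i l) q
      - pd l (fun w => metric X w i j) q)

/-- The Laplace operator of the induced metric, with the sign for which it is `-∂² - ∂²` on the
Euclidean plane; it acts on functions with values in any normed space. -/
def laplaceCoord {V : Type*} [NormedAddCommGroup V] [NormedSpace ℝ V] (X : Plane → E41)
    (G : Plane → V) (q : Plane) : V :=
  -∑ i, ∑ j, (metric X q)⁻¹ i j • (pd i (pd j G) q - ∑ k, christoffel X k i j q • pd k G q)

/-- The second fundamental form: the ambient derivative minus the derivative with respect to the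
Levi-Civita connection (Gauss formula). -/
def secondFormCoord (X : Plane → E41) (i j : Fin 2) (q : Plane) : E41 :=
  pd i (pd j X) q - ∑ k, christoffel X k i j q • pd k X q

/-- The mean curvature vector, half the trace of the second fundamental form. -/
def meanCurvatureCoord (X : Plane → E41) (q : Plane) : E41 :=
  (1 / 2 : ℝ) • ∑ i, ∑ j, (metric X q)⁻¹ i j • secondFormCoord X i j q

/-- The `l`-th component of `R(∂ᵢ, ∂ⱼ) ∂ₖ`, where `R` is the curvature tensor of the induced
metric. -/
def riemannCoord (X : Plane → E41) (l k i j : Fin 2) (q : Plane) : ℝ :=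
  pd i (christoffel X l j k) q - pd j (christoffel X l i k) q
    + ∑ m, (christoffel X m j k q * christoffel X l i m q
      - christoffel X m i k q * christoffel X l j m q)

/-- The Gaussian curvature `⟨R(∂₁, ∂₂) ∂₂, ∂₁⟩ / det g` of the induced metric. -/
def gaussCurvatureCoord (X : Plane → E41) (q : Plane) : ℝ :=
  (∑ l, riemannCoord X l 1 0 1 q * metric X q l 0) / (metric X q).det

/-! ### Surfaces: immersions `x` of a two-dimensional manifold `M`

All quantities at a point are computed in the preferred chart at that point. -/

section Surface

variable {M : Type*} [TopologicalSpace M] [ChartedSpace Plane M]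

/-- The coordinate expression of a map in the preferred chart at `p`. -/
def inChart {V : Type*} (p : M) (G : M → V) : Plane → V := G ∘ (chartAt Plane p).symm

/-- The Laplace operator of the surface `x`. -/
def laplace {V : Type*} [NormedAddCommGroup V] [NormedSpace ℝ V] (x : M → E41) (G : M → V)
    (p : M) : V :=
  laplaceCoord (inChart p x) (inChart p G) (chartAt Plane p p)

/-- The mean curvature vector of the surface `x`. -/
def meanCurvature (x : M → E41) (p : M) : E41 :=
  meanCurvatureCoord (inChart p x) (chartAt Plane p p)

/-- The Gaussian curvature of the surface `x`. -/
def gaussCurvature (x : M → E41) (p : M) : ℝ :=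
  gaussCurvatureCoord (inChart p x) (chartAt Plane p p)

/-- A smooth space-like immersed surface: every non-zero tangent vector is space-like. -/
def IsSpacelikeSurface (x : M → E41) : Prop :=
  ContMDiff (𝓡 2) 𝓘(ℝ, E41) ∞ x ∧
    ∀ (p : M) (v : TangentSpace (𝓡 2) p), v ≠ 0 →
      0 < form (mfderiv (𝓡 2) 𝓘(ℝ, E41) x p v) (mfderiv (𝓡 2) 𝓘(ℝ, E41) x p v)

/-- A marginally trapped surface: the mean curvature vector is light-like at every point. -/
def IsMarginallyTrapped (x : M → E41) : Prop :=
  IsSpacelikeSurface x ∧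
    ∀ p, meanCurvature x p ≠ 0 ∧ form (meanCurvature x p) (meanCurvature x p) = 0

/-- `ν` is the Gauss map of the surface `x` for one of its orientations: it is continuous, and
`ν p` is the wedge product of an orthonormal basis of the tangent plane at `p`. (The choice of
one of the two unit 2-vectors of each tangent plane, continuously in the point, is the choice of
an orientation.) -/
def IsGaussMap (x : M → E41) (ν : M → Bivector) : Prop :=
  Continuous ν ∧
    ∀ p, ∃ v w : TangentSpace (𝓡 2) p,
      form (mfderiv (𝓡 2) 𝓘(ℝ, E41) x p v) (mfderiv (𝓡 2) 𝓘(ℝ, E41) x p v) = 1 ∧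
      form (mfderiv (𝓡 2) 𝓘(ℝ, E41) x p w) (mfderiv (𝓡 2) 𝓘(ℝ, E41) x p w) = 1 ∧
      form (mfderiv (𝓡 2) 𝓘(ℝ, E41) x p v) (mfderiv (𝓡 2) 𝓘(ℝ, E41) x p w) = 0 ∧
      ν p = wedge (mfderiv (𝓡 2) 𝓘(ℝ, E41) x p v) (mfderiv (𝓡 2) 𝓘(ℝ, E41) x p w)

/-- The Gauss map `ν` of `x` is pointwise 1-type: `Δν = f (ν + C)` for a smooth function `f`
that is not identically zero and a constant 2-vector `C`. -/
def IsPointwiseOneType (x : M → E41) (ν : M → Bivector) : Prop :=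
  ∃ (f : M → ℝ) (C : Bivector), ContMDiff (𝓡 2) 𝓘(ℝ, ℝ) ∞ f ∧ (∃ p, f p ≠ 0) ∧
    ∀ p, laplace x ν p = f p • (ν p + C)

/-- The set of the points at which `Δν` does not vanish. -/
def nonHarmonicSet (x : M → E41) (ν : M → Bivector) : Set M := {p | laplace x ν p ≠ 0}

/-- The part `S` of the surface `x` is congruent to a non-flat surface lying in a de Sitter space
or in a hyperbolic space. -/
def IsNonflatInQuadric (x : M → E41) (S : Set M) : Prop :=
  (∃ p ∈ S, gaussCurvature x p ≠ 0) ∧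
    ∃ (T : E41 ≃ᵃ[ℝ] E41) (r : ℝ), IsCongruence T ∧ 0 < r ∧
      ((∀ p ∈ S, T (x p) ∈ deSitter r) ∨ (∀ p ∈ S, T (x p) ∈ hyperbolic r))

end Surface

/-! ### The graph surfaces `(φ, u, v, φ)` -/

/-- The Laplace operator `-∂² - ∂²` of the Euclidean plane. -/
def flatLaplace (ψ : Plane → ℝ) (w : Plane) : ℝ := -(pd 0 (pd 0 ψ) w) - pd 1 (pd 1 ψ) w

/-- The surface `(u, v) ↦ (φ(u,v), u, v, φ(u,v))`. -/
def graphMap (φ : Plane → ℝ) (w : Plane) : E41 := ![φ w, w 0, w 1, φ w]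

/-- The conditions on the data `Ω`, `ψ`, `φ`, `F` of a graph surface with the constants
`c₁`, `c₂`. -/
structure IsGraphData (c₁ c₂ : ℝ) (Ω : Set Plane) (ψ φ : Plane → ℝ) (F : ℝ → ℝ) : Prop where
  isOpen : IsOpen Ω
  isBounded : Bornology.IsBounded Ω
  smooth_psi : ContDiffOn ℝ ∞ ψ Ω
  smooth_phi : ContDiffOn ℝ ∞ φ Ω
  differentiable : DifferentiableOn ℝ F (ψ '' Ω)
  nonconstant : ∃ s ∈ ψ '' Ω, ∃ t ∈ ψ '' Ω, F s ≠ F t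
  smooth_deriv : ContDiffOn ℝ ∞ (fun w => derivWithin F (ψ '' Ω) (ψ w)) Ω
  laplace_eq : ∀ w ∈ Ω, flatLaplace ψ w = F (ψ w)
  phi_eq : ∀ w ∈ Ω, φ w = ψ w + c₁ * w 0 + c₂ * w 1

/-- The part `S` of the surface `x` is non-empty and, after one isometry `T` and with one pair of
constants `c₁`, `c₂` for all of `S`, it is near each of its points a graph surface: some open
neighbourhood `U` is mapped by `T ∘ x` bijectively onto the graph surface of admissible data. -/
def IsLocallyGraph {M : Type*} [TopologicalSpace M] (x : M → E41) (S : Set M) : Prop :=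
  S.Nonempty ∧
    ∃ (T : E41 ≃ᵃ[ℝ] E41) (c₁ c₂ : ℝ), IsCongruence T ∧
      ∀ p ∈ S, ∃ (U : Set M) (Ω : Set Plane) (ψ φ : Plane → ℝ) (F : ℝ → ℝ),
        IsOpen U ∧ p ∈ U ∧ U ⊆ S ∧ IsGraphData c₁ c₂ Ω ψ φ F ∧
          Set.BijOn (fun q => T (x q)) U (graphMap φ '' Ω)

end

end MinkSurf

open Topology

namespace MinkSurf

/-! ### Algebra of the indefinite form and of 2-vectors -/

/-! Write X₀, X₁ for the coordinate fields, A_n for the shape operator of a normal vector n, and h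
for the second fundamental form. Near each point let η be the null normal field with ⟨H, η⟩ = -1.
The Laplacian Δν is known through its pairings with bivectors of this frame. Its pairing with ν is
‖h‖² = 4⟨H, H⟩ - 2K = -2K (`bform_laplace_N`). Its pairings with n ∧ X_k give the normal derivative
of H, by Codazzi (`bform_laplace_normal_tangent`). Its pairing with H ∧ η is the commutator of A_H
and A_η up to a factor (`bform_laplace_normal_normal`). As H is null, Δν and ν are both orthogonal
to H ∧ X_k, so Δν = f(ν + C) forces C ⟂ H ∧ X_k wherever f ≠ 0. The operator A_H is symmetric and
trace-free; the proof splits according to whether it vanishes where f ≠ 0.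

If A_H ≠ 0 at such a point, differentiating these orthogonality relations twice gives C = 0
(`const_eq_zero`). Then Δν = fν, so H is parallel and A_H commutes with A_η. Hence dη = dX + l dH
with l locally constant, and for a constant vector y the field X + y is normal with ⟨H, X + y⟩ = -1
(`exists_isNormalTranslate`). So ⟨x + y, x + y⟩ is constant, and it is not zero because f = -2K is
not. Conversely, on a quadric A_{x+y} is a multiple of the identity, and Δν = -2Kν.

If A_H = 0 near such a point, H has a constant direction ξ and the surface lies in a null
hyperplane. It is then locally a graph of height φ = ψ + c₁u + c₂v over a Euclidean plane spanned by
a, b, with flat metric. For a suitable C one has ν + C = ε(ψ_u ξ∧b - ψ_v ξ∧a) with ε = ±1, and Δν is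
the same expression with Δψ in place of ψ. So the equation says d(Δψ) = f dψ: where dψ ≠ 0, Δψ is
locally a function F of ψ with F' = f. For the converse f must be smooth at critical points of ψ as
well; there Δψ ≠ 0, because H ≠ 0, and Hadamard division applies (`exists_smooth_ratio`).

Both cases need a passage from local to global with smooth data only. The direction of the null
vector H, a point w of the Riemann sphere, satisfies a Beltrami equation w₁ = m w₀ because A_H is
trace-free (`pd_direction`). The properties "H has direction n" and "X + y is normal with ⟨H, X + y⟩
= -1" are vanishing conditions for solutions of the same equation (`pd_light_of_symm`). Such
solutions continue uniquely: the logarithm of the modulus is annihilated by a real elliptic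
operator, and the maximum principle with a barrier finishes the argument
(`eq_zero_of_eq_zero_on_ball`). -/

lemma form_comm (a b : E41) : form a b = form b a := by unfold form; ring

lemma form_add_left (a b c : E41) : form (a + b) c = form a c + form b c := by
  simp only [form, Pi.add_apply]; ring

lemma form_add_right (a b c : E41) : form a (b + c) = form a b + form a c := by
  simp only [form, Pi.add_apply]; ring

lemma form_sub_left (a b c : E41) : form (a - b) c = form a c - form b c := by
  simp only [form, Pi.sub_apply]; ring

lemma form_sub_right (a b c : E41) : form a (b - c) = form a b - form a c := by
  simp only [form, Pi.sub_apply]; ring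

lemma form_smul_left (t : ℝ) (a b : E41) : form (t • a) b = t * form a b := by
  simp only [form, Pi.smul_apply, smul_eq_mul]; ring

lemma form_smul_right (t : ℝ) (a b : E41) : form a (t • b) = t * form a b := by
  simp only [form, Pi.smul_apply, smul_eq_mul]; ring

lemma form_zero_left (a : E41) : form 0 a = 0 := by simp [form]

lemma form_zero_right (a : E41) : form a 0 = 0 := by simp [form]

lemma wedge_add_left (a b c : E41) : wedge (a + b) c = wedge a c + wedge b c := by
  ext ij; simp only [wedge, Pi.add_apply]; ring

lemma wedge_add_right (a b c : E41) : wedge a (b + c) = wedge a b + wedge a c := by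
  ext ij; simp only [wedge, Pi.add_apply]; ring

lemma wedge_smul_left (t : ℝ) (a b : E41) : wedge (t • a) b = t • wedge a b := by
  ext ij; simp only [wedge, Pi.smul_apply, smul_eq_mul]; ring

lemma wedge_smul_right (t : ℝ) (a b : E41) : wedge a (t • b) = t • wedge a b := by
  ext ij; simp only [wedge, Pi.smul_apply, smul_eq_mul]; ring

/-- The indefinite form as a continuous bilinear map. -/
noncomputable def formL : E41 →L[ℝ] E41 →L[ℝ] ℝ :=
  LinearMap.toContinuousLinearMap
    ((LinearMap.toContinuousLinearMap (𝕜 := ℝ) (E := E41) (F' := ℝ)).toLinearMap ∘ₗ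
      LinearMap.mk₂ ℝ form form_add_left form_smul_left form_add_right form_smul_right)

/-- The wedge product as a continuous bilinear map. -/
noncomputable def wedgeL : E41 →L[ℝ] E41 →L[ℝ] Bivector :=
  LinearMap.toContinuousLinearMap
    ((LinearMap.toContinuousLinearMap (𝕜 := ℝ) (E := E41) (F' := Bivector)).toLinearMap ∘ₗ
      LinearMap.mk₂ ℝ wedge wedge_add_left wedge_smul_left wedge_add_right wedge_smul_right)

/-! ### Calculus of partial derivatives -/

section Calculus

variable {V W : Type*} [NormedAddCommGroup V] [NormedSpace ℝ V] [NormedAddCommGroup W]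
  [NormedSpace ℝ W] {q : Plane} (i j : Fin 2)

lemma _root_.ContDiffAt.diff {G : Plane → V} (h : ContDiffAt ℝ ∞ G q) : DifferentiableAt ℝ G q :=
  h.differentiableAt (by simp)

lemma contDiffAt_pd {G : Plane → V} (h : ContDiffAt ℝ ∞ G q) : ContDiffAt ℝ ∞ (pd i G) q := by
  unfold pd
  exact (h.fderiv_right (m := ∞) (by simp)).clm_apply contDiffAt_const

lemma pd_eventuallyEq {F G : Plane → V} (h : F =ᶠ[𝓝 q] G) : pd i F q = pd i G q := by
  unfold pd; rw [h.fderiv_eq]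

lemma pd_eventuallyEq' {F G : Plane → V} (h : F =ᶠ[𝓝 q] G) : pd i F =ᶠ[𝓝 q] pd i G := by
  filter_upwards [h.eventuallyEq_nhds] with w hw using pd_eventuallyEq i hw

lemma pd_congr {F G : Plane → V} {S : Set Plane} (hS : IsOpen S) (h : ∀ w ∈ S, F w = G w)
    (hq : q ∈ S) : pd i F q = pd i G q :=
  pd_eventuallyEq i (Filter.eventuallyEq_of_mem (hS.mem_nhds hq) h)

lemma pd_comm {G : Plane → V} (h : ContDiffAt ℝ ∞ G q) :
    pd i (pd j G) q = pd j (pd i G) q := by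
  have h1 : ∀ k : Fin 2, ∀ v, fderiv ℝ (pd k G) q v
      = fderiv ℝ (fderiv ℝ G) q v (EuclideanSpace.single k 1) := by
    intro k v
    unfold pd
    rw [fderiv_clm_apply (ContDiffAt.diff (h.fderiv_right (m := ∞) (by simp)))
      (differentiableAt_const _)]
    simp
  have h2 := h.isSymmSndFDerivAt (by simp only [minSmoothness_of_isRCLikeNormedField]; exact ENat.LEInfty.out)
  change fderiv ℝ (pd j G) q _ = fderiv ℝ (pd i G) q _
  rw [h1, h1]
  exact h2 _ _

lemma pd_const (c : V) : pd i (fun _ => c) q = 0 := by simp [pd]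

lemma pd_add {F G : Plane → V} (hF : DifferentiableAt ℝ F q) (hG : DifferentiableAt ℝ G q) :
    pd i (fun w => F w + G w) q = pd i F q + pd i G q := by
  unfold pd; rw [fderiv_fun_add hF hG]; rfl

lemma pd_sub {F G : Plane → V} (hF : DifferentiableAt ℝ F q) (hG : DifferentiableAt ℝ G q) :
    pd i (fun w => F w - G w) q = pd i F q - pd i G q := by
  unfold pd; rw [fderiv_fun_sub hF hG]; rfl

lemma pd_neg {F : Plane → V} : pd i (fun w => -F w) q = -pd i F q := by
  unfold pd; rw [fderiv_fun_neg]; rfl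

lemma pd_smul {f : Plane → ℝ} {G : Plane → V} (hf : DifferentiableAt ℝ f q)
    (hG : DifferentiableAt ℝ G q) :
    pd i (fun w => f w • G w) q = f q • pd i G q + pd i f q • G q := by
  unfold pd; rw [fderiv_fun_smul hf hG]; simp

lemma pd_mul {f g : Plane → ℝ} (hf : DifferentiableAt ℝ f q) (hg : DifferentiableAt ℝ g q) :
    pd i (fun w => f w * g w) q = f q * pd i g q + pd i f q * g q := by
  unfold pd; rw [fderiv_fun_mul hf hg]; simp [mul_comm]

lemma pd_clm (L : V →L[ℝ] W) {G : Plane → V} (hG : DifferentiableAt ℝ G q) :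
    pd i (fun w => L (G w)) q = L (pd i G q) := by
  unfold pd
  have := (L.hasFDerivAt.comp q hG.hasFDerivAt).fderiv
  change (fderiv ℝ (L ∘ G) q) _ = _
  rw [this]; rfl

lemma pd_apply {ι : Type*} [Fintype ι] {G : Plane → ι → ℝ} (hG : DifferentiableAt ℝ G q)
    (k : ι) : pd i (fun w => G w k) q = pd i G q k :=
  pd_clm i (ContinuousLinearMap.proj (R := ℝ) (φ := fun _ : ι => ℝ) k) hG

lemma pd_bilin {E F G : Type*} [NormedAddCommGroup E] [NormedSpace ℝ E] [NormedAddCommGroup F]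
    [NormedSpace ℝ F] [NormedAddCommGroup G] [NormedSpace ℝ G] (B : E →L[ℝ] F →L[ℝ] G)
    {a : Plane → E} {b : Plane → F} (ha : DifferentiableAt ℝ a q) (hb : DifferentiableAt ℝ b q) :
    pd i (fun w => B (a w) (b w)) q = B (pd i a q) (b q) + B (a q) (pd i b q) := by
  unfold pd
  rw [B.fderiv_of_bilinear ha hb]
  simp [add_comm]

lemma pd_form {a b : Plane → E41} (ha : DifferentiableAt ℝ a q) (hb : DifferentiableAt ℝ b q) :
    pd i (fun w => form (a w) (b w)) q = form (pd i a q) (b q) + form (a q) (pd i b q) :=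
  pd_bilin i formL ha hb

lemma pd_wedge {a b : Plane → E41} (ha : DifferentiableAt ℝ a q) (hb : DifferentiableAt ℝ b q) :
    pd i (fun w => wedge (a w) (b w)) q = wedge (pd i a q) (b q) + wedge (a q) (pd i b q) :=
  pd_bilin i wedgeL ha hb

lemma contDiffAt_form {a b : Plane → E41} (ha : ContDiffAt ℝ ∞ a q) (hb : ContDiffAt ℝ ∞ b q) :
    ContDiffAt ℝ ∞ (fun w => form (a w) (b w)) q :=
  (formL.contDiff.contDiffAt.comp q ha).clm_apply hb

lemma contDiffAt_wedge {a b : Plane → E41} (ha : ContDiffAt ℝ ∞ a q) (hb : ContDiffAt ℝ ∞ b q) :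
    ContDiffAt ℝ ∞ (fun w => wedge (a w) (b w)) q :=
  (wedgeL.contDiff.contDiffAt.comp q ha).clm_apply hb

lemma fderiv_eq_pd (G : Plane → V) (v : Plane) :
    fderiv ℝ G q v = v 0 • pd 0 G q + v 1 • pd 1 G q := by
  have : v = v 0 • EuclideanSpace.single 0 1 + v 1 • EuclideanSpace.single 1 1 := by
    ext k; fin_cases k <;> simp
  conv_lhs => rw [this]
  rw [map_add, map_smul, map_smul]; rfl

lemma pd_comp {G : Plane → V} {τ : Plane → Plane} (hG : DifferentiableAt ℝ G (τ q))
    (hτ : DifferentiableAt ℝ τ q) :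
    pd i (fun w => G (τ w)) q = (pd i τ q) 0 • pd 0 G (τ q) + (pd i τ q) 1 • pd 1 G (τ q) := by
  unfold pd
  have := (hG.hasFDerivAt.comp q hτ.hasFDerivAt).fderiv
  change (fderiv ℝ (G ∘ τ) q) _ = _
  rw [this, ContinuousLinearMap.comp_apply, fderiv_eq_pd]; rfl

lemma pd_coord (k : Fin 2) : pd i (fun w : Plane => w k) q = if i = k then 1 else 0 := by
  have h : pd i (fun w : Plane => w k) q = (pd i (fun w : Plane => w) q) k :=
    pd_clm i (EuclideanSpace.proj k : Plane →L[ℝ] ℝ) differentiableAt_id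
  have h' : pd i (fun w : Plane => w) q = EuclideanSpace.single i 1 := by simp [pd]
  rw [h, h']; simp [eq_comm]

lemma pd_plane_apply {τ : Plane → Plane} (hτ : DifferentiableAt ℝ τ q) (k : Fin 2) :
    pd i (fun w => τ w k) q = (pd i τ q) k :=
  pd_clm i (EuclideanSpace.proj k : Plane →L[ℝ] ℝ) hτ

end Calculus

/-! ### Unique continuation for solutions of a Beltrami equation -/

lemma pd_eq_zero_of_isLocalMax {Φ : Plane → ℝ} {z : Plane} (h : IsLocalMax Φ z) (i : Fin 2) :
    pd i Φ z = 0 := by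
  unfold pd; rw [h.fderiv_eq_zero]; rfl

lemma hessian_nonpos_of_isLocalMax {Φ : Plane → ℝ} {z : Plane} (hΦ : ContDiffAt ℝ ∞ Φ z)
    (h : IsLocalMax Φ z) (v : Plane) :
    v 0 * (v 0 * pd 0 (pd 0 Φ) z + v 1 * pd 0 (pd 1 Φ) z)
      + v 1 * (v 0 * pd 1 (pd 0 Φ) z + v 1 * pd 1 (pd 1 Φ) z) ≤ 0 := by
  by_contra! hpos
  have hline : ∀ t : ℝ, HasDerivAt (fun t : ℝ => z + t • v) v t := by
    intro t
    simpa using ((hasDerivAt_id t).smul_const v).const_add z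
  have hc0 : Filter.Tendsto (fun t : ℝ => z + t • v) (𝓝 0) (𝓝 z) := by
    have := (hline 0).continuousAt.tendsto
    simpa using this
  have hd : ∀ᶠ w in 𝓝 z, DifferentiableAt ℝ Φ w := by
    have h2 : ContDiffAt ℝ 1 Φ z := hΦ.of_le (by simp)
    filter_upwards [h2.eventually (by simp)] with w hw using hw.differentiableAt (by simp)
  have h1 : ∀ G : Plane → ℝ, ∀ t : ℝ, DifferentiableAt ℝ G (z + t • v) →
      HasDerivAt (fun t : ℝ => G (z + t • v))
        (v 0 * pd 0 G (z + t • v) + v 1 * pd 1 G (z + t • v)) t := by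
    intro G t hG
    have := hG.hasFDerivAt.comp_hasDerivAt t (hline t)
    rw [fderiv_eq_pd] at this
    exact this
  have hder : deriv (fun t : ℝ => Φ (z + t • v)) =ᶠ[𝓝 0]
      fun t => v 0 * pd 0 Φ (z + t • v) + v 1 * pd 1 Φ (z + t • v) := by
    filter_upwards [hc0.eventually hd] with t ht using (h1 Φ t ht).deriv
  have hz : z + (0 : ℝ) • v = z := by simp
  have e0 : HasDerivAt (fun t : ℝ => pd 0 Φ (z + t • v)) _ 0 :=
    h1 _ 0 (by rw [hz]; exact (contDiffAt_pd 0 hΦ).diff)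
  have e1 : HasDerivAt (fun t : ℝ => pd 1 Φ (z + t • v)) _ 0 :=
    h1 _ 0 (by rw [hz]; exact (contDiffAt_pd 1 hΦ).diff)
  have hdd : deriv (deriv (fun t : ℝ => Φ (z + t • v))) 0 > 0 := by
    rw [hder.deriv_eq, ((e0.const_mul (v 0)).fun_add (e1.const_mul (v 1))).deriv, hz]
    linarith
  have hd0 : deriv (fun t : ℝ => Φ (z + t • v)) 0 = 0 := by
    rw [hder.eq_of_nhds, hz, pd_eq_zero_of_isLocalMax h, pd_eq_zero_of_isLocalMax h]; simp
  have hcont : ContinuousAt (fun t : ℝ => Φ (z + t • v)) 0 :=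
    (h1 Φ 0 (by rw [hz]; exact hΦ.diff)).continuousAt
  -- A positive second derivative makes 0 a local minimum of the restriction to the line. Being also
  -- a local maximum, the restriction is locally constant, which contradicts the positive second
  -- derivative.
  have hmin := isLocalMin_of_deriv_deriv_pos hdd hd0 hcont
  have hconst : (fun t : ℝ => Φ (z + t • v)) =ᶠ[𝓝 0] fun _ => Φ z := by
    filter_upwards [hmin, hc0.eventually h] with t h1 h2
    rw [hz] at h1
    exact le_antisymm h2 h1
  have : deriv (fun t : ℝ => Φ (z + t • v)) =ᶠ[𝓝 0] fun _ => (0 : ℝ) := by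
    filter_upwards [hconst.eventuallyEq_nhds] with t ht
    rw [ht.deriv_eq]; simp
  rw [this.deriv_eq] at hdd
  simp at hdd

/-- The real and the imaginary part `a`, `b` of a solution of `∂₁ w = (α + i β) ∂₀ w`. -/
structure IsBeltrami (α β a b : Plane → ℝ) (V : Set Plane) : Prop where
  isOpen : IsOpen V
  coeff_re : ∀ q ∈ V, ContDiffAt ℝ ∞ α q
  coeff_im : ∀ q ∈ V, ContDiffAt ℝ ∞ β q
  coeff_ne : ∀ q ∈ V, β q ≠ 0
  re : ∀ q ∈ V, ContDiffAt ℝ ∞ a q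
  im : ∀ q ∈ V, ContDiffAt ℝ ∞ b q
  eq_re : ∀ q ∈ V, pd 1 a q = α q * pd 0 a q - β q * pd 0 b q
  eq_im : ∀ q ∈ V, pd 1 b q = α q * pd 0 b q + β q * pd 0 a q

/-- Real and imaginary part of `∂₁ m - conj m * ∂₀ m` for `m = α + i β`. -/
noncomputable def driftRe (α β : Plane → ℝ) (q : Plane) : ℝ :=
  pd 1 α q - (α q * pd 0 α q + β q * pd 0 β q)

noncomputable def driftIm (α β : Plane → ℝ) (q : Plane) : ℝ :=
  pd 1 β q - (α q * pd 0 β q - β q * pd 0 α q)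

/-- The product (∂₁ - m̄ ∂₀)(∂₁ - m ∂₀) has the complex first-order term -(∂₁m - m̄ ∂₀m) ∂₀. On
solutions i β ∂₀ equals ∂₁ - α ∂₀, so its imaginary part can be traded for a real drift. -/
noncomputable def drift₁ (α β : Plane → ℝ) (q : Plane) : ℝ := -driftIm α β q / β q

noncomputable def drift₀ (α β : Plane → ℝ) (q : Plane) : ℝ :=
  -driftRe α β q - drift₁ α β q * α q

/-- A second order elliptic operator that annihilates the solutions of the Beltrami equation and
the logarithms of their absolute values. -/
noncomputable def ellipticOp (α β : Plane → ℝ) (u : Plane → ℝ) (q : Plane) : ℝ :=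
  (α q ^ 2 + β q ^ 2) * pd 0 (pd 0 u) q - 2 * α q * pd 0 (pd 1 u) q + pd 1 (pd 1 u) q
    + drift₀ α β q * pd 0 u q + drift₁ α β q * pd 1 u q

lemma ellipticOp_nonpos_of_isLocalMax {α β Φ : Plane → ℝ} {z : Plane}
    (hΦ : ContDiffAt ℝ ∞ Φ z) (h : IsLocalMax Φ z) : ellipticOp α β Φ z ≤ 0 := by
  -- The principal symbol is the sum of the squares of the directions (-α, 1) and (β, 0), so the
  -- second derivatives along these two suffice.
  have h1 := hessian_nonpos_of_isLocalMax hΦ h !₂[-α z, 1]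
  have h2 := hessian_nonpos_of_isLocalMax hΦ h !₂[β z, 0]
  simp only [ellipticOp, pd_eq_zero_of_isLocalMax h]
  rw [pd_comm 1 0 hΦ] at h1 h2
  simp at h1 h2
  nlinarith

lemma ellipticOp_add {α β u v : Plane → ℝ} {q : Plane} (hu : ContDiffAt ℝ ∞ u q)
    (hv : ContDiffAt ℝ ∞ v q) :
    ellipticOp α β (fun w => u w + v w) q = ellipticOp α β u q + ellipticOp α β v q := by
  have hd : ∀ f : Plane → ℝ, ContDiffAt ℝ ∞ f q → ∀ᶠ w in 𝓝 q, DifferentiableAt ℝ f w := by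
    intro f hf
    have h2 : ContDiffAt ℝ 1 f q := hf.of_le (by simp)
    filter_upwards [h2.eventually (by simp)] with w hw using hw.differentiableAt (by simp)
  have h1 : ∀ i, pd i (fun w => u w + v w) =ᶠ[𝓝 q] fun w => pd i u w + pd i v w := by
    intro i
    filter_upwards [hd u hu, hd v hv] with w h1 h2 using pd_add i h1 h2
  have h2 : ∀ i j, pd i (pd j (fun w => u w + v w)) q = pd i (pd j u) q + pd i (pd j v) q := by
    intro i j
    rw [pd_eventuallyEq i (h1 j), pd_add i (contDiffAt_pd j hu).diff (contDiffAt_pd j hv).diff]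
  simp only [ellipticOp, h2, (h1 _).eq_of_nhds]
  ring

lemma ellipticOp_const_mul {α β u : Plane → ℝ} {q : Plane} (N : ℝ) :
    ellipticOp α β (fun w => N * u w) q = N * ellipticOp α β u q := by
  have h1 : ∀ (i : Fin 2) (f : Plane → ℝ), pd i (fun w => N * f w) = fun w => N * pd i f w := by
    intro i f
    funext w
    unfold pd
    have : (fun w => N * f w) = N • f := rfl
    rw [this, fderiv_const_smul_field]; rfl
  simp only [ellipticOp, h1]
  ring

namespace IsBeltrami

variable {α β a b : Plane → ℝ} {V : Set Plane}

/-- Where w = a + i b is non-zero, log w solves the same Beltrami equation, so the real operator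
annihilates it and its real part. The computation needs no branch of the logarithm: it works with P
= |w|² and P ∂(log P) = ∂P. -/
lemma ellipticOp_log (h : IsBeltrami α β a b V) {q : Plane} (hq : q ∈ V)
    (hne : 0 < a q ^ 2 + b q ^ 2) :
    ellipticOp α β (fun w => Real.log (a w ^ 2 + b w ^ 2)) q = 0 := by
  set P : Plane → ℝ := fun w => a w ^ 2 + b w ^ 2 with hP
  set ℓ : Plane → ℝ := fun w => Real.log (P w) with hℓ
  have ha := h.re q hq
  have hb := h.im q hq
  have hPs : ∀ w ∈ V, ContDiffAt ℝ ∞ P w := fun w hw => ((h.re w hw).pow 2).add ((h.im w hw).pow 2)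
  have hev : ∀ᶠ w in 𝓝 q, w ∈ V ∧ 0 < P w :=
    Filter.Eventually.and (h.isOpen.mem_nhds hq) ((hPs q hq).continuousAt.eventually (lt_mem_nhds hne))
  have hℓs : ContDiffAt ℝ ∞ ℓ q := (hPs q hq).log hne.ne'
  have f1 : ∀ i, (fun w => P w * pd i ℓ w) =ᶠ[𝓝 q]
      fun w => 2 * (a w * pd i a w + b w * pd i b w) := by
    intro i
    filter_upwards [hev] with w hw
    have e1 : pd i ℓ w = (P w)⁻¹ * pd i P w := by
      unfold pd
      rw [hℓ]
      have := (((hPs w hw.1).diff.hasFDerivAt).log hw.2.ne').fderiv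
      rw [this]; simp
    have e2 : pd i P w = 2 * (a w * pd i a w + b w * pd i b w) := by
      have da := (h.re w hw.1).diff
      have db := (h.im w hw.1).diff
      have : P = fun w => a w * a w + b w * b w := by funext w; simp only [hP]; ring
      rw [this, pd_add i (da.fun_mul da) (db.fun_mul db), pd_mul i da da, pd_mul i db db]; ring
    rw [e1, e2, mul_inv_cancel_left₀ hw.2.ne']
  have f2 : ∀ i j, P q * pd j (pd i ℓ) q + pd j P q * pd i ℓ q
      = 2 * ((a q * pd j (pd i a) q + pd j a q * pd i a q)
        + (b q * pd j (pd i b) q + pd j b q * pd i b q)) := by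
    intro i j
    rw [← pd_mul j (hPs q hq).diff (contDiffAt_pd i hℓs).diff, pd_eventuallyEq j (f1 i)]
    have d1 := ha.diff.fun_mul (contDiffAt_pd i ha).diff
    have d2 := hb.diff.fun_mul (contDiffAt_pd i hb).diff
    rw [pd_mul j (differentiableAt_const _) (d1.fun_add d2), pd_add j d1 d2,
      pd_mul j ha.diff (contDiffAt_pd i ha).diff, pd_mul j hb.diff (contDiffAt_pd i hb).diff,
      pd_const]
    ring
  have f3 : ∀ i, pd i P q = 2 * (a q * pd i a q + b q * pd i b q) := by
    intro i
    have : P = fun w => a w * a w + b w * b w := by funext w; simp only [hP]; ring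
    rw [this, pd_add i (ha.diff.fun_mul ha.diff) (hb.diff.fun_mul hb.diff), pd_mul i ha.diff ha.diff,
      pd_mul i hb.diff hb.diff]; ring
  have f0 := fun i => (f1 i).eq_of_nhds
  have dα := (h.coeff_re q hq).diff
  have dβ := (h.coeff_im q hq).diff
  have da0 := (contDiffAt_pd 0 ha).diff
  have db0 := (contDiffAt_pd 0 hb).diff
  have g1 : ∀ i, pd i (pd 1 a) q = (α q * pd i (pd 0 a) q + pd i α q * pd 0 a q)
      - (β q * pd i (pd 0 b) q + pd i β q * pd 0 b q) := by
    intro i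
    rw [pd_congr i h.isOpen h.eq_re hq, pd_sub i (dα.fun_mul da0) (dβ.fun_mul db0), pd_mul i dα da0,
      pd_mul i dβ db0]
  have g2 : ∀ i, pd i (pd 1 b) q = (α q * pd i (pd 0 b) q + pd i α q * pd 0 b q)
      + (β q * pd i (pd 0 a) q + pd i β q * pd 0 a q) := by
    intro i
    rw [pd_congr i h.isOpen h.eq_im hq, pd_add i (dα.fun_mul db0) (dβ.fun_mul da0), pd_mul i dα db0,
      pd_mul i dβ da0]
  have c1 := pd_comm 0 1 ha
  have c2 := pd_comm 0 1 hb
  have hβ := h.coeff_ne q hq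
  have k1 := h.eq_re q hq
  have k2 := h.eq_im q hq
  have hd1 : drift₁ α β q * β q = -driftIm α β q := by
    unfold drift₁; field_simp
  -- The factor P² clears the denominators of the second derivatives of log P.
  have hP2 : P q ^ 2 ≠ 0 := pow_ne_zero 2 hne.ne'
  refine (mul_eq_zero.1 (?_ : P q ^ 2 * _ = 0)).resolve_left hP2
  have f00 := f2 0 0
  have f01 := f2 1 0
  have f11 := f2 1 1
  have l0 := f0 0
  have l1 := f0 1
  have hPq : P q = a q ^ 2 + b q ^ 2 := rfl
  simp only [f3] at f00 f01 f11
  have g10 := g1 0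
  have g11 := g1 1
  have g20 := g2 0
  have g21 := g2 1
  have hd0 : drift₀ α β q = -driftRe α β q - drift₁ α β q * α q := rfl
  have hre : driftRe α β q = pd 1 α q - (α q * pd 0 α q + β q * pd 0 β q) := rfl
  have him : driftIm α β q = pd 1 β q - (α q * pd 0 β q - β q * pd 0 α q) := rfl
  unfold ellipticOp
  rw [hd0]
  generalize pd 0 (pd 0 ℓ) q = L00 at *
  generalize pd 0 (pd 1 ℓ) q = L01 at *
  generalize pd 1 (pd 1 ℓ) q = L11 at *
  generalize pd 0 ℓ q = L0 at *
  generalize pd 1 ℓ q = L1 at *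
  generalize drift₁ α β q = d at *
  generalize driftRe α β q = r at *
  generalize driftIm α β q = s at *
  generalize pd 0 (pd 0 a) q = a00 at *
  generalize pd 0 (pd 1 a) q = a01 at *
  generalize pd 1 (pd 0 a) q = a10 at *
  generalize pd 1 (pd 1 a) q = a11 at *
  generalize pd 0 (pd 0 b) q = b00 at *
  generalize pd 0 (pd 1 b) q = b01 at *
  generalize pd 1 (pd 0 b) q = b10 at *
  generalize pd 1 (pd 1 b) q = b11 at *
  generalize pd 0 a q = a0 at *
  generalize pd 0 b q = b0 at *
  generalize pd 1 a q = a1 at *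
  generalize pd 1 b q = b1 at *
  generalize P q = p at *
  subst c1 c2 k1 k2
  generalize pd 0 α q = α0 at *
  generalize pd 1 α q = α1 at *
  generalize pd 0 β q = β0 at *
  generalize pd 1 β q = β1 at *
  generalize α q = A at *
  generalize β q = B at *
  generalize a q = x at *
  generalize b q = y at *
  clear f0 f1 f2 f3 g1 g2
  have hL0 : p * L0 = 2 * (x * a0 + y * b0) := l0
  have hL1 : p * L1 = 2 * (x * (A * a0 - B * b0) + y * (A * b0 + B * a0)) := l1
  have e00 : p ^ 2 * L00 = p * (2 * (x * a00 + a0 * a0 + (y * b00 + b0 * b0)))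
      - (2 * (x * a0 + y * b0)) * (p * L0) := by linear_combination p * f00
  have e01 : p ^ 2 * L01 = p * (2 * (x * a01 + a0 * (A * a0 - B * b0) + (y * b01 + b0 * (A * b0 + B * a0))))
      - (2 * (x * a0 + y * b0)) * (p * L1) := by linear_combination p * f01
  have e11 : p ^ 2 * L11 = p * (2 * (x * a11 + (A * a0 - B * b0) * (A * a0 - B * b0) + (y * b11 + (A * b0 + B * a0) * (A * b0 + B * a0))))
      - (2 * (x * (A * a0 - B * b0) + y * (A * b0 + B * a0))) * (p * L1) := by linear_combination p * f11
  have key : p ^ 2 * ((A ^ 2 + B ^ 2) * L00 - 2 * A * L01 + L11 + (-r - d * A) * L0 + d * L1)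
      = (A ^ 2 + B ^ 2) * (p ^ 2 * L00) - 2 * A * (p ^ 2 * L01) + p ^ 2 * L11
        + p * (-r * (p * L0) + d * (p * L1 - A * (p * L0))) := by ring
  rw [key, e00, e01, e11, hL0, hL1]
  have hdB : d * (2 * (x * (A * a0 - B * b0) + y * (A * b0 + B * a0)) - A * (2 * (x * a0 + y * b0)))
     = -s * (2 * (y * a0 - x * b0)) := by linear_combination (2 * (y * a0 - x * b0)) * hd1
  rw [hdB, hre, him, g11, g21, g10, g20, hPq]
  ring

end IsBeltrami

/-- The squared distance from `c`. -/
noncomputable def sqDist (c q : Plane) : ℝ := (q 0 - c 0) ^ 2 + (q 1 - c 1) ^ 2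

lemma sqDist_eq (c q : Plane) : sqDist c q = dist q c ^ 2 := by
  rw [EuclideanSpace.dist_eq, Real.sq_sqrt (by positivity), Fin.sum_univ_two, Real.dist_eq,
    Real.dist_eq, sq_abs, sq_abs, sqDist]

lemma contDiff_coord (k : Fin 2) : ContDiff ℝ ∞ (fun q : Plane => q k) :=
  (EuclideanSpace.proj k : Plane →L[ℝ] ℝ).contDiff

lemma contDiff_sqDist (c : Plane) : ContDiff ℝ ∞ (sqDist c) :=
  (((contDiff_coord 0).sub contDiff_const).pow 2).add
    (((contDiff_coord 1).sub contDiff_const).pow 2)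

/-- A barrier function that vanishes on the circle of radius `R` about `c`. -/
noncomputable def barrier (c : Plane) (k R : ℝ) (q : Plane) : ℝ :=
  Real.exp (-k * sqDist c q) - Real.exp (-k * R ^ 2)

lemma contDiff_barrier (c : Plane) (k R : ℝ) : ContDiff ℝ ∞ (barrier c k R) :=
  ((contDiff_const.mul (contDiff_sqDist c)).exp).sub contDiff_const

lemma pd_sqDist (c q : Plane) (i : Fin 2) : pd i (sqDist c) q = 2 * (q i - c i) := by
  have d : ∀ k : Fin 2, DifferentiableAt ℝ (fun w : Plane => w k - c k) q :=
    fun k => ((contDiff_coord k).sub contDiff_const).contDiffAt.diff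
  have e : ∀ k : Fin 2, pd i (fun w : Plane => w k - c k) q = if i = k then 1 else 0 := by
    intro k
    rw [pd_sub i (contDiff_coord k).contDiffAt.diff (differentiableAt_const _), pd_coord, pd_const,
      sub_zero]
  have : sqDist c = fun w : Plane =>
      (w 0 - c 0) * (w 0 - c 0) + (w 1 - c 1) * (w 1 - c 1) := by
    funext w; simp only [sqDist]; ring
  rw [this, pd_add i ((d 0).fun_mul (d 0)) ((d 1).fun_mul (d 1)), pd_mul i (d 0) (d 0),
    pd_mul i (d 1) (d 1), e, e]
  fin_cases i <;> simp <;> ring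

lemma pd_exp_sqDist (c q : Plane) (k : ℝ) (i : Fin 2) :
    pd i (fun w => Real.exp (-k * sqDist c w)) q
      = -2 * k * ((q i - c i) * Real.exp (-k * sqDist c q)) := by
  have h : HasFDerivAt (fun w => Real.exp (-k * sqDist c w))
      (Real.exp (-k * sqDist c q) • (-k) • fderiv ℝ (sqDist c) q) q :=
    (((contDiff_sqDist c).contDiffAt.diff.hasFDerivAt).const_mul (-k)).exp
  have h2 := pd_sqDist c q i
  unfold pd at h2 ⊢
  rw [h.fderiv]
  simp [h2]; ring

lemma pd_barrier (c : Plane) (k R : ℝ) (q : Plane) (i : Fin 2) :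
    pd i (barrier c k R) q = -2 * k * ((q i - c i) * Real.exp (-k * sqDist c q)) := by
  unfold barrier
  rw [pd_sub i ((contDiff_const.mul (contDiff_sqDist c)).exp).contDiffAt.diff
    (differentiableAt_const _), pd_exp_sqDist, pd_const, sub_zero]

lemma pd_pd_barrier (c : Plane) (k R : ℝ) (q : Plane) (i j : Fin 2) :
    pd i (pd j (barrier c k R)) q
      = (4 * k ^ 2 * ((q i - c i) * (q j - c j)) - 2 * k * (if i = j then 1 else 0))
        * Real.exp (-k * sqDist c q) := by
  have h : pd j (barrier c k R)
      = fun w => (-2 * k) * ((w j - c j) * Real.exp (-k * sqDist c w)) := by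
    funext w; rw [pd_barrier]
  have d1 : DifferentiableAt ℝ (fun w : Plane => w j - c j) q :=
    ((contDiff_coord j).sub contDiff_const).contDiffAt.diff
  have d2 : DifferentiableAt ℝ (fun w => Real.exp (-k * sqDist c w)) q :=
    ((contDiff_const.mul (contDiff_sqDist c)).exp).contDiffAt.diff
  rw [h, pd_mul i (differentiableAt_const _) (d1.fun_mul d2), pd_mul i d1 d2, pd_const,
    pd_exp_sqDist, pd_sub i (contDiff_coord j).contDiffAt.diff (differentiableAt_const _),
    pd_coord, pd_const]
  ring

namespace IsBeltrami

variable {α β a b : Plane → ℝ} {V : Set Plane}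

lemma exists_barrier (h : IsBeltrami α β a b V) {c : Plane} {R R₂ : ℝ} (hR : 0 < R)
    (hball : Metric.closedBall c R₂ ⊆ V) :
    ∃ k : ℝ, 0 < k ∧ ∀ q, R ≤ dist q c → dist q c ≤ R₂ →
      0 < ellipticOp α β (barrier c k R₂) q := by
  set K : Set Plane := Metric.closedBall c R₂ ∩ {q | R ≤ dist q c} with hK
  have hKc : IsCompact K := (isCompact_closedBall c R₂).inter_right
    (isClosed_le continuous_const (continuous_id.dist continuous_const))
  rcases K.eq_empty_or_nonempty with hKe | hKn
  · refine ⟨1, one_pos, fun q h1 h2 => ?_⟩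
    have : q ∈ K := ⟨h2, h1⟩
    rw [hKe] at this; exact this.elim
  -- S is the principal symbol at q - c, positive by ellipticity; B collects the terms of lower
  -- order in k. Applied to exp(-k|q - c|²), the operator gives 2k(2kS - B) times the exponential.
  set S : Plane → ℝ := fun q => ((q 1 - c 1) - α q * (q 0 - c 0)) ^ 2 + (β q * (q 0 - c 0)) ^ 2
    with hS
  set B : Plane → ℝ := fun q => (α q ^ 2 + β q ^ 2) + 1 + drift₀ α β q * (q 0 - c 0)
    + drift₁ α β q * (q 1 - c 1) with hB
  have hx : ∀ (k : Fin 2) (q : Plane), ContinuousAt (fun q : Plane => q k - c k) q := fun k q =>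
    ((contDiff_coord k).sub contDiff_const).contDiffAt.diff.continuousAt
  have hKV : ∀ q ∈ K, q ∈ V := fun q hq => hball hq.1
  have hα : ∀ q ∈ K, ContinuousAt α q := fun q hq => (h.coeff_re q (hKV q hq)).continuousAt
  have hβ : ∀ q ∈ K, ContinuousAt β q := fun q hq => (h.coeff_im q (hKV q hq)).continuousAt
  have hα' : ∀ i, ∀ q ∈ K, ContinuousAt (pd i α) q :=
    fun i q hq => (contDiffAt_pd i (h.coeff_re q (hKV q hq))).continuousAt
  have hβ' : ∀ i, ∀ q ∈ K, ContinuousAt (pd i β) q :=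
    fun i q hq => (contDiffAt_pd i (h.coeff_im q (hKV q hq))).continuousAt
  have hSc : ContinuousOn S K := fun q hq => ContinuousAt.continuousWithinAt
    ((((hx 1 q).sub ((hα q hq).mul (hx 0 q))).pow 2).add (((hβ q hq).mul (hx 0 q)).pow 2))
  have hd1 : ∀ q ∈ K, ContinuousAt (drift₁ α β) q := fun q hq =>
    ContinuousAt.div (((hβ' 1 q hq).sub
      (((hα q hq).mul (hβ' 0 q hq)).sub ((hβ q hq).mul (hα' 0 q hq)))).neg) (hβ q hq)
      (h.coeff_ne q (hKV q hq))
  have hd0 : ∀ q ∈ K, ContinuousAt (drift₀ α β) q := fun q hq =>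
    (((hα' 1 q hq).sub (((hα q hq).mul (hα' 0 q hq)).add ((hβ q hq).mul (hβ' 0 q hq)))).neg).sub
      ((hd1 q hq).mul (hα q hq))
  have hBc : ContinuousOn B K := fun q hq => ContinuousAt.continuousWithinAt
    ((((((hα q hq).pow 2).add ((hβ q hq).pow 2)).add continuousAt_const).add
      ((hd0 q hq).mul (hx 0 q))).add ((hd1 q hq).mul (hx 1 q)))
  obtain ⟨q₁, hq₁, hmin⟩ := hKc.exists_isMinOn hKn hSc
  obtain ⟨q₂, hq₂, hmax⟩ := hKc.exists_isMaxOn hKn hBc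
  have hSpos : 0 < S q₁ := by
    have hb := h.coeff_ne q₁ (hKV q₁ hq₁)
    by_contra hneg
    have h0 : S q₁ = 0 := le_antisymm (not_lt.1 hneg) (by simp only [hS]; positivity)
    simp only [hS] at h0
    have e1 : β q₁ * (q₁ 0 - c 0) = 0 := by
      nlinarith [sq_nonneg ((q₁ 1 - c 1) - α q₁ * (q₁ 0 - c 0)), sq_nonneg (β q₁ * (q₁ 0 - c 0))]
    have e2 : q₁ 0 - c 0 = 0 := (mul_eq_zero.1 e1).resolve_left hb
    rw [e2] at h0
    have e3 : q₁ 1 - c 1 = 0 := by nlinarith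
    have e4 := sqDist_eq c q₁
    rw [sqDist, e2, e3] at e4
    have := hq₁.2
    simp only [Set.mem_ofPred_eq] at this
    nlinarith
  -- With the minimum of S and the maximum of B on the annulus, this k gives kS ≥ |max B| + 1, so
  -- 2kS exceeds B.
  refine ⟨(|B q₂| + 1) / S q₁, by positivity, fun q h1 h2 => ?_⟩
  have hqK : q ∈ K := ⟨h2, h1⟩
  have m1 : S q₁ ≤ S q := hmin hqK
  have m2 : B q ≤ B q₂ := hmax hqK
  set k := (|B q₂| + 1) / S q₁ with hk
  have hkpos : 0 < k := by positivity
  have hkS : B q < 2 * k * S q := by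
    have : k * S q₁ = |B q₂| + 1 := by rw [hk]; field_simp
    have h3 : k * S q₁ ≤ k * S q := mul_le_mul_of_nonneg_left m1 hkpos.le
    have := le_abs_self (B q₂)
    nlinarith [abs_nonneg (B q₂)]
  have : ellipticOp α β (barrier c k R₂) q
      = 2 * k * (2 * k * S q - B q) * Real.exp (-k * sqDist c q) := by
    simp only [ellipticOp, pd_pd_barrier, pd_barrier, hS, hB]
    simp
    ring
  rw [this]
  have := Real.exp_pos (-k * sqDist c q)
  have h5 : 0 < 2 * k * S q - B q := by linarith
  positivity

/-- A three circles theorem: a solution that vanishes on a disc vanishes on all larger concentric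
discs. -/
theorem eq_zero_of_eq_zero_on_ball (h : IsBeltrami α β a b V) {c : Plane} {R R₂ : ℝ} (hR : 0 < R)
    (hball : Metric.closedBall c R₂ ⊆ V)
    (h0 : ∀ q ∈ Metric.ball c R, a q ^ 2 + b q ^ 2 = 0) :
    ∀ q ∈ Metric.ball c R₂, a q ^ 2 + b q ^ 2 = 0 := by
  intro p hp
  by_cases hpR : dist p c < R
  · exact h0 p hpR
  push Not at hpR
  obtain ⟨k, hk, hbar⟩ := h.exists_barrier hR hball
  set P : Plane → ℝ := fun w => a w ^ 2 + b w ^ 2 with hP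
  set θ := barrier c k R₂ with hθ
  have hPs : ∀ w ∈ V, ContDiffAt ℝ ∞ P w := fun w hw => ((h.re w hw).pow 2).add ((h.im w hw).pow 2)
  have hP0 : ∀ w, 0 ≤ P w := fun w => by simp only [hP]; positivity
  set K : Set Plane := Metric.closedBall c R₂ ∩ {q | R ≤ dist q c} with hK
  have hKc : IsCompact K := (isCompact_closedBall c R₂).inter_right
    (isClosed_le continuous_const (continuous_id.dist continuous_const))
  have hpK : p ∈ K := ⟨Metric.ball_subset_closedBall hp, hpR⟩
  have hPc : ContinuousOn P K := fun q hq => (hPs q (hball hq.1)).continuousAt.continuousWithinAt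
  obtain ⟨qA, -, hA⟩ := hKc.exists_isMaxOn ⟨p, hpK⟩ hPc
  have hθc : ContinuousOn θ K := (contDiff_barrier c k R₂).continuous.continuousOn
  -- A positive maximum of P exp(Nθ) over the annulus is not on the inner circle, where P vanishes
  -- by continuity, and not in the interior, where the elliptic operator is positive on log P + Nθ.
  -- So it is on the outer circle, where θ = 0, and the bound does not depend on N.
  have hbound : ∀ N : ℝ, 0 < N → P p * Real.exp (N * θ p) ≤ P qA := by
    intro N hN
    obtain ⟨z, hzK, hz⟩ := hKc.exists_isMaxOn ⟨p, hpK⟩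
      (hPc.mul (Real.continuous_exp.comp_continuousOn (continuousOn_const.mul hθc)) :
        ContinuousOn (fun q => P q * Real.exp (N * θ q)) K)
    refine le_trans (hz hpK) ?_
    change P z * Real.exp (N * θ z) ≤ P qA
    by_cases hPz : P z = 0
    · rw [hPz, zero_mul]; exact hP0 _
    have hPz' : 0 < P z := lt_of_le_of_ne (hP0 z) (Ne.symm hPz)
    have hzV := hball hzK.1
    have hzR : R < dist z c := by
      refine lt_of_le_of_ne hzK.2 fun heq => hPz ?_
      have hcl : z ∈ closure (Metric.ball c R) := by
        rw [closure_ball c hR.ne']; exact heq.ge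
      obtain ⟨u, hu, hlim⟩ := mem_closure_iff_seq_limit.1 hcl
      have t1 := (hPs z hzV).continuousAt.tendsto.comp hlim
      have t2 : P ∘ u = fun _ => (0 : ℝ) := by funext n; exact h0 (u n) (hu n)
      rw [t2] at t1
      exact tendsto_nhds_unique t1 tendsto_const_nhds
    rcases eq_or_lt_of_le (show dist z c ≤ R₂ from hzK.1) with hzR₂ | hzR₂
    · have : θ z = 0 := by
        rw [hθ, barrier, sqDist_eq, hzR₂, sub_self]
      rw [this, mul_zero, Real.exp_zero, mul_one]
      exact hA hzK
    exfalso
    have hmax : IsLocalMax (fun w => Real.log (P w) + N * θ w) z := by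
      have n1 : ∀ᶠ w in 𝓝 z, R < dist w c ∧ dist w c < R₂ :=
        ((continuous_id.dist continuous_const).continuousAt.eventually (lt_mem_nhds hzR)).and
          ((continuous_id.dist continuous_const).continuousAt.eventually (gt_mem_nhds hzR₂))
      have n2 : ∀ᶠ w in 𝓝 z, 0 < P w :=
        (hPs z hzV).continuousAt.eventually (lt_mem_nhds hPz')
      filter_upwards [n1, n2] with w hw hPw
      have : P w * Real.exp (N * θ w) ≤ P z * Real.exp (N * θ z) :=
        hz (show w ∈ K from ⟨hw.2.le, hw.1.le⟩)
      have h2 := Real.log_le_log (by positivity) this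
      rw [Real.log_mul hPw.ne' (Real.exp_ne_zero _), Real.log_mul hPz'.ne' (Real.exp_ne_zero _),
        Real.log_exp, Real.log_exp] at h2
      exact h2
    have hl : ContDiffAt ℝ ∞ (fun w => Real.log (P w)) z := (hPs z hzV).log hPz
    have hs : ContDiffAt ℝ ∞ (fun w => N * θ w) z :=
      (contDiff_const.mul (contDiff_barrier c k R₂)).contDiffAt
    have e1 := ellipticOp_nonpos_of_isLocalMax (α := α) (β := β) (hl.add hs) hmax
    have e2 := ellipticOp_add (α := α) (β := β) hl hs
    rw [h.ellipticOp_log hzV hPz', ellipticOp_const_mul] at e2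
    have e3 := hbar z hzR.le hzR₂.le
    have e4 : 0 < N * ellipticOp α β θ z := mul_pos hN e3
    linarith
  have hθp : 0 < θ p := by
    rw [hθ, barrier, sub_pos, Real.exp_lt_exp, sqDist_eq]
    have : dist p c < R₂ := hp
    have h2 : dist p c ^ 2 < R₂ ^ 2 := by
      have := dist_nonneg (x := p) (y := c); nlinarith
    nlinarith
  by_contra hne
  have hpp : 0 < P p := lt_of_le_of_ne (hP0 p) (Ne.symm hne)
  -- This N makes Nθ(p) = P(qA)/P(p) + 1, and exp t ≥ t + 1 already contradicts the bound.
  have h1 := hbound ((P qA / P p + 1) / θ p) (by have := hP0 qA; positivity)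
  rw [div_mul_cancel₀ _ hθp.ne'] at h1
  have h2 := Real.add_one_le_exp (P qA / P p + 1)
  have h3 : P p * (P qA / P p + 1 + 1) ≤ P qA :=
    (mul_le_mul_of_nonneg_left h2 hpp.le).trans h1
  have h4 : P p * (P qA / P p + 1 + 1) = P qA + 2 * P p := by field_simp; ring
  linarith

end IsBeltrami

/-! ### Coordinate formulas -/

/-- The determinant of the induced metric. -/
noncomputable def gramDet (X : Plane → E41) (q : Plane) : ℝ :=
  form (pd 0 X q) (pd 0 X q) * form (pd 1 X q) (pd 1 X q) - form (pd 0 X q) (pd 1 X q) ^ 2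

section

variable {X : Plane → E41} {q : Plane}

lemma metric_apply (X : Plane → E41) (q : Plane) (i j : Fin 2) :
    metric X q i j = form (pd i X q) (pd j X q) := rfl

lemma det_metric (X : Plane → E41) (q : Plane) : (metric X q).det = gramDet X q := by
  rw [Matrix.det_fin_two, gramDet]
  simp only [metric_apply]
  rw [form_comm (pd 1 X q) (pd 0 X q)]; ring

lemma inv_metric (X : Plane → E41) (q : Plane) :
    (metric X q)⁻¹ = (gramDet X q)⁻¹ • !![form (pd 1 X q) (pd 1 X q), -form (pd 0 X q) (pd 1 X q);
      -form (pd 0 X q) (pd 1 X q), form (pd 0 X q) (pd 0 X q)] := by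
  rw [Matrix.inv_def, det_metric, Ring.inverse_eq_inv', Matrix.adjugate_fin_two]
  simp only [metric_apply, form_comm (pd 1 X q) (pd 0 X q)]

lemma inv_metric_00 (X : Plane → E41) (q : Plane) :
    (metric X q)⁻¹ 0 0 = (gramDet X q)⁻¹ * form (pd 1 X q) (pd 1 X q) := by simp [inv_metric]

lemma inv_metric_01 (X : Plane → E41) (q : Plane) :
    (metric X q)⁻¹ 0 1 = (gramDet X q)⁻¹ * -form (pd 0 X q) (pd 1 X q) := by simp [inv_metric]

lemma inv_metric_10 (X : Plane → E41) (q : Plane) :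
    (metric X q)⁻¹ 1 0 = (gramDet X q)⁻¹ * -form (pd 0 X q) (pd 1 X q) := by simp [inv_metric]

lemma inv_metric_11 (X : Plane → E41) (q : Plane) :
    (metric X q)⁻¹ 1 1 = (gramDet X q)⁻¹ * form (pd 0 X q) (pd 0 X q) := by simp [inv_metric]

lemma pd_metric (hX : ContDiffAt ℝ ∞ X q) (i j k : Fin 2) :
    pd i (fun w => metric X w j k) q
      = form (pd i (pd j X) q) (pd k X q) + form (pd j X q) (pd i (pd k X) q) :=
  pd_form i (contDiffAt_pd j hX).diff (contDiffAt_pd k hX).diff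

/-- For an induced metric the product rule turns the metric derivatives into inner products of
ambient derivatives, and all but one kind cancel. The Christoffel symbols are thus the tangential
part of the ambient second derivatives. -/
lemma christoffel_eq (hX : ContDiffAt ℝ ∞ X q) (k i j : Fin 2) :
    christoffel X k i j q
      = ∑ l, (metric X q)⁻¹ k l * form (pd i (pd j X) q) (pd l X q) := by
  unfold christoffel
  refine Finset.sum_congr rfl fun l _ => ?_
  rw [pd_metric hX, pd_metric hX, pd_metric hX, pd_comm j i hX, pd_comm l i hX, pd_comm l j hX,
    form_comm (pd j X q), form_comm (pd i X q)]
  ring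

lemma christoffel_comm (hX : ContDiffAt ℝ ∞ X q) (k i j : Fin 2) :
    christoffel X k i j q = christoffel X k j i q := by
  simp only [christoffel_eq hX, pd_comm i j hX]

lemma sum_christoffel_mul_metric (hX : ContDiffAt ℝ ∞ X q) (hD : gramDet X q ≠ 0)
    (i j l : Fin 2) :
    christoffel X 0 i j q * form (pd 0 X q) (pd l X q)
      + christoffel X 1 i j q * form (pd 1 X q) (pd l X q)
      = form (pd i (pd j X) q) (pd l X q) := by
  simp only [christoffel_eq hX, Fin.sum_univ_two, inv_metric_00, inv_metric_01, inv_metric_10,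
    inv_metric_11]
  generalize hd : (gramDet X q)⁻¹ = d
  have hd' : d * gramDet X q = 1 := by rw [← hd]; exact inv_mul_cancel₀ hD
  rw [gramDet] at hd'
  have hc := form_comm (pd 1 X q) (pd 0 X q)
  generalize pd i (pd j X) q = Y
  fin_cases l
  · simp only [Fin.zero_eta]
    rw [hc]
    linear_combination form Y (pd 0 X q) * hd'
  · simp only [Fin.mk_one]
    linear_combination form Y (pd 1 X q) * hd'

lemma secondFormCoord_eq (X : Plane → E41) (i j : Fin 2) (q : Plane) :
    secondFormCoord X i j q = pd i (pd j X) q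
      - (christoffel X 0 i j q • pd 0 X q + christoffel X 1 i j q • pd 1 X q) := by
  rw [secondFormCoord, Fin.sum_univ_two]

lemma secondFormCoord_comm (hX : ContDiffAt ℝ ∞ X q) (i j : Fin 2) :
    secondFormCoord X i j q = secondFormCoord X j i q := by
  simp only [secondFormCoord_eq, christoffel_comm hX _ i j, pd_comm i j hX]

lemma form_secondFormCoord_pd (hX : ContDiffAt ℝ ∞ X q) (hD : gramDet X q ≠ 0)
    (i j l : Fin 2) : form (secondFormCoord X i j q) (pd l X q) = 0 := by
  rw [secondFormCoord_eq, form_sub_left, form_add_left, form_smul_left, form_smul_left,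
    sum_christoffel_mul_metric hX hD, sub_self]

lemma form_secondFormCoord_normal {n : E41} (hn : ∀ l, form (pd l X q) n = 0) (i j : Fin 2) :
    form (secondFormCoord X i j q) n = form (pd i (pd j X) q) n := by
  rw [secondFormCoord_eq, form_sub_left, form_add_left, form_smul_left, form_smul_left,
    hn, hn]
  ring

lemma meanCurvatureCoord_eq (X : Plane → E41) (q : Plane) :
    meanCurvatureCoord X q = (-1 / 2 : ℝ) • laplaceCoord X X q := by
  unfold meanCurvatureCoord laplaceCoord secondFormCoord
  module

/-- The factor D D⁻¹ is kept so that the identity needs no regularity of the metric; where the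
metric is regular it becomes 1. -/
lemma two_smul_meanCurvatureCoord (hX : ContDiffAt ℝ ∞ X q) :
    (2 * gramDet X q) • meanCurvatureCoord X q = (gramDet X q * (gramDet X q)⁻¹) •
      (form (pd 1 X q) (pd 1 X q) • secondFormCoord X 0 0 q
      - (2 * form (pd 0 X q) (pd 1 X q)) • secondFormCoord X 0 1 q
      + form (pd 0 X q) (pd 0 X q) • secondFormCoord X 1 1 q) := by
  simp only [meanCurvatureCoord, Fin.sum_univ_two, inv_metric_00, inv_metric_01, inv_metric_10,
    inv_metric_11, secondFormCoord_comm hX 1 0]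
  module

lemma form_meanCurvatureCoord_pd (hX : ContDiffAt ℝ ∞ X q) (hD : gramDet X q ≠ 0) (l : Fin 2) :
    form (pd l X q) (meanCurvatureCoord X q) = 0 := by
  have h1 : form ((2 * gramDet X q) • meanCurvatureCoord X q) (pd l X q) = 0 := by
    rw [two_smul_meanCurvatureCoord hX, form_smul_left, form_add_left, form_sub_left,
      form_smul_left, form_smul_left, form_smul_left]
    simp only [form_secondFormCoord_pd hX hD]
    ring
  rw [form_smul_left] at h1
  rw [form_comm]
  exact (mul_eq_zero.1 h1).resolve_left (mul_ne_zero two_ne_zero hD)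

/-- The trace of the second fundamental form in the direction of a normal vector. -/
lemma trace_second_normal (hX : ContDiffAt ℝ ∞ X q) (hD : gramDet X q ≠ 0) {n : E41}
    (hn : ∀ l, form (pd l X q) n = 0) :
    form (pd 1 X q) (pd 1 X q) * form (pd 0 (pd 0 X) q) n
      - 2 * form (pd 0 X q) (pd 1 X q) * form (pd 0 (pd 1 X) q) n
      + form (pd 0 X q) (pd 0 X q) * form (pd 1 (pd 1 X) q) n
      = 2 * gramDet X q * form (meanCurvatureCoord X q) n := by
  have h1 := congrArg (fun v => form v n) (two_smul_meanCurvatureCoord hX)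
  simp only [form_smul_left, form_add_left, form_sub_left, mul_inv_cancel₀ hD,
    form_secondFormCoord_normal hn] at h1
  linarith

lemma contDiffAt_metric (hX : ContDiffAt ℝ ∞ X q) (i j : Fin 2) :
    ContDiffAt ℝ ∞ (fun w => form (pd i X w) (pd j X w)) q :=
  contDiffAt_form (contDiffAt_pd i hX) (contDiffAt_pd j hX)

lemma contDiffAt_gramDet (hX : ContDiffAt ℝ ∞ X q) : ContDiffAt ℝ ∞ (gramDet X) q :=
  ((contDiffAt_metric hX 0 0).mul (contDiffAt_metric hX 1 1)).sub
    ((contDiffAt_metric hX 0 1).pow 2)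

lemma contDiffAt_inv_metric (hX : ContDiffAt ℝ ∞ X q) (hD : gramDet X q ≠ 0) (i j : Fin 2) :
    ContDiffAt ℝ ∞ (fun w => (metric X w)⁻¹ i j) q := by
  have h := (contDiffAt_gramDet hX).inv hD
  fin_cases i <;> fin_cases j <;>
    simp only [Fin.zero_eta, Fin.mk_one, inv_metric_00, inv_metric_01, inv_metric_10,
      inv_metric_11]
  · exact h.mul (contDiffAt_metric hX 1 1)
  · exact h.mul (contDiffAt_metric hX 0 1).neg
  · exact h.mul (contDiffAt_metric hX 0 1).neg
  · exact h.mul (contDiffAt_metric hX 0 0)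

lemma contDiffAt_christoffel (hX : ContDiffAt ℝ ∞ X q) (hD : gramDet X q ≠ 0) (k i j : Fin 2) :
    ContDiffAt ℝ ∞ (christoffel X k i j) q := by
  refine ContDiffAt.sum fun l _ => ContDiffAt.mul
    ((contDiffAt_inv_metric hX hD k l).div_const 2) ?_
  have h := fun a b c : Fin 2 =>
    contDiffAt_pd (G := fun w => metric X w b c) a (contDiffAt_metric hX b c)
  exact ((h i j l).add (h j i l)).sub (h l i j)

lemma contDiffAt_secondFormCoord (hX : ContDiffAt ℝ ∞ X q) (hD : gramDet X q ≠ 0)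
    (i j : Fin 2) : ContDiffAt ℝ ∞ (secondFormCoord X i j) q :=
  (contDiffAt_pd i (contDiffAt_pd j hX)).sub (ContDiffAt.sum fun k _ =>
    (contDiffAt_christoffel hX hD k i j).smul (contDiffAt_pd k hX))

lemma contDiffAt_laplaceCoord {W : Type*} [NormedAddCommGroup W] [NormedSpace ℝ W]
    {G : Plane → W} (hX : ContDiffAt ℝ ∞ X q) (hD : gramDet X q ≠ 0) (hG : ContDiffAt ℝ ∞ G q) :
    ContDiffAt ℝ ∞ (laplaceCoord X G) q :=
  (ContDiffAt.sum fun i _ => ContDiffAt.sum fun j _ => (contDiffAt_inv_metric hX hD i j).smul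
    ((contDiffAt_pd i (contDiffAt_pd j hG)).sub (ContDiffAt.sum fun k _ =>
      (contDiffAt_christoffel hX hD k i j).smul (contDiffAt_pd k hG)))).neg

lemma contDiffAt_meanCurvatureCoord (hX : ContDiffAt ℝ ∞ X q) (hD : gramDet X q ≠ 0) :
    ContDiffAt ℝ ∞ (meanCurvatureCoord X) q := by
  rw [show meanCurvatureCoord X = fun w => (-1 / 2 : ℝ) • laplaceCoord X X w from
    funext (meanCurvatureCoord_eq X)]
  exact (contDiffAt_const (c := (-1 / 2 : ℝ))).smul (contDiffAt_laplaceCoord hX hD hX)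

/-- The Gauss equation. -/
lemma gauss_equation {V : Set Plane} (hV : IsOpen V) (hX : ∀ w ∈ V, ContDiffAt ℝ ∞ X w)
    (hD : ∀ w ∈ V, gramDet X w ≠ 0) (hq : q ∈ V) :
    gramDet X q * gaussCurvatureCoord X q
      = form (secondFormCoord X 0 0 q) (secondFormCoord X 1 1 q)
        - form (secondFormCoord X 0 1 q) (secondFormCoord X 0 1 q) := by
  have hx := hX q hq
  have hd := hD q hq
  have hs := fun i j => (contDiffAt_secondFormCoord hx hd i j).diff
  have hp := fun i => (contDiffAt_pd i hx).diff
  have hΓ := fun k i j => (contDiffAt_christoffel hx hd k i j).diff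
  have hn := fun i j l => form_secondFormCoord_pd hx hd i j l
  -- derivative of the normality of the second fundamental form
  have h1 : ∀ i j k l, form (pd k (secondFormCoord X i j) q) (pd l X q)
      = -form (secondFormCoord X i j q) (secondFormCoord X k l q) := by
    intro i j k l
    have e := pd_form k (hs i j) (hp l)
    rw [pd_congr k hV (fun w hw => form_secondFormCoord_pd (hX w hw) (hD w hw) i j l) hq,
      pd_const] at e
    have e2 : form (secondFormCoord X i j q) (pd k (pd l X) q)
        = form (secondFormCoord X i j q) (secondFormCoord X k l q) := by
      rw [secondFormCoord_eq X k l, form_sub_right, form_add_right, form_smul_right,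
        form_smul_right, hn, hn]; ring
    linarith
  -- derivative of the Gauss formula
  have h2 : ∀ i j k, pd k (secondFormCoord X i j) q = pd k (pd i (pd j X)) q
      - ((christoffel X 0 i j q • pd k (pd 0 X) q + pd k (christoffel X 0 i j) q • pd 0 X q)
        + (christoffel X 1 i j q • pd k (pd 1 X) q
          + pd k (christoffel X 1 i j) q • pd 1 X q)) := by
    intro i j k
    have e : secondFormCoord X i j = fun w => pd i (pd j X) w
        - (christoffel X 0 i j w • pd 0 X w + christoffel X 1 i j w • pd 1 X w) :=
      funext (secondFormCoord_eq X i j)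
    rw [e, pd_sub k (contDiffAt_pd i (contDiffAt_pd j hx)).diff
      (((hΓ 0 i j).fun_smul (hp 0)).fun_add ((hΓ 1 i j).fun_smul (hp 1))),
      pd_add k ((hΓ 0 i j).fun_smul (hp 0)) ((hΓ 1 i j).fun_smul (hp 1)),
      pd_smul k (hΓ 0 i j) (hp 0), pd_smul k (hΓ 1 i j) (hp 1)]
  have h3 : pd 0 (pd 1 (pd 1 X)) q = pd 1 (pd 0 (pd 1 X)) q := pd_comm 0 1 (contDiffAt_pd 1 hx)
  -- These two instances contain ∂₀∂₁∂₁X and ∂₁∂₀∂₁X, which agree. Their difference leaves only the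
  -- curvature expression and products of second fundamental forms.
  have a1 := h1 1 1 0 0
  have a2 := h1 0 1 1 0
  rw [h2] at a1 a2
  rw [h3] at a1
  have hc := fun i j => sum_christoffel_mul_metric hx hd i j 0
  simp only [form_sub_left, form_add_left, form_smul_left, ← hc] at a1 a2
  rw [← secondFormCoord_comm hx 0 1, form_comm (secondFormCoord X 1 1 q)] at *
  have hK : gramDet X q * gaussCurvatureCoord X q
      = ∑ l, riemannCoord X l 1 0 1 q * metric X q l 0 := by
    rw [gaussCurvatureCoord, det_metric, mul_div_cancel₀ _ hd]
  rw [hK]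
  simp only [riemannCoord, Fin.sum_univ_two, metric_apply]
  linear_combination a2 - a1

end

/-! ### The inner product of 2-vectors -/

/-- The indices of the six coordinates of a 2-vector. -/
abbrev bi (i j : Fin 4) (h : i < j := by decide) : {ij : Fin 4 × Fin 4 // ij.1 < ij.2} :=
  ⟨(i, j), h⟩

/-- The inner product of 2-vectors induced by the indefinite form. -/
def bform (B C : Bivector) : ℝ :=
  -(B (bi 0 1) * C (bi 0 1)) - B (bi 0 2) * C (bi 0 2) - B (bi 0 3) * C (bi 0 3)
    + B (bi 1 2) * C (bi 1 2) + B (bi 1 3) * C (bi 1 3) + B (bi 2 3) * C (bi 2 3)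

lemma Bivector.ext_coord {B C : Bivector} (h01 : B (bi 0 1) = C (bi 0 1))
    (h02 : B (bi 0 2) = C (bi 0 2)) (h03 : B (bi 0 3) = C (bi 0 3))
    (h12 : B (bi 1 2) = C (bi 1 2)) (h13 : B (bi 1 3) = C (bi 1 3))
    (h23 : B (bi 2 3) = C (bi 2 3)) : B = C := by
  funext ⟨⟨i, j⟩, hij⟩
  fin_cases i <;> fin_cases j <;> first | assumption | (exact absurd hij (by decide))

lemma bform_comm (B C : Bivector) : bform B C = bform C B := by unfold bform; ring

lemma bform_add_left (A B C : Bivector) : bform (A + B) C = bform A C + bform B C := by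
  simp only [bform, Pi.add_apply]; ring

lemma bform_sub_left (A B C : Bivector) : bform (A - B) C = bform A C - bform B C := by
  simp only [bform, Pi.sub_apply]; ring

lemma bform_neg_left (A C : Bivector) : bform (-A) C = -bform A C := by
  simp only [bform, Pi.neg_apply]; ring

lemma bform_smul_left (t : ℝ) (B C : Bivector) : bform (t • B) C = t * bform B C := by
  simp only [bform, Pi.smul_apply, smul_eq_mul]; ring

lemma bform_add_right (A B C : Bivector) : bform A (B + C) = bform A B + bform A C := by
  simp only [bform, Pi.add_apply]; ring

lemma bform_smul_right (t : ℝ) (B C : Bivector) : bform B (t • C) = t * bform B C := by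
  simp only [bform, Pi.smul_apply, smul_eq_mul]; ring

lemma bform_wedge (a b c d : E41) :
    bform (wedge a b) (wedge c d) = form a c * form b d - form a d * form b c := by
  simp only [bform, wedge, form]; ring

/-- The inner product of 2-vectors as a continuous bilinear map. -/
noncomputable def bformL : Bivector →L[ℝ] Bivector →L[ℝ] ℝ :=
  LinearMap.toContinuousLinearMap
    ((LinearMap.toContinuousLinearMap (𝕜 := ℝ) (E := Bivector) (F' := ℝ)).toLinearMap ∘ₗ
      LinearMap.mk₂ ℝ bform bform_add_left bform_smul_left bform_add_right bform_smul_right)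

lemma pd_bform {a b : Plane → Bivector} {q : Plane} (i : Fin 2) (ha : DifferentiableAt ℝ a q)
    (hb : DifferentiableAt ℝ b q) :
    pd i (fun w => bform (a w) (b w)) q = bform (pd i a q) (b q) + bform (a q) (pd i b q) :=
  pd_bilin i bformL ha hb

/-- `a`, `b` span a non-degenerate plane, and `ξ`, `η` are orthogonal to it, with `ξ` light-like
and `⟨ξ, η⟩ = -1`. -/
structure IsFrame (a b ξ η : E41) : Prop where
  det_ne : form a a * form b b - form a b ^ 2 ≠ 0
  aξ : form a ξ = 0
  aη : form a η = 0
  bξ : form b ξ = 0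
  bη : form b η = 0
  ξξ : form ξ ξ = 0
  ξη : form ξ η = -1

namespace IsFrame

variable {a b ξ η : E41}

/-- The mutual inner products make the four vectors linearly independent, hence a basis, and the
form is non-degenerate. -/
lemma eq_zero (h : IsFrame a b ξ η) {v : E41} (va : form a v = 0) (vb : form b v = 0)
    (vξ : form ξ v = 0) (vη : form η v = 0) : v = 0 := by
  have hdet : (Matrix.of ![a, b, ξ, η]).det ≠ 0 := by
    intro h0
    obtain ⟨c, hc, hc0⟩ := Matrix.exists_vecMul_eq_zero_iff.2 h0
    have e : c 0 • a + c 1 • b + c 2 • ξ + c 3 • η = 0 := by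
      funext k
      have := congrFun hc0 k
      simpa [Matrix.vecMul, dotProduct, Fin.sum_univ_four] using this
    have e1 := fun w => congrArg (fun u => form u w) e
    simp only [form_add_left, form_smul_left, form_zero_left] at e1
    have w1 := e1 ξ
    have w2 := e1 η
    have w3 := e1 a
    have w4 := e1 b
    rw [form_comm ξ a, form_comm η a, form_comm b a, h.aξ, h.aη] at w3
    rw [form_comm ξ b, form_comm η b, h.bξ, h.bη] at w4
    rw [form_comm η ξ, h.aξ, h.bξ, h.ξξ, h.ξη] at w1
    rw [h.aη, h.bη, h.ξη] at w2
    have c3 : c 3 = 0 := by linarith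
    have c2 : c 2 = 0 := by rw [c3] at w2; linarith
    have c0 : c 0 = 0 := by
      have : c 0 * (form a a * form b b - form a b ^ 2) = 0 := by
        linear_combination form b b * w3 - form a b * w4
      exact (mul_eq_zero.1 this).resolve_right h.det_ne
    have c1 : c 1 = 0 := by
      have : c 1 * (form a a * form b b - form a b ^ 2) = 0 := by
        linear_combination form a a * w4 - form a b * w3
      exact (mul_eq_zero.1 this).resolve_right h.det_ne
    exact hc (funext fun k => by fin_cases k <;> assumption)
  -- Changing the sign of the time coordinate turns `form` into the dot product.
  have hv : Matrix.mulVec (Matrix.of ![a, b, ξ, η]) ![-v 0, v 1, v 2, v 3] = 0 := by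
    funext k
    simp only [form] at va vb vξ vη
    fin_cases k <;> simp [Matrix.mulVec, dotProduct, Fin.sum_univ_four] <;> linarith
  have hz := Matrix.eq_zero_of_mulVec_eq_zero hdet hv
  have z := fun k => congrFun hz k
  funext k
  fin_cases k
  · simpa using z 0
  · simpa using z 1
  · simpa using z 2
  · simpa using z 3

/-- Contracting B with d gives a vector u with ⟨c, u⟩ = B·(c ∧ d). If this vanishes for all frame
vectors c then u = 0. The argument is used first for d in the frame and then for arbitrary d. -/
lemma bivector_eq_zero (h : IsFrame a b ξ η) {B : Bivector} (hab : bform B (wedge a b) = 0)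
    (hξη : bform B (wedge ξ η) = 0) (hξa : bform B (wedge ξ a) = 0)
    (hξb : bform B (wedge ξ b) = 0) (hηa : bform B (wedge η a) = 0)
    (hηb : bform B (wedge η b) = 0) : B = 0 := by
  have anti : ∀ c d, wedge c d = -wedge d c := fun c d => by
    ext; simp only [wedge, Pi.neg_apply]; ring
  have self : ∀ c, bform B (wedge c c) = 0 := fun c => by
    have : wedge c c = 0 := by ext; simp only [wedge, Pi.zero_apply]; ring
    rw [this]; simp [bform]
  have flip : ∀ c d, bform B (wedge c d) = 0 → bform B (wedge d c) = 0 := by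
    intro c d hcd
    rw [anti, bform_comm, bform_neg_left, bform_comm, hcd, neg_zero]
  -- the contraction of `B` with `d`
  have contr : ∀ d, ∃ u : E41, ∀ c, form c u = bform B (wedge c d) := by
    intro d
    refine ⟨fun k => (if k = 0 then -1 else 1) * bform B (wedge (Pi.single k 1) d), fun c => ?_⟩
    simp [form, bform, wedge]
    ring
  have step : ∀ d, bform B (wedge a d) = 0 → bform B (wedge b d) = 0 → bform B (wedge ξ d) = 0 →
      bform B (wedge η d) = 0 → ∀ c, bform B (wedge c d) = 0 := by
    intro d h1 h2 h3 h4 c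
    obtain ⟨u, hu⟩ := contr d
    rw [← hu] at h1 h2 h3 h4 ⊢
    rw [h.eq_zero h1 h2 h3 h4, form_zero_right]
  have sa := step a (self a) (flip _ _ hab) hξa hηa
  have sb := step b hab (self b) hξb hηb
  have sξ := step ξ (flip _ _ hξa) (flip _ _ hξb) (self ξ) (flip _ _ hξη)
  have sη := step η (flip _ _ hηa) (flip _ _ hηb) hξη (self η)
  have all : ∀ c d, bform B (wedge c d) = 0 := fun c d =>
    flip _ _ (step c (flip _ _ (sa c)) (flip _ _ (sb c)) (flip _ _ (sξ c)) (flip _ _ (sη c)) d) |>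
      flip _ _ |> flip _ _
  have key : ∀ i j : Fin 4, bform B (wedge (Pi.single i 1) (Pi.single j 1)) = 0 :=
    fun i j => all _ _
  apply Bivector.ext_coord
  · simpa [bform, wedge] using key 0 1
  · simpa [bform, wedge] using key 0 2
  · simpa [bform, wedge] using key 0 3
  · simpa [bform, wedge] using key 1 2
  · simpa [bform, wedge] using key 1 3
  · simpa [bform, wedge] using key 2 3

end IsFrame

/-! ### The Laplacian of the Gauss map -/

/-- `X` is a regular parametrization on `V`, with the unit 2-vector field
`N = μ X₀ ∧ X₁`, `μ = ± 1 / √ det g`. -/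
structure IsGaussPatch (X : Plane → E41) (μ : Plane → ℝ) (N : Plane → Bivector)
    (V : Set Plane) : Prop where
  isOpen : IsOpen V
  smooth : ∀ q ∈ V, ContDiffAt ℝ ∞ X q
  pos : ∀ q ∈ V, 0 < form (pd 0 X q) (pd 0 X q)
  det_pos : ∀ q ∈ V, 0 < gramDet X q
  smooth_mu : ∀ q ∈ V, ContDiffAt ℝ ∞ μ q
  mu_sq : ∀ q ∈ V, μ q ^ 2 * gramDet X q = 1
  eq_wedge : ∀ q ∈ V, N q = μ q • wedge (pd 0 X q) (pd 1 X q)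

namespace IsGaussPatch

variable {X : Plane → E41} {μ : Plane → ℝ} {N : Plane → Bivector} {V : Set Plane} {q : Plane}

lemma det_ne (h : IsGaussPatch X μ N V) (hq : q ∈ V) : gramDet X q ≠ 0 := (h.det_pos q hq).ne'

lemma mu_ne (h : IsGaussPatch X μ N V) (hq : q ∈ V) : μ q ≠ 0 := by
  intro h0
  have := h.mu_sq q hq
  rw [h0] at this
  norm_num at this

lemma smooth_N (h : IsGaussPatch X μ N V) (hq : q ∈ V) : ContDiffAt ℝ ∞ N q :=
  ((h.smooth_mu q hq).smul (contDiffAt_wedge (contDiffAt_pd 0 (h.smooth q hq))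
    (contDiffAt_pd 1 (h.smooth q hq)))).congr_of_eventuallyEq
    (Filter.eventuallyEq_of_mem (h.isOpen.mem_nhds hq) h.eq_wedge)

lemma pd_gramDet (h : IsGaussPatch X μ N V) (hq : q ∈ V) (k : Fin 2) :
    pd k (gramDet X) q
      = 2 * gramDet X q * (christoffel X 0 k 0 q + christoffel X 1 k 1 q) := by
  have hx := h.smooth q hq
  have d := fun i j => (contDiffAt_metric hx i j).diff
  have e := fun i j => pd_form (q := q) k (contDiffAt_pd i hx).diff (contDiffAt_pd j hx).diff
  have h1 : gramDet X = fun w => form (pd 0 X w) (pd 0 X w) * form (pd 1 X w) (pd 1 X w)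
      - form (pd 0 X w) (pd 1 X w) * form (pd 0 X w) (pd 1 X w) := by
    funext w; rw [gramDet]; ring
  have hc := fun i l => sum_christoffel_mul_metric hx (h.det_ne hq) k i l
  rw [h1, pd_sub k ((d 0 0).fun_mul (d 1 1)) ((d 0 1).fun_mul (d 0 1)), pd_mul k (d 0 0) (d 1 1),
    pd_mul k (d 0 1) (d 0 1), e, e, e, form_comm (pd 0 X q) (pd k (pd 0 X) q),
    form_comm (pd 0 X q) (pd k (pd 1 X) q), form_comm (pd 1 X q) (pd k (pd 1 X) q),
    ← hc, ← hc, ← hc, ← hc, form_comm (pd 1 X q) (pd 0 X q)]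
  ring

lemma pd_mu (h : IsGaussPatch X μ N V) (hq : q ∈ V) (k : Fin 2) :
    pd k μ q = -μ q * (christoffel X 0 k 0 q + christoffel X 1 k 1 q) := by
  have dμ := (h.smooth_mu q hq).diff
  have dD := (contDiffAt_gramDet (h.smooth q hq)).diff
  have e := pd_congr (F := fun w => μ w * μ w * gramDet X w) (G := fun _ => (1 : ℝ)) k h.isOpen
    (fun w hw => by rw [← h.mu_sq w hw]; ring) hq
  rw [pd_mul k (dμ.fun_mul dμ) dD, pd_mul k dμ dμ, pd_const, h.pd_gramDet hq] at e
  have h2 : 2 * μ q * gramDet X q ≠ 0 :=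
    mul_ne_zero (mul_ne_zero two_ne_zero (h.mu_ne hq)) (h.det_ne hq)
  apply mul_left_cancel₀ h2
  linear_combination e

/-- The tangential parts of ∂X₀ and ∂X₁ contribute the trace of the Christoffel symbols, which the
derivative of μ removes. Only the second fundamental form is left. -/
lemma pd_N (h : IsGaussPatch X μ N V) (hq : q ∈ V) (k : Fin 2) :
    pd k N q = μ q • (wedge (secondFormCoord X k 0 q) (pd 1 X q)
      + wedge (pd 0 X q) (secondFormCoord X k 1 q)) := by
  have hx := h.smooth q hq
  have d := fun i => (contDiffAt_pd i hx).diff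
  rw [pd_congr k h.isOpen h.eq_wedge hq, pd_smul k (h.smooth_mu q hq).diff
    (contDiffAt_wedge (contDiffAt_pd 0 hx) (contDiffAt_pd 1 hx)).diff, pd_wedge k (d 0) (d 1),
    h.pd_mu hq]
  simp only [secondFormCoord_eq]
  ext ij
  simp only [wedge, Pi.add_apply, Pi.smul_apply, Pi.sub_apply, smul_eq_mul]
  ring

lemma pd_pd_N (h : IsGaussPatch X μ N V) (hq : q ∈ V) (i j : Fin 2) :
    pd i (pd j N) q = μ q • (wedge (pd i (secondFormCoord X j 0) q) (pd 1 X q)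
        + wedge (secondFormCoord X j 0 q) (pd i (pd 1 X) q)
        + (wedge (pd i (pd 0 X) q) (secondFormCoord X j 1 q)
        + wedge (pd 0 X q) (pd i (secondFormCoord X j 1) q)))
      + (-μ q * (christoffel X 0 i 0 q + christoffel X 1 i 1 q)) •
        (wedge (secondFormCoord X j 0 q) (pd 1 X q)
          + wedge (pd 0 X q) (secondFormCoord X j 1 q)) := by
  have hx := h.smooth q hq
  have d := fun i => contDiffAt_pd i hx
  have s := fun i j => contDiffAt_secondFormCoord hx (h.det_ne hq) i j
  rw [pd_congr i h.isOpen (fun w hw => h.pd_N hw j) hq, pd_smul i (h.smooth_mu q hq).diff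
    ((contDiffAt_wedge (s j 0) (d 1)).add (contDiffAt_wedge (d 0) (s j 1))).diff,
    pd_add i (contDiffAt_wedge (s j 0) (d 1)).diff (contDiffAt_wedge (d 0) (s j 1)).diff,
    pd_wedge i (s j 0).diff (d 1).diff, pd_wedge i (d 0).diff (s j 1).diff, h.pd_mu hq]

/-- The determinant clears the inverse metric, so that pairings of Δν with bivectors become
polynomial identities. -/
lemma gramDet_mul_bform_laplace (h : IsGaussPatch X μ N V) (hq : q ∈ V) (B : Bivector) :
    gramDet X q * bform (laplaceCoord X N q) B =
      -(form (pd 1 X q) (pd 1 X q) * (bform (pd 0 (pd 0 N) q) B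
          - christoffel X 0 0 0 q * bform (pd 0 N q) B - christoffel X 1 0 0 q * bform (pd 1 N q) B)
        - 2 * form (pd 0 X q) (pd 1 X q) * (bform (pd 0 (pd 1 N) q) B
          - christoffel X 0 0 1 q * bform (pd 0 N q) B - christoffel X 1 0 1 q * bform (pd 1 N q) B)
        + form (pd 0 X q) (pd 0 X q) * (bform (pd 1 (pd 1 N) q) B
          - christoffel X 0 1 1 q * bform (pd 0 N q) B
          - christoffel X 1 1 1 q * bform (pd 1 N q) B)) := by
  have hd := mul_inv_cancel₀ (h.det_ne hq)
  simp only [laplaceCoord, Fin.sum_univ_two, inv_metric_00, inv_metric_01, inv_metric_10,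
    inv_metric_11, bform_neg_left, bform_add_left, bform_sub_left, bform_smul_left,
    pd_comm 1 0 (h.smooth_N hq), christoffel_comm (h.smooth q hq) _ 1 0]
  generalize (gramDet X q)⁻¹ = d at *
  linear_combination -(form (pd 1 X q) (pd 1 X q) * (bform (pd 0 (pd 0 N) q) B
          - christoffel X 0 0 0 q * bform (pd 0 N q) B - christoffel X 1 0 0 q * bform (pd 1 N q) B)
        - 2 * form (pd 0 X q) (pd 1 X q) * (bform (pd 0 (pd 1 N) q) B
          - christoffel X 0 0 1 q * bform (pd 0 N q) B - christoffel X 1 0 1 q * bform (pd 1 N q) B)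
        + form (pd 0 X q) (pd 0 X q) * (bform (pd 1 (pd 1 N) q) B
          - christoffel X 0 1 1 q * bform (pd 0 N q) B
          - christoffel X 1 1 1 q * bform (pd 1 N q) B)) * hd

lemma bform_N_N (h : IsGaussPatch X μ N V) (hq : q ∈ V) : bform (N q) (N q) = 1 := by
  rw [h.eq_wedge q hq, bform_smul_left, bform_smul_right, bform_wedge, ← h.mu_sq q hq, gramDet,
    form_comm (pd 1 X q) (pd 0 X q)]
  ring

/-- From ⟨ν, ν⟩ = 1 follows ⟨∂∂ν, ν⟩ = -⟨∂ν, ∂ν⟩, so the pairing is ‖h‖². By the Gauss equation this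
is 4⟨H, H⟩ - 2K, and H is null. -/
lemma bform_laplace_N (h : IsGaussPatch X μ N V) (hq : q ∈ V)
    (hH : form (meanCurvatureCoord X q) (meanCurvatureCoord X q) = 0) :
    bform (laplaceCoord X N q) (N q) = -2 * gaussCurvatureCoord X q := by
  have hx := h.smooth q hq
  have hN := h.smooth_N hq
  have hd := h.det_ne hq
  have e1 : ∀ w ∈ V, ∀ i, bform (pd i N w) (N w) = 0 := by
    intro w hw i
    have hNw := (h.smooth_N hw).diff
    have e := pd_bform i hNw hNw
    rw [pd_congr i h.isOpen (fun w hw => h.bform_N_N hw) hw, pd_const,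
      bform_comm (N w)] at e
    linarith
  have e2 : ∀ i j, bform (pd i (pd j N) q) (N q) = -bform (pd i N q) (pd j N q) := by
    intro i j
    have e := pd_bform i (contDiffAt_pd j hN).diff hN.diff
    rw [pd_congr i h.isOpen (fun w hw => e1 w hw j) hq, pd_const, bform_comm (pd j N q)] at e
    linarith
  have hg := gauss_equation h.isOpen h.smooth (fun w hw => h.det_ne hw) hq
  have hl := h.gramDet_mul_bform_laplace hq (N q)
  have ht := two_smul_meanCurvatureCoord hx
  rw [mul_inv_cancel₀ hd, one_smul] at ht
  have hHH : form ((2 * gramDet X q) • meanCurvatureCoord X q)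
      ((2 * gramDet X q) • meanCurvatureCoord X q) = 0 := by
    rw [form_smul_left, form_smul_right, hH]; ring
  rw [ht] at hHH
  have s10 := secondFormCoord_comm hx 1 0
  have n1 : ∀ i j l, form (pd l X q) (secondFormCoord X i j q) = 0 := fun i j l => by
    rw [form_comm, form_secondFormCoord_pd hx hd]
  simp only [e2, e1 q hq] at hl
  simp only [h.pd_N hq, s10] at hl
  simp only [form_add_left, form_sub_left, form_smul_left, form_add_right, form_sub_right,
    form_smul_right] at hHH
  simp only [bform_smul_left, bform_smul_right, bform_add_left, bform_add_right, bform_wedge,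
    form_secondFormCoord_pd hx hd, n1, form_comm (pd 1 X q) (pd 0 X q)] at hl
  rw [form_comm (secondFormCoord X 1 1 q) (secondFormCoord X 0 0 q),
    form_comm (secondFormCoord X 1 1 q) (secondFormCoord X 0 1 q),
    form_comm (secondFormCoord X 0 1 q) (secondFormCoord X 0 0 q)] at *
  have hμ := h.mu_sq q hq
  apply mul_left_cancel₀ hd
  apply mul_left_cancel₀ hd
  have hD : gramDet X q = form (pd 0 X q) (pd 0 X q) * form (pd 1 X q) (pd 1 X q)
    - form (pd 0 X q) (pd 1 X q) ^ 2 := rfl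
  rw [hl]
  generalize gramDet X q = D at *
  generalize form (pd 0 X q) (pd 0 X q) = E at *
  generalize form (pd 0 X q) (pd 1 X q) = F at *
  generalize form (pd 1 X q) (pd 1 X q) = G at *
  generalize form (secondFormCoord X 0 0 q) (secondFormCoord X 0 0 q) = a at *
  generalize form (secondFormCoord X 0 0 q) (secondFormCoord X 0 1 q) = b at *
  generalize form (secondFormCoord X 0 0 q) (secondFormCoord X 1 1 q) = c at *
  generalize form (secondFormCoord X 0 1 q) (secondFormCoord X 0 1 q) = d at *
  generalize form (secondFormCoord X 0 1 q) (secondFormCoord X 1 1 q) = e at *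
  generalize form (secondFormCoord X 1 1 q) (secondFormCoord X 1 1 q) = f at *
  linear_combination (G * (G * a - 2 * F * b + E * d) - 2 * F * (G * b - F * c - F * d + E * e)
    + E * (G * d - 2 * F * e + E * f)) * hμ + hHH + 2 * D * hg + 2 * (c - d) * hD

/-- The derivatives of the Christoffel symbols multiply tangent vectors and drop out against a
normal n. -/
lemma form_pd_secondFormCoord (h : IsGaussPatch X μ N V) (hq : q ∈ V) {n : E41}
    (hn : ∀ l, form (pd l X q) n = 0) (k i j : Fin 2) :
    form (pd k (secondFormCoord X i j) q) n = form (pd k (pd i (pd j X)) q) n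
      - christoffel X 0 i j q * form (pd k (pd 0 X) q) n
      - christoffel X 1 i j q * form (pd k (pd 1 X) q) n := by
  have hx := h.smooth q hq
  have hΓ := fun k => (contDiffAt_christoffel hx (h.det_ne hq) k i j).diff
  have hp := fun i => (contDiffAt_pd i hx).diff
  rw [show secondFormCoord X i j = fun w => pd i (pd j X) w
      - (christoffel X 0 i j w • pd 0 X w + christoffel X 1 i j w • pd 1 X w) from
      funext (secondFormCoord_eq X i j),
    pd_sub k (contDiffAt_pd i (contDiffAt_pd j hx)).diff
      (((hΓ 0).fun_smul (hp 0)).fun_add ((hΓ 1).fun_smul (hp 1))),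
    pd_add k ((hΓ 0).fun_smul (hp 0)) ((hΓ 1).fun_smul (hp 1)),
    pd_smul k (hΓ 0) (hp 0), pd_smul k (hΓ 1) (hp 1)]
  simp only [form_sub_left, form_add_left, form_smul_left, hn]
  ring

/-- This is the n-component of the derivative of 2DH = G h₀₀ - 2F h₀₁ + E h₁₁, kept free of
denominators. -/
lemma form_pd_meanCurvatureCoord (h : IsGaussPatch X μ N V) (hq : q ∈ V) {n : E41}
    (hn : ∀ l, form (pd l X q) n = 0) (k : Fin 2) :
    2 * gramDet X q * form (pd k (meanCurvatureCoord X) q) n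
      + 2 * (christoffel X 0 k 0 q + christoffel X 1 k 1 q)
        * (form (pd 1 X q) (pd 1 X q) * form (pd 0 (pd 0 X) q) n
          - 2 * form (pd 0 X q) (pd 1 X q) * form (pd 0 (pd 1 X) q) n
          + form (pd 0 X q) (pd 0 X q) * form (pd 1 (pd 1 X) q) n)
      = 2 * form (pd k (pd 1 X) q) (pd 1 X q) * form (pd 0 (pd 0 X) q) n
        - 2 * (form (pd k (pd 0 X) q) (pd 1 X q) + form (pd k (pd 1 X) q) (pd 0 X q))
          * form (pd 0 (pd 1 X) q) n
        + 2 * form (pd k (pd 0 X) q) (pd 0 X q) * form (pd 1 (pd 1 X) q) n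
        + form (pd 1 X q) (pd 1 X q) * form (pd k (secondFormCoord X 0 0) q) n
        - 2 * form (pd 0 X q) (pd 1 X q) * form (pd k (secondFormCoord X 0 1) q) n
        + form (pd 0 X q) (pd 0 X q) * form (pd k (secondFormCoord X 1 1) q) n := by
  have hx := h.smooth q hq
  have hd := h.det_ne hq
  have g := fun i j => (contDiffAt_metric hx i j).diff
  have s := fun i j => (contDiffAt_secondFormCoord hx hd i j).diff
  have dp := fun i => (contDiffAt_pd i hx).diff
  have e := pd_congr (F := fun w => (gramDet X w) • meanCurvatureCoord X w) k h.isOpen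
    (fun w hw => show _ = (1 / 2 : ℝ) •
      (form (pd 1 X w) (pd 1 X w) • secondFormCoord X 0 0 w
      - (form (pd 0 X w) (pd 1 X w) • secondFormCoord X 0 1 w
        + form (pd 0 X w) (pd 1 X w) • secondFormCoord X 0 1 w)
      + form (pd 0 X w) (pd 0 X w) • secondFormCoord X 1 1 w) by
      have := two_smul_meanCurvatureCoord (h.smooth w hw)
      rw [mul_inv_cancel₀ (h.det_ne hw), one_smul] at this
      have h2 : gramDet X w • meanCurvatureCoord X w
        = (1 / 2 : ℝ) • ((2 * gramDet X w) • meanCurvatureCoord X w) := by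
        rw [smul_smul]; congr 1; ring
      rw [h2, this]; module) hq
  have t := trace_second_normal hx hd hn
  have m1 := (g 1 1).fun_smul (s 0 0)
  have m2 := (g 0 1).fun_smul (s 0 1)
  have m3 := (g 0 0).fun_smul (s 1 1)
  rw [pd_smul k (contDiffAt_gramDet hx).diff (contDiffAt_meanCurvatureCoord hx hd).diff,
    pd_smul k (differentiableAt_const _) ((m1.fun_sub (m2.fun_add m2)).fun_add m3), pd_const,
    pd_add k (m1.fun_sub (m2.fun_add m2)) m3, pd_sub k m1 (m2.fun_add m2), pd_add k m2 m2,
    pd_smul k (g 1 1) (s 0 0), pd_smul k (g 0 1) (s 0 1), pd_smul k (g 0 0) (s 1 1),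
    pd_form k (dp 0) (dp 0), pd_form k (dp 0) (dp 1), pd_form k (dp 1) (dp 1),
    h.pd_gramDet hq] at e
  have e2 := congrArg (fun v => form v n) e
  simp only [form_add_left, form_sub_left, form_smul_left, form_secondFormCoord_normal hn,
    form_comm (pd 0 X q) (pd k (pd 0 X) q), form_comm (pd 0 X q) (pd k (pd 1 X) q),
    form_comm (pd 1 X q) (pd k (pd 1 X) q), zero_mul, add_zero] at e2
  linear_combination 2 * e2 + 2 * (christoffel X 0 k 0 q + christoffel X 1 k 1 q) * t

/-- Component of the Laplacian of the Gauss map: the normal derivative of the mean curvature. -/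
lemma bform_laplace_normal_tangent (h : IsGaussPatch X μ N V) (hq : q ∈ V) {n : E41}
    (hn : ∀ l, form (pd l X q) n = 0) (k : Fin 2) :
    bform (laplaceCoord X N q) (wedge n (pd k X q)) =
      -2 * μ q * (form (pd 0 (meanCurvatureCoord X) q) n * form (pd 1 X q) (pd k X q)
        - form (pd 1 (meanCurvatureCoord X) q) n * form (pd 0 X q) (pd k X q)) := by
  have hx := h.smooth q hq
  have hd := h.det_ne hq
  have hl := h.gramDet_mul_bform_laplace hq (wedge n (pd k X q))
  have m0 := h.form_pd_meanCurvatureCoord hq hn 0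
  have m1 := h.form_pd_meanCurvatureCoord hq hn 1
  have hc := fun i j l => sum_christoffel_mul_metric hx hd i j l
  have s10 : secondFormCoord X 1 0 q = secondFormCoord X 0 1 q := secondFormCoord_comm hx 1 0
  simp only [h.pd_pd_N hq, h.pd_N hq, bform_add_left, bform_smul_left, bform_wedge,
    form_secondFormCoord_pd hx hd, hn, form_secondFormCoord_normal hn,
    h.form_pd_secondFormCoord hq hn] at hl
  simp only [h.form_pd_secondFormCoord hq hn] at m0 m1
  -- Codazzi enters here: mixed third derivatives that differ only in the order of differentiation
  -- are brought to one form.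
  have p1 : pd 1 (pd 0 (pd 0 X)) q = pd 0 (pd 0 (pd 1 X)) q := by
    rw [pd_comm 1 0 (contDiffAt_pd 0 hx)]
    exact pd_congr 0 h.isOpen (fun w hw => pd_comm 1 0 (h.smooth w hw)) hq
  have p2 : pd 0 (pd 1 (pd 0 X)) q = pd 0 (pd 0 (pd 1 X)) q :=
    pd_congr 0 h.isOpen (fun w hw => pd_comm 1 0 (h.smooth w hw)) hq
  have p3 : pd 1 (pd 1 (pd 0 X)) q = pd 0 (pd 1 (pd 1 X)) q := by
    rw [pd_comm 0 1 (contDiffAt_pd 1 hx)]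
    exact pd_congr 1 h.isOpen (fun w hw => pd_comm 1 0 (h.smooth w hw)) hq
  have p4 : pd 1 (pd 0 (pd 1 X)) q = pd 0 (pd 1 (pd 1 X)) q := pd_comm 1 0 (contDiffAt_pd 1 hx)
  rw [pd_comm 1 0 hx, christoffel_comm hx 0 1 0, christoffel_comm hx 1 1 0] at *
  simp only [p1, p2, p3, p4, ← hc, form_comm (pd 1 X q) (pd 0 X q)] at hl m0 m1
  apply mul_left_cancel₀ hd
  rw [hl]
  generalize gramDet X q = D at *
  generalize form (pd 0 (meanCurvatureCoord X) q) n = h0 at *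
  generalize form (pd 1 (meanCurvatureCoord X) q) n = h1 at *
  fin_cases k
  · simp only [Fin.zero_eta, form_comm (pd 1 X q) (pd 0 X q)] at hl ⊢
    linear_combination μ q * form (pd 0 X q) (pd 1 X q) * m0
      - μ q * form (pd 0 X q) (pd 0 X q) * m1
  · simp only [Fin.mk_one] at hl ⊢
    linear_combination μ q * form (pd 1 X q) (pd 1 X q) * m0
      - μ q * form (pd 0 X q) (pd 1 X q) * m1

/-- Component of the Laplacian of the Gauss map: the normal curvature. -/
lemma bform_laplace_normal_normal (h : IsGaussPatch X μ N V) (hq : q ∈ V) {n m : E41}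
    (hn : ∀ l, form (pd l X q) n = 0) (hm : ∀ l, form (pd l X q) m = 0) :
    gramDet X q * bform (laplaceCoord X N q) (wedge n m) = -2 * μ q *
      (form (pd 1 X q) (pd 1 X q) * (form (pd 0 (pd 0 X) q) n * form (pd 0 (pd 1 X) q) m
          - form (pd 0 (pd 0 X) q) m * form (pd 0 (pd 1 X) q) n)
        - form (pd 0 X q) (pd 1 X q) * (form (pd 0 (pd 0 X) q) n * form (pd 1 (pd 1 X) q) m
          - form (pd 0 (pd 0 X) q) m * form (pd 1 (pd 1 X) q) n)
        + form (pd 0 X q) (pd 0 X q) * (form (pd 0 (pd 1 X) q) n * form (pd 1 (pd 1 X) q) m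
          - form (pd 0 (pd 1 X) q) m * form (pd 1 (pd 1 X) q) n)) := by
  have hx := h.smooth q hq
  have hl := h.gramDet_mul_bform_laplace hq (wedge n m)
  simp only [h.pd_pd_N hq, h.pd_N hq, bform_add_left, bform_smul_left, bform_wedge, hn, hm,
    form_secondFormCoord_normal hn, form_secondFormCoord_normal hm] at hl
  rw [pd_comm 1 0 hx] at hl
  rw [hl]
  ring

end IsGaussPatch

/-! ### Invariance of the Laplace operator under changes of coordinates -/

section Invariance

variable {W : Type*} [NormedAddCommGroup W] [NormedSpace ℝ W] {q : Plane}

lemma metric_eventuallyEq {X Y : Plane → E41} (h : X =ᶠ[𝓝 q] Y) :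
    metric X =ᶠ[𝓝 q] metric Y := by
  filter_upwards [pd_eventuallyEq' 0 h, pd_eventuallyEq' 1 h] with w h0 h1
  have hh : ∀ i, pd i X w = pd i Y w := fun i => by fin_cases i <;> assumption
  ext i j
  rw [metric_apply, metric_apply, hh, hh]

lemma laplaceCoord_congr_metric {X Y : Plane → E41} (h : metric X =ᶠ[𝓝 q] metric Y)
    (G : Plane → W) : laplaceCoord X G q = laplaceCoord Y G q := by
  have hm : metric X q = metric Y q := h.eq_of_nhds
  have hp : ∀ a b c, pd a (fun w => metric X w b c) q = pd a (fun w => metric Y w b c) q :=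
    fun a b c => pd_eventuallyEq a (h.mono fun w hw => by simp only [hw])
  have hΓ : ∀ k i j, christoffel X k i j q = christoffel Y k i j q := fun k i j => by
    simp only [christoffel, hm, hp]
  simp only [laplaceCoord, hm, hΓ]

lemma laplaceCoord_congr {X : Plane → E41} {F G : Plane → W} (h : F =ᶠ[𝓝 q] G) :
    laplaceCoord X F q = laplaceCoord X G q := by
  have h1 := fun i => (pd_eventuallyEq i h)
  have h2 := fun i j => pd_eventuallyEq i (pd_eventuallyEq' j h)
  simp only [laplaceCoord, h1, h2]

lemma gramDet_smul_laplaceCoord {X : Plane → E41} {G : Plane → W} (hX : ContDiffAt ℝ ∞ X q)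
    (hG : ContDiffAt ℝ ∞ G q) (hD : gramDet X q ≠ 0) :
    gramDet X q • laplaceCoord X G q =
      -(form (pd 1 X q) (pd 1 X q) • (pd 0 (pd 0 G) q
          - (christoffel X 0 0 0 q • pd 0 G q + christoffel X 1 0 0 q • pd 1 G q))
        - (2 * form (pd 0 X q) (pd 1 X q)) • (pd 0 (pd 1 G) q
          - (christoffel X 0 0 1 q • pd 0 G q + christoffel X 1 0 1 q • pd 1 G q))
        + form (pd 0 X q) (pd 0 X q) • (pd 1 (pd 1 G) q
          - (christoffel X 0 1 1 q • pd 0 G q + christoffel X 1 1 1 q • pd 1 G q))) := by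
  have hd := mul_inv_cancel₀ hD
  simp only [laplaceCoord, Fin.sum_univ_two, inv_metric_00, inv_metric_01, inv_metric_10,
    inv_metric_11, pd_comm 1 0 hG, christoffel_comm hX _ 1 0, smul_neg, smul_add, ← smul_assoc,
    smul_eq_mul, ← mul_assoc, hd, one_mul]
  module

lemma pd_pd_comp {G : Plane → W} {τ : Plane → Plane} (hG : ContDiffAt ℝ ∞ G (τ q))
    (hτ : ContDiffAt ℝ ∞ τ q) (i j : Fin 2) :
    pd i (pd j (fun w => G (τ w))) q =
      (pd i (pd j τ) q 0 • pd 0 G (τ q) + pd i (pd j τ) q 1 • pd 1 G (τ q))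
      + (pd j τ q 0 • (pd i τ q 0 • pd 0 (pd 0 G) (τ q) + pd i τ q 1 • pd 1 (pd 0 G) (τ q))
        + pd j τ q 1 • (pd i τ q 0 • pd 0 (pd 1 G) (τ q) + pd i τ q 1 • pd 1 (pd 1 G) (τ q))) := by
  have hd : ∀ᶠ w in 𝓝 q, DifferentiableAt ℝ G (τ w) ∧ DifferentiableAt ℝ τ w := by
    have h1 : ContDiffAt ℝ 1 G (τ q) := hG.of_le (by simp)
    have h2 : ContDiffAt ℝ 1 τ q := hτ.of_le (by simp)
    filter_upwards [hτ.continuousAt.eventually (h1.eventually (by simp)),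
      h2.eventually (by simp)] with w a b
    exact ⟨a.differentiableAt (by simp), b.differentiableAt (by simp)⟩
  have e : pd j (fun w => G (τ w)) =ᶠ[𝓝 q]
      fun w => (pd j τ w) 0 • pd 0 G (τ w) + (pd j τ w) 1 • pd 1 G (τ w) := by
    filter_upwards [hd] with w hw using pd_comp j hw.1 hw.2
  have dτ := (contDiffAt_pd j hτ).diff
  have d1 : ∀ k : Fin 2, DifferentiableAt ℝ (fun w => (pd j τ w) k) q := fun k =>
    ((EuclideanSpace.proj k : Plane →L[ℝ] ℝ).differentiableAt).comp q dτ
  have d2 : ∀ k : Fin 2, DifferentiableAt ℝ (fun w => pd k G (τ w)) q := fun k =>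
    DifferentiableAt.comp q (contDiffAt_pd k hG).diff hτ.diff
  rw [pd_eventuallyEq i e, pd_add i ((d1 0).fun_smul (d2 0)) ((d1 1).fun_smul (d2 1)),
    pd_smul i (d1 0) (d2 0), pd_smul i (d1 1) (d2 1), pd_plane_apply i dτ, pd_plane_apply i dτ,
    pd_comp i (contDiffAt_pd 0 hG).diff hτ.diff, pd_comp i (contDiffAt_pd 1 hG).diff hτ.diff]
  module

/-- The Jacobian determinant. -/
noncomputable def jac (τ : Plane → Plane) (q : Plane) : ℝ :=
  pd 0 τ q 0 * pd 1 τ q 1 - pd 0 τ q 1 * pd 1 τ q 0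

lemma gramDet_comp {X : Plane → E41} {τ : Plane → Plane} (hX : DifferentiableAt ℝ X (τ q))
    (hτ : DifferentiableAt ℝ τ q) :
    gramDet (fun w => X (τ w)) q = jac τ q ^ 2 * gramDet X (τ q) := by
  simp only [gramDet, pd_comp _ hX hτ, form_add_left, form_add_right, form_smul_left,
    form_smul_right, form_comm (pd 1 X (τ q)) (pd 0 X (τ q)), jac]
  ring

/-- By the chain rule both sides describe the tangential part of ∂ᵢ∂ⱼ(X ∘ τ). They agree because the
Jacobian and the metric are invertible. -/
lemma christoffel_comp {X : Plane → E41} {τ : Plane → Plane} (hX : ContDiffAt ℝ ∞ X (τ q))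
    (hτ : ContDiffAt ℝ ∞ τ q) (hD : gramDet (fun w => X (τ w)) q ≠ 0) (i j c : Fin 2) :
    christoffel (fun w => X (τ w)) 0 i j q * pd 0 τ q c
      + christoffel (fun w => X (τ w)) 1 i j q * pd 1 τ q c
    = pd i (pd j τ) q c
      + (pd j τ q 0 * (pd i τ q 0 * christoffel X c 0 0 (τ q)
          + pd i τ q 1 * christoffel X c 0 1 (τ q))
        + pd j τ q 1 * (pd i τ q 0 * christoffel X c 0 1 (τ q)
          + pd i τ q 1 * christoffel X c 1 1 (τ q))) := by
  have hXτ : ContDiffAt ℝ ∞ (fun w => X (τ w)) q := ContDiffAt.comp q hX hτ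
  have hD' := hD
  rw [gramDet_comp hX.diff hτ.diff] at hD'
  have hJ : jac τ q ≠ 0 := fun h => hD' (by rw [h]; ring)
  have hDX : gramDet X (τ q) ≠ 0 := fun h => hD' (by rw [h]; ring)
  have h1 := fun l => sum_christoffel_mul_metric hXτ hD i j l
  have h2 := fun i j l => sum_christoffel_mul_metric hX hDX i j l
  have a0 := h1 0
  have a1 := h1 1
  simp only [pd_pd_comp hX hτ, pd_comp _ hX.diff hτ.diff, form_add_left, form_add_right,
    form_smul_left, form_smul_right, pd_comm 1 0 hX, ← h2] at a0 a1
  rw [form_comm (pd 1 X (τ q)) (pd 0 X (τ q))] at a0 a1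
  have hDX' : form (pd 0 X (τ q)) (pd 0 X (τ q)) * form (pd 1 X (τ q)) (pd 1 X (τ q))
    - form (pd 0 X (τ q)) (pd 1 X (τ q)) ^ 2 ≠ 0 := hDX
  have hJ' : pd 0 τ q 0 * pd 1 τ q 1 - pd 0 τ q 1 * pd 1 τ q 0 ≠ 0 := hJ
  clear h1 h2
  generalize form (pd 0 X (τ q)) (pd 0 X (τ q)) = E at *
  generalize form (pd 0 X (τ q)) (pd 1 X (τ q)) = F at *
  generalize form (pd 1 X (τ q)) (pd 1 X (τ q)) = G at *
  generalize christoffel (fun w => X (τ w)) 0 i j q = Γ0 at *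
  generalize christoffel (fun w => X (τ w)) 1 i j q = Γ1 at *
  -- This is the difference of the two sides; the Jacobian matrix and then the Gram matrix are
  -- cancelled from a linear system for it.
  set v : Fin 2 → ℝ := fun c => Γ0 * pd 0 τ q c + Γ1 * pd 1 τ q c - (pd i (pd j τ) q c
      + (pd j τ q 0 * (pd i τ q 0 * christoffel X c 0 0 (τ q)
          + pd i τ q 1 * christoffel X c 0 1 (τ q))
        + pd j τ q 1 * (pd i τ q 0 * christoffel X c 0 1 (τ q)
          + pd i τ q 1 * christoffel X c 1 1 (τ q)))) with hv
  have b0 : pd 0 τ q 0 * (v 0 * E + v 1 * F) + pd 0 τ q 1 * (v 0 * F + v 1 * G) = 0 := by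
    simp only [hv]; linear_combination a0
  have b1 : pd 1 τ q 0 * (v 0 * E + v 1 * F) + pd 1 τ q 1 * (v 0 * F + v 1 * G) = 0 := by
    simp only [hv]; linear_combination a1
  have c0 : v 0 * E + v 1 * F = 0 := (mul_eq_zero.1 (show _ * (v 0 * E + v 1 * F) = 0 by
    linear_combination pd 1 τ q 1 * b0 - pd 0 τ q 1 * b1)).resolve_left hJ'
  have c1 : v 0 * F + v 1 * G = 0 := (mul_eq_zero.1 (show _ * (v 0 * F + v 1 * G) = 0 by
    linear_combination -pd 1 τ q 0 * b0 + pd 0 τ q 0 * b1)).resolve_left hJ'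
  have d0 : v 0 = 0 := (mul_eq_zero.1 (show _ * v 0 = 0 by
    linear_combination G * c0 - F * c1)).resolve_left hDX'
  have d1 : v 1 = 0 := (mul_eq_zero.1 (show _ * v 1 = 0 by
    linear_combination E * c1 - F * c0)).resolve_left hDX'
  have : v c = 0 := by fin_cases c <;> assumption
  simp only [hv] at this
  linarith

/-- The Laplacian at p is defined in the preferred chart at p, which changes with p. To treat it as
a smooth function of the point, its nearby values must be computed in a single chart. -/
theorem laplaceCoord_comp {X : Plane → E41} {G : Plane → W} {τ : Plane → Plane}
    (hX : ContDiffAt ℝ ∞ X (τ q)) (hG : ContDiffAt ℝ ∞ G (τ q)) (hτ : ContDiffAt ℝ ∞ τ q)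
    (hD : gramDet (fun w => X (τ w)) q ≠ 0) :
    laplaceCoord (fun w => X (τ w)) (fun w => G (τ w)) q = laplaceCoord X G (τ q) := by
  have hXτ : ContDiffAt ℝ ∞ (fun w => X (τ w)) q := ContDiffAt.comp q hX hτ
  have hGτ : ContDiffAt ℝ ∞ (fun w => G (τ w)) q := ContDiffAt.comp q hG hτ
  have hD' := hD
  rw [gramDet_comp hX.diff hτ.diff] at hD'
  have hDX : gramDet X (τ q) ≠ 0 := fun h => hD' (by rw [h]; ring)
  -- the Hessian is a tensor
  have key : ∀ i j, pd i (pd j (fun w => G (τ w))) q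
      - (christoffel (fun w => X (τ w)) 0 i j q • pd 0 (fun w => G (τ w)) q
        + christoffel (fun w => X (τ w)) 1 i j q • pd 1 (fun w => G (τ w)) q)
      = (pd j τ q 0 * pd i τ q 0) • (pd 0 (pd 0 G) (τ q)
          - (christoffel X 0 0 0 (τ q) • pd 0 G (τ q) + christoffel X 1 0 0 (τ q) • pd 1 G (τ q)))
        + (pd j τ q 0 * pd i τ q 1 + pd j τ q 1 * pd i τ q 0) • (pd 0 (pd 1 G) (τ q)
          - (christoffel X 0 0 1 (τ q) • pd 0 G (τ q) + christoffel X 1 0 1 (τ q) • pd 1 G (τ q)))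
        + (pd j τ q 1 * pd i τ q 1) • (pd 1 (pd 1 G) (τ q)
          - (christoffel X 0 1 1 (τ q) • pd 0 G (τ q)
            + christoffel X 1 1 1 (τ q) • pd 1 G (τ q))) := by
    intro i j
    have k0 := christoffel_comp hX hτ hD i j 0
    have k1 := christoffel_comp hX hτ hD i j 1
    rw [pd_pd_comp hG hτ, pd_comp _ hG.diff hτ.diff, pd_comp _ hG.diff hτ.diff, pd_comm 1 0 hG]
    have e : christoffel (fun w => X (τ w)) 0 i j q •
          (pd 0 τ q 0 • pd 0 G (τ q) + pd 0 τ q 1 • pd 1 G (τ q))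
        + christoffel (fun w => X (τ w)) 1 i j q •
          (pd 1 τ q 0 • pd 0 G (τ q) + pd 1 τ q 1 • pd 1 G (τ q))
        = (christoffel (fun w => X (τ w)) 0 i j q * pd 0 τ q 0
            + christoffel (fun w => X (τ w)) 1 i j q * pd 1 τ q 0) • pd 0 G (τ q)
          + (christoffel (fun w => X (τ w)) 0 i j q * pd 0 τ q 1
            + christoffel (fun w => X (τ w)) 1 i j q * pd 1 τ q 1) • pd 1 G (τ q) := by module
    rw [e, k0, k1]
    module
  have h1 := gramDet_smul_laplaceCoord hXτ hGτ hD
  have h2 := gramDet_smul_laplaceCoord hX hG hDX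
  rw [key, key, key] at h1
  have h3 : gramDet (fun w => X (τ w)) q •
      laplaceCoord (fun w => X (τ w)) (fun w => G (τ w)) q
      = jac τ q ^ 2 • (gramDet X (τ q) • laplaceCoord X G (τ q)) := by
    rw [h1, h2]
    simp only [pd_comp _ hX.diff hτ.diff, form_add_left, form_add_right, form_smul_left,
      form_smul_right, form_comm (pd 1 X (τ q)) (pd 0 X (τ q)), jac]
    generalize pd 0 (pd 0 G) (τ q) - (christoffel X 0 0 0 (τ q) • pd 0 G (τ q)
      + christoffel X 1 0 0 (τ q) • pd 1 G (τ q)) = K00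
    generalize pd 0 (pd 1 G) (τ q) - (christoffel X 0 0 1 (τ q) • pd 0 G (τ q)
      + christoffel X 1 0 1 (τ q) • pd 1 G (τ q)) = K01
    generalize pd 1 (pd 1 G) (τ q) - (christoffel X 0 1 1 (τ q) • pd 0 G (τ q)
      + christoffel X 1 1 1 (τ q) • pd 1 G (τ q)) = K11
    module
  rw [smul_smul, ← gramDet_comp hX.diff hτ.diff] at h3
  exact smul_right_injective W hD h3

end Invariance

/-! ### From the manifold to coordinates -/

section Manifold

variable {M : Type*} [TopologicalSpace M] [ChartedSpace Plane M]
  {W : Type*} [NormedAddCommGroup W] [NormedSpace ℝ W]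

lemma contDiffAt_comp_param {G : M → W} {s : Plane → M} {q : Plane}
    (hG : ContMDiffAt (𝓡 2) 𝓘(ℝ, W) ∞ G (s q)) (hs : ContMDiffAt (𝓡 2) (𝓡 2) ∞ s q) :
    ContDiffAt ℝ ∞ (fun w => G (s w)) q :=
  (ContMDiffAt.comp q hG hs).contDiffAt

lemma meanCurvature_eq (x : M → E41) (p : M) :
    meanCurvature x p = (-1 / 2 : ℝ) • laplace x x p :=
  meanCurvatureCoord_eq _ _

lemma mfderiv_param {G : M → W} {s : Plane → M} {q : Plane}
    (hG : ContMDiffAt (𝓡 2) 𝓘(ℝ, W) ∞ G (s q)) (hs : ContMDiffAt (𝓡 2) (𝓡 2) ∞ s q)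
    (u : Plane) : mfderiv (𝓡 2) 𝓘(ℝ, W) G (s q) (mfderiv (𝓡 2) (𝓡 2) s q u)
      = u 0 • pd 0 (fun w => G (s w)) q + u 1 • pd 1 (fun w => G (s w)) q := by
  have h := mfderiv_comp q (hG.mdifferentiableAt (by simp)) (hs.mdifferentiableAt (by simp))
  have h2 : fderiv ℝ (fun w => G (s w)) q = mfderiv 𝓘(ℝ, Plane) 𝓘(ℝ, W) (G ∘ s) q :=
    (mfderiv_eq_fderiv).symm
  rw [← fderiv_eq_pd, h2, h]
  rfl

variable [IsManifold (𝓡 2) ∞ M]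

lemma contMDiffAt_chart_symm (p : M) {q : Plane} (hq : q ∈ (chartAt Plane p).target) :
    ContMDiffAt (𝓡 2) (𝓡 2) ∞ (chartAt Plane p).symm q :=
  (contMDiffOn_chart_symm (I := 𝓡 2)).contMDiffAt ((chartAt Plane p).open_target.mem_nhds hq)

lemma contMDiffAt_chart (p : M) {p' : M} (hp : p' ∈ (chartAt Plane p).source) :
    ContMDiffAt (𝓡 2) (𝓡 2) ∞ (chartAt Plane p) p' :=
  (contMDiffOn_chart (I := 𝓡 2)).contMDiffAt ((chartAt Plane p).open_source.mem_nhds hp)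

lemma contDiffAt_inChart {G : M → W} (p : M) {q : Plane} (hq : q ∈ (chartAt Plane p).target)
    (hG : ContMDiffAt (𝓡 2) 𝓘(ℝ, W) ∞ G ((chartAt Plane p).symm q)) :
    ContDiffAt ℝ ∞ (inChart p G) q :=
  contDiffAt_comp_param (s := (chartAt Plane p).symm) hG (contMDiffAt_chart_symm p hq)

lemma contMDiffAt_of_inChart {G : M → W} (p : M) {p' : M} (hp : p' ∈ (chartAt Plane p).source)
    (hG : ContDiffAt ℝ ∞ (inChart p G) (chartAt Plane p p')) :
    ContMDiffAt (𝓡 2) 𝓘(ℝ, W) ∞ G p' := by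
  have h := ContMDiffAt.comp p' hG.contMDiffAt (contMDiffAt_chart p hp)
  refine h.congr_of_eventuallyEq ?_
  filter_upwards [(chartAt Plane p).open_source.mem_nhds hp] with w hw
  simp [inChart, (chartAt Plane p).left_inv hw]

/-- The Laplace operator can be computed in any regular parametrization. -/
theorem laplace_param {x : M → E41} {G : M → W} {s : Plane → M} {q : Plane}
    (hx : ContMDiffAt (𝓡 2) 𝓘(ℝ, E41) ∞ x (s q)) (hG : ContMDiffAt (𝓡 2) 𝓘(ℝ, W) ∞ G (s q))
    (hs : ContMDiffAt (𝓡 2) (𝓡 2) ∞ s q) (hD : gramDet (fun w => x (s w)) q ≠ 0) :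
    laplace x G (s q) = laplaceCoord (fun w => x (s w)) (fun w => G (s w)) q := by
  set c := chartAt Plane (s q) with hc
  have hmem : s q ∈ c.source := mem_chart_source Plane (s q)
  have hτ : ContDiffAt ℝ ∞ (fun w => c (s w)) q :=
    (ContMDiffAt.comp q (contMDiffAt_chart (s q) hmem) hs).contDiffAt
  have hev : ∀ᶠ w in 𝓝 q, c.symm (c (s w)) = s w := by
    filter_upwards [hs.continuousAt.eventually (c.open_source.mem_nhds hmem)] with w hw
      using c.left_inv hw
  have ht : c (s q) ∈ c.target := c.map_source hmem
  have hl : c.symm (c (s q)) = s q := c.left_inv hmem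
  have hX : ContDiffAt ℝ ∞ (inChart (s q) x) (c (s q)) :=
    contDiffAt_inChart (s q) ht (by rw [hl]; exact hx)
  have hGc : ContDiffAt ℝ ∞ (inChart (s q) G) (c (s q)) :=
    contDiffAt_inChart (s q) ht (by rw [hl]; exact hG)
  have e1 : (fun w => inChart (s q) x (c (s w))) =ᶠ[𝓝 q] fun w => x (s w) := by
    filter_upwards [hev] with w hw
    change x (c.symm (c (s w))) = _
    rw [hw]
  have e2 : (fun w => inChart (s q) G (c (s w))) =ᶠ[𝓝 q] fun w => G (s w) := by
    filter_upwards [hev] with w hw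
    change G (c.symm (c (s w))) = _
    rw [hw]
  have hD' : gramDet (fun w => inChart (s q) x (c (s w))) q ≠ 0 := by
    rw [← det_metric] at hD ⊢
    rwa [(metric_eventuallyEq e1).eq_of_nhds]
  have := laplaceCoord_comp (τ := fun w => c (s w)) hX hGc hτ hD'
  rw [laplaceCoord_congr_metric (metric_eventuallyEq e1), laplaceCoord_congr e2] at this
  exact this.symm

lemma meanCurvature_param {x : M → E41} {s : Plane → M} {q : Plane}
    (hx : ContMDiffAt (𝓡 2) 𝓘(ℝ, E41) ∞ x (s q)) (hs : ContMDiffAt (𝓡 2) (𝓡 2) ∞ s q)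
    (hD : gramDet (fun w => x (s w)) q ≠ 0) :
    meanCurvature x (s q) = meanCurvatureCoord (fun w => x (s w)) q := by
  rw [meanCurvature_eq, laplace_param hx hx hs hD, ← meanCurvatureCoord_eq]

lemma mfderiv_chart_symm_bijective (p : M) {q : Plane} (hq : q ∈ (chartAt Plane p).target) :
    Function.Bijective (mfderiv (𝓡 2) (𝓡 2) (chartAt Plane p).symm q) := by
  have hq' : q ∈ (extChartAt (𝓡 2) p).target := by simpa using hq
  have h := isInvertible_mfderivWithin_extChartAt_symm (I := 𝓡 2) hq'
  rw [ModelWithCorners.range_eq_univ, mfderivWithin_univ] at h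
  have e : ((extChartAt (𝓡 2) p).symm : Plane → M) = (chartAt Plane p).symm := by
    simp
  rw [e] at h
  exact h.bijective

lemma exists_mfderiv_eq (p : M) {q : Plane} (hq : q ∈ (chartAt Plane p).target) {G : M → W}
    (hG : ContMDiffAt (𝓡 2) 𝓘(ℝ, W) ∞ G ((chartAt Plane p).symm q))
    (v : TangentSpace (𝓡 2) ((chartAt Plane p).symm q)) :
    ∃ a b : ℝ, mfderiv (𝓡 2) 𝓘(ℝ, W) G ((chartAt Plane p).symm q) v
        = a • pd 0 (inChart p G) q + b • pd 1 (inChart p G) q := by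
  obtain ⟨u, hu⟩ := (mfderiv_chart_symm_bijective p hq).2 v
  exact ⟨_, _, by rw [← hu]; exact mfderiv_param hG (contMDiffAt_chart_symm p hq) u⟩

lemma form_pd_inChart_pos {x : M → E41} (hx : IsSpacelikeSurface x) (p : M) {q : Plane}
    (hq : q ∈ (chartAt Plane p).target) {a b : ℝ} (hab : a ≠ 0 ∨ b ≠ 0) :
    0 < form (a • pd 0 (inChart p x) q + b • pd 1 (inChart p x) q)
      (a • pd 0 (inChart p x) q + b • pd 1 (inChart p x) q) := by
  have h := mfderiv_param (hx.1 ((chartAt Plane p).symm q)) (contMDiffAt_chart_symm p hq)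
    (!₂[a, b] : Plane)
  have e : ((!₂[a, b] : Plane) 0 • pd 0 (fun w => x ((chartAt Plane p).symm w)) q
      + (!₂[a, b] : Plane) 1 • pd 1 (fun w => x ((chartAt Plane p).symm w)) q)
      = a • pd 0 (inChart p x) q + b • pd 1 (inChart p x) q := rfl
  rw [e] at h
  rw [← h]
  apply hx.2
  intro h0
  have h1 : (!₂[a, b] : Plane) = 0 := (mfderiv_chart_symm_bijective p hq).1 (by
    rw [h0]; exact (map_zero _).symm)
  have e0 := congrArg (fun v : Plane => v 0) h1
  have e1 := congrArg (fun v : Plane => v 1) h1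
  simp at e0 e1
  rcases hab with h | h
  · exact h e0
  · exact h e1

lemma form_pd_zero_inChart_pos {x : M → E41} (hx : IsSpacelikeSurface x) (p : M) {q : Plane}
    (hq : q ∈ (chartAt Plane p).target) :
    0 < form (pd 0 (inChart p x) q) (pd 0 (inChart p x) q) := by
  have := form_pd_inChart_pos hx p hq (a := 1) (b := 0) (Or.inl one_ne_zero)
  simpa using this

lemma gramDet_inChart_pos {x : M → E41} (hx : IsSpacelikeSurface x) (p : M) {q : Plane}
    (hq : q ∈ (chartAt Plane p).target) : 0 < gramDet (inChart p x) q := by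
  have hE := form_pd_zero_inChart_pos hx p hq
  have := form_pd_inChart_pos hx p hq
    (a := -form (pd 0 (inChart p x) q) (pd 1 (inChart p x) q))
    (b := form (pd 0 (inChart p x) q) (pd 0 (inChart p x) q)) (Or.inr hE.ne')
  simp only [form_add_left, form_add_right, form_smul_left, form_smul_right,
    form_comm (pd 1 (inChart p x) q) (pd 0 (inChart p x) q)] at this
  have h2 : 0 < form (pd 0 (inChart p x) q) (pd 0 (inChart p x) q) * gramDet (inChart p x) q := by
    rw [gramDet]; linarith
  exact pos_of_mul_pos_right h2 hE.le

/-- The coefficient of the Gauss map with respect to the wedge product of the partial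
derivatives. -/
noncomputable def gaussCoeff (X : Plane → E41) (N : Plane → Bivector) (q : Plane) : ℝ :=
  bform (N q) (wedge (pd 0 X q) (pd 1 X q)) / gramDet X q

/-- Only continuity of ν is assumed. Smoothness follows since the coefficient can only be ±1/√(det
g), and continuity fixes the sign locally. -/
lemma isGaussPatch_inChart {x : M → E41} (hx : IsSpacelikeSurface x) {ν : M → Bivector}
    (hν : IsGaussMap x ν) (p : M) :
    IsGaussPatch (inChart p x) (gaussCoeff (inChart p x) (inChart p ν)) (inChart p ν)
      (chartAt Plane p).target := by
  set X := inChart p x with hX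
  set N := inChart p ν with hN
  set V := (chartAt Plane p).target with hV
  have hVo : IsOpen V := (chartAt Plane p).open_target
  have hsm : ∀ q ∈ V, ContDiffAt ℝ ∞ X q := fun q hq => contDiffAt_inChart p hq (hx.1 _)
  have hD : ∀ q ∈ V, 0 < gramDet X q := fun q hq => gramDet_inChart_pos hx p hq
  have hself : ∀ q, bform (wedge (pd 0 X q) (pd 1 X q)) (wedge (pd 0 X q) (pd 1 X q))
      = gramDet X q := fun q => by
    rw [bform_wedge, gramDet, form_comm (pd 1 X q) (pd 0 X q)]; ring
  have hex : ∀ q ∈ V, ∃ m : ℝ, m ^ 2 * gramDet X q = 1 ∧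
      N q = m • wedge (pd 0 X q) (pd 1 X q) := by
    intro q hq
    obtain ⟨v, w, h1, h2, h3, h4⟩ := hν.2 ((chartAt Plane p).symm q)
    obtain ⟨a, b, hab⟩ := exists_mfderiv_eq p hq (hx.1 _) v
    obtain ⟨c, d, hcd⟩ := exists_mfderiv_eq p hq (hx.1 _) w
    rw [hab] at h1 h3 h4
    rw [hcd] at h2 h3 h4
    simp only [form_add_left, form_add_right, form_smul_left, form_smul_right,
      form_comm (pd 1 (inChart p x) q) (pd 0 (inChart p x) q)] at h1 h2 h3
    -- The coefficient is the determinant of the change of basis to the orthonormal pair, whose Gram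
    -- determinant is 1.
    refine ⟨a * d - b * c, ?_, ?_⟩
    · rw [gramDet]
      have : (a * (a * form (pd 0 X q) (pd 0 X q)) + b * (a * form (pd 0 X q) (pd 1 X q))
          + (a * (b * form (pd 0 X q) (pd 1 X q)) + b * (b * form (pd 1 X q) (pd 1 X q)))) = 1 := by
        linarith
      linear_combination (c * (c * form (pd 0 X q) (pd 0 X q)) + d * (c * form (pd 0 X q) (pd 1 X q))
          + (c * (d * form (pd 0 X q) (pd 1 X q)) + d * (d * form (pd 1 X q) (pd 1 X q)))) * this
          + h2 - (a * (c * form (pd 0 X q) (pd 0 X q)) + b * (c * form (pd 0 X q) (pd 1 X q))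
          + (a * (d * form (pd 0 X q) (pd 1 X q)) + b * (d * form (pd 1 X q) (pd 1 X q)))) * h3
    · change ν _ = _
      rw [h4]
      ext ij
      simp only [wedge, Pi.add_apply, Pi.smul_apply, smul_eq_mul, hX]
      ring
  have hμ : ∀ q ∈ V, gaussCoeff X N q ^ 2 * gramDet X q = 1 ∧
      N q = gaussCoeff X N q • wedge (pd 0 X q) (pd 1 X q) := by
    intro q hq
    obtain ⟨m, h1, h2⟩ := hex q hq
    have : gaussCoeff X N q = m := by
      rw [gaussCoeff, h2, bform_smul_left, hself, mul_div_cancel_right₀ _ (hD q hq).ne']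
    rw [this]
    exact ⟨h1, h2⟩
  refine ⟨hVo, hsm, fun q hq => form_pd_zero_inChart_pos hx p hq, hD, fun q hq => ?_,
    fun q hq => (hμ q hq).1, fun q hq => (hμ q hq).2⟩
  -- the sign of the coefficient is locally constant
  have hNc : ContinuousAt N q := by
    have := (chartAt Plane p).continuousAt_symm hq
    exact hν.1.continuousAt.comp this
  have hW : ContDiffAt ℝ ∞ (fun w => wedge (pd 0 X w) (pd 1 X w)) q :=
    contDiffAt_wedge (contDiffAt_pd 0 (hsm q hq)) (contDiffAt_pd 1 (hsm q hq))
  have hc : ContinuousAt (gaussCoeff X N) q := by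
    refine ContinuousAt.div ?_ (contDiffAt_gramDet (hsm q hq)).continuousAt (hD q hq).ne'
    exact (bformL.continuous.continuousAt.comp hNc).clm_apply hW.continuousAt
  set m := gaussCoeff X N q with hm
  have hm0 : m ≠ 0 := by
    intro h0
    have := (hμ q hq).1
    rw [← hm, h0] at this
    norm_num at this
  have hpos : ∀ᶠ w in 𝓝 q, w ∈ V ∧ 0 < gaussCoeff X N w * m := by
    refine Filter.Eventually.and (hVo.mem_nhds hq) ?_
    exact (hc.mul continuousAt_const).eventually (lt_mem_nhds (mul_self_pos.2 hm0))
  have heq : gaussCoeff X N =ᶠ[𝓝 q] fun w => m / |m| * (Real.sqrt (gramDet X w))⁻¹ := by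
    filter_upwards [hpos] with w hw
    have h1 := (hμ w hw.1).1
    have hs := Real.sq_sqrt (hD w hw.1).le
    have hsp := Real.sqrt_pos.2 (hD w hw.1)
    have habs : |gaussCoeff X N w| = (Real.sqrt (gramDet X w))⁻¹ := by
      rw [← Real.sqrt_inv, ← Real.sqrt_sq_eq_abs]
      congr 1
      exact eq_inv_of_mul_eq_one_left h1
    rw [← habs]
    rcases lt_or_gt_of_ne hm0 with hneg | hpos'
    · have h3 : gaussCoeff X N w < 0 := by nlinarith [hw.2]
      rw [abs_of_neg hneg, abs_of_neg h3]; field_simp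
    · have h3 : 0 < gaussCoeff X N w := by nlinarith [hw.2]
      rw [abs_of_pos hpos', abs_of_pos h3]; field_simp
  refine ContDiffAt.congr_of_eventuallyEq ?_ heq
  exact contDiffAt_const.mul (((contDiffAt_gramDet (hsm q hq)).sqrt (hD q hq).ne').inv
    (Real.sqrt_pos.2 (hD q hq)).ne')

end Manifold

/-! ### Marginally trapped patches -/

lemma IsFrame.expand {a b ξ η : E41} (h : IsFrame a b ξ η) (hη : form η η = 0) (v : E41) :
    v = ((form b b * form a v - form a b * form b v) / (form a a * form b b - form a b ^ 2)) • a
      + ((form a a * form b v - form a b * form a v) / (form a a * form b b - form a b ^ 2)) • b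
      - form v η • ξ - form v ξ • η := by
  have hd := h.det_ne
  rw [← sub_eq_zero]
  have e1 := form_comm ξ a
  have e2 := form_comm η a
  have e3 := form_comm ξ b
  have e4 := form_comm η b
  have e5 := form_comm η ξ
  rw [h.aξ] at e1
  rw [h.aη] at e2
  rw [h.bξ] at e3
  rw [h.bη] at e4
  rw [h.ξη] at e5
  apply h.eq_zero
  all_goals simp only [form_sub_right, form_add_right, form_smul_right, e1, e2, e3, e4, e5, h.aξ,
    h.aη, h.bξ, h.bη, h.ξξ, h.ξη, hη, form_comm b a, form_comm v]
  · simp only [div_eq_mul_inv]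
    rw [form_comm a v, form_comm b v]
    linear_combination -(form v a) * mul_inv_cancel₀ hd
  · simp only [div_eq_mul_inv]
    rw [form_comm a v, form_comm b v]
    linear_combination -(form v b) * mul_inv_cancel₀ hd
  · rw [form_comm η v, form_comm ξ v]; ring
  · rw [form_comm η v, form_comm ξ v]; ring

/-- A symmetric form that is singular and trace-free with respect to a positive definite one
vanishes. -/
lemma eq_zero_of_trace_eq_zero_of_det_eq_zero {E F G b₀ b₁ b₂ : ℝ} (hE : 0 < E)
    (hD : 0 < E * G - F ^ 2) (ht : G * b₀ - 2 * F * b₁ + E * b₂ = 0) (hd : b₀ * b₂ = b₁ ^ 2) :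
    b₀ = 0 ∧ b₁ = 0 ∧ b₂ = 0 := by
  have h1 : (G * b₀ - E * b₂) ^ 2 + 4 * (E * G - F ^ 2) * b₁ ^ 2 = 0 := by
    linear_combination (G * b₀ + 2 * F * b₁ + E * b₂) * ht - 4 * (E * G) * hd
  have h2 : b₁ ^ 2 = 0 := by nlinarith [sq_nonneg (G * b₀ - E * b₂), sq_nonneg b₁]
  have h3 : b₁ = 0 := pow_eq_zero_iff (two_ne_zero) |>.1 h2
  have h4 : G * b₀ - E * b₂ = 0 := by
    have : (G * b₀ - E * b₂) ^ 2 = 0 := by rw [h2] at h1; linarith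
    exact pow_eq_zero_iff (two_ne_zero) |>.1 this
  rw [h3] at ht
  have h5 : b₂ = 0 := by
    have : E * b₂ = 0 := by linarith
    exact (mul_eq_zero.1 this).resolve_left hE.ne'
  have hG : G ≠ 0 := by
    intro h0
    rw [h0] at hD
    nlinarith [sq_nonneg F]
  have h6 : b₀ = 0 := by
    rw [h5] at ht
    have : G * b₀ = 0 := by linarith
    exact (mul_eq_zero.1 this).resolve_left hG
  exact ⟨h6, h3, h5⟩

/-- A patch of a marginally trapped surface with its Gauss map. -/
structure IsTrappedPatch (X : Plane → E41) (μ : Plane → ℝ) (N : Plane → Bivector)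
    (V : Set Plane) : Prop extends IsGaussPatch X μ N V where
  H_ne : ∀ q ∈ V, meanCurvatureCoord X q ≠ 0
  H_null : ∀ q ∈ V, form (meanCurvatureCoord X q) (meanCurvatureCoord X q) = 0

/-- `η` is the second light-like normal field, normalized by `⟨H, η⟩ = -1`. -/
structure IsConjugateNormal (X η : Plane → E41) (V : Set Plane) : Prop where
  smooth : ∀ q ∈ V, ContDiffAt ℝ ∞ η q
  normal : ∀ q ∈ V, ∀ l, form (pd l X q) (η q) = 0
  null : ∀ q ∈ V, form (η q) (η q) = 0
  H_η : ∀ q ∈ V, form (meanCurvatureCoord X q) (η q) = -1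

lemma apply_zero_ne_of_null {v : E41} (h : form v v = 0) (hv : v ≠ 0) : v 0 ≠ 0 := by
  intro h0
  simp only [form, h0] at h
  apply hv
  have h1 : v 1 = 0 := by nlinarith [sq_nonneg (v 1), sq_nonneg (v 2), sq_nonneg (v 3)]
  have h2 : v 2 = 0 := by nlinarith [sq_nonneg (v 1), sq_nonneg (v 2), sq_nonneg (v 3)]
  have h3 : v 3 = 0 := by nlinarith [sq_nonneg (v 1), sq_nonneg (v 2), sq_nonneg (v 3)]
  funext k; fin_cases k <;> assumption

namespace IsTrappedPatch

variable {X η : Plane → E41} {μ : Plane → ℝ} {N : Plane → Bivector} {V : Set Plane} {q : Plane}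

lemma smooth_H (h : IsTrappedPatch X μ N V) (hq : q ∈ V) :
    ContDiffAt ℝ ∞ (meanCurvatureCoord X) q :=
  contDiffAt_meanCurvatureCoord (h.smooth q hq) (h.det_ne hq)

lemma form_pd_H (h : IsTrappedPatch X μ N V) (hq : q ∈ V) (l : Fin 2) :
    form (pd l X q) (meanCurvatureCoord X q) = 0 :=
  form_meanCurvatureCoord_pd (h.smooth q hq) (h.det_ne hq) l

lemma form_pdH_H (h : IsTrappedPatch X μ N V) (hq : q ∈ V) (k : Fin 2) :
    form (pd k (meanCurvatureCoord X) q) (meanCurvatureCoord X q) = 0 := by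
  have d := (h.smooth_H hq).diff
  have e := pd_form k d d
  rw [pd_congr k h.isOpen h.H_null hq, pd_const, form_comm (meanCurvatureCoord X q)] at e
  linarith

lemma form_pdn_pdX (h : IsTrappedPatch X μ N V) (hη : ∀ w ∈ V, ContDiffAt ℝ ∞ η w)
    (hn : ∀ w ∈ V, ∀ l, form (pd l X w) (η w) = 0) (hq : q ∈ V) (k l : Fin 2) :
    form (pd k η q) (pd l X q) = -form (pd k (pd l X) q) (η q) := by
  have e := pd_form k (contDiffAt_pd l (h.smooth q hq)).diff (hη q hq).diff
  rw [pd_congr k h.isOpen (fun w hw => hn w hw l) hq, pd_const, form_comm (pd l X q)] at e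
  linarith

lemma form_pdH_pdX (h : IsTrappedPatch X μ N V) (hq : q ∈ V) (k l : Fin 2) :
    form (pd k (meanCurvatureCoord X) q) (pd l X q)
      = -form (pd k (pd l X) q) (meanCurvatureCoord X q) :=
  h.form_pdn_pdX (fun _ hw => h.smooth_H hw) (fun _ hw l => h.form_pd_H hw l) hq k l

lemma form_pdH_comm (h : IsTrappedPatch X μ N V) (hq : q ∈ V) :
    form (pd 1 (meanCurvatureCoord X) q) (pd 0 X q)
      = form (pd 0 (meanCurvatureCoord X) q) (pd 1 X q) := by
  rw [h.form_pdH_pdX hq, h.form_pdH_pdX hq, pd_comm 1 0 (h.smooth q hq)]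

lemma trace_pdH (h : IsTrappedPatch X μ N V) (hq : q ∈ V) :
    form (pd 1 X q) (pd 1 X q) * form (pd 0 (meanCurvatureCoord X) q) (pd 0 X q)
      - 2 * form (pd 0 X q) (pd 1 X q) * form (pd 0 (meanCurvatureCoord X) q) (pd 1 X q)
      + form (pd 0 X q) (pd 0 X q) * form (pd 1 (meanCurvatureCoord X) q) (pd 1 X q) = 0 := by
  have := trace_second_normal (h.smooth q hq) (h.det_ne hq) (h.form_pd_H hq)
  rw [h.H_null q hq] at this
  simp only [h.form_pdH_pdX hq]
  linarith

lemma isFrame (h : IsTrappedPatch X μ N V) (hq : q ∈ V) {n : E41}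
    (hn : ∀ l, form (pd l X q) n = 0) (hH : form (meanCurvatureCoord X q) n = -1) :
    IsFrame (pd 0 X q) (pd 1 X q) (meanCurvatureCoord X q) n :=
  ⟨h.det_ne hq, h.form_pd_H hq 0, hn 0, h.form_pd_H hq 1, hn 1, h.H_null q hq, hH⟩

/-- The normal part τ of the constant time vector e works on the whole patch: ⟨H, τ⟩ = ⟨H, e⟩ = -H₀,
and a non-zero null vector has H₀ ≠ 0. -/
lemma exists_conjugateNormal (h : IsTrappedPatch X μ N V) :
    ∃ η, IsConjugateNormal X η V := by
  set H := meanCurvatureCoord X with hH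
  set e : E41 := Pi.single 0 1 with he
  set τ : Plane → E41 := fun q => e
    - ((gramDet X q)⁻¹ * (form (pd 1 X q) (pd 1 X q) * form (pd 0 X q) e
      - form (pd 0 X q) (pd 1 X q) * form (pd 1 X q) e)) • pd 0 X q
    - ((gramDet X q)⁻¹ * (form (pd 0 X q) (pd 0 X q) * form (pd 1 X q) e
      - form (pd 0 X q) (pd 1 X q) * form (pd 0 X q) e)) • pd 1 X q with hτ
  have hτs : ∀ q ∈ V, ContDiffAt ℝ ∞ τ q := by
    intro q hq
    have hx := h.smooth q hq
    have p := fun i => contDiffAt_pd i hx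
    have pe := fun i => contDiffAt_form (p i) (contDiffAt_const (c := e))
    have g := fun i j => contDiffAt_metric hx i j
    have di := (contDiffAt_gramDet hx).inv (h.det_ne hq)
    exact (contDiffAt_const.sub ((di.mul (((g 1 1).mul (pe 0)).sub ((g 0 1).mul (pe 1)))).smul
      (p 0))).sub ((di.mul (((g 0 0).mul (pe 1)).sub ((g 0 1).mul (pe 0)))).smul (p 1))
  have hτn : ∀ q ∈ V, ∀ l, form (pd l X q) (τ q) = 0 := by
    intro q hq l
    have hd := inv_mul_cancel₀ (h.det_ne hq)
    simp only [hτ, form_sub_right, form_smul_right]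
    generalize hgd : (gramDet X q)⁻¹ = d at hd
    rw [gramDet] at hd
    fin_cases l
    · simp only [Fin.zero_eta]
      linear_combination -form (pd 0 X q) e * hd
    · simp only [Fin.mk_one, form_comm (pd 1 X q) (pd 0 X q)]
      linear_combination -form (pd 1 X q) e * hd
  have hτH : ∀ q ∈ V, form (H q) (τ q) = -(H q 0) := by
    intro q hq
    simp only [hτ, form_sub_right, form_smul_right]
    rw [form_comm (H q) (pd 0 X q), form_comm (H q) (pd 1 X q), h.form_pd_H hq 0, h.form_pd_H hq 1]
    simp [form, he]
  have hH0 : ∀ q ∈ V, H q 0 ≠ 0 := fun q hq =>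
    apply_zero_ne_of_null (h.H_null q hq) (h.H_ne q hq)
  have hH0s : ∀ q ∈ V, ContDiffAt ℝ ∞ (fun w => H w 0) q := fun q hq =>
    contDiffAt_pi.1 (h.smooth_H hq) 0
  -- The factor of τ normalizes the product with H. Adding a multiple of H does not change that
  -- product, and its coefficient is chosen to make the sum null.
  refine ⟨fun q => (H q 0)⁻¹ • τ q + ((H q 0)⁻¹ ^ 2 * form (τ q) (τ q) / 2) • H q, ?_, ?_, ?_, ?_⟩
  · intro q hq
    have i := (hH0s q hq).inv (hH0 q hq)
    exact (i.smul (hτs q hq)).add ((((i.pow 2).mul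
      (contDiffAt_form (hτs q hq) (hτs q hq))).div_const 2).smul (h.smooth_H hq))
  · intro q hq l
    rw [form_add_right, form_smul_right, form_smul_right, hτn q hq, h.form_pd_H hq]
    ring
  · intro q hq
    simp only [form_add_right, form_smul_right, form_add_left, form_smul_left]
    rw [form_comm (τ q) (H q), hτH q hq, h.H_null q hq]
    have := hH0 q hq
    field_simp
    ring
  · intro q hq
    simp only [form_add_right, form_smul_right]
    rw [hτH q hq, h.H_null q hq]
    have := hH0 q hq
    field_simp
    ring

/-- As H is null, ⟨∂H, H⟩ = 0. This is what restricts the constant C of the pointwise 1-type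
equation. -/
lemma bform_laplace_H_tangent (h : IsTrappedPatch X μ N V) (hq : q ∈ V) (k : Fin 2) :
    bform (laplaceCoord X N q) (wedge (meanCurvatureCoord X q) (pd k X q)) = 0 := by
  rw [h.bform_laplace_normal_tangent hq (h.form_pd_H hq), h.form_pdH_H hq, h.form_pdH_H hq]
  ring

lemma bform_N_normal_tangent (h : IsTrappedPatch X μ N V) (hq : q ∈ V) {n : E41}
    (hn : ∀ l, form (pd l X q) n = 0) (k : Fin 2) : bform (N q) (wedge n (pd k X q)) = 0 := by
  rw [h.eq_wedge q hq, bform_smul_left, bform_wedge, hn, hn]; ring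

lemma bform_N_normal_normal (h : IsTrappedPatch X μ N V) (hq : q ∈ V) {n m : E41}
    (hn : ∀ l, form (pd l X q) n = 0) : bform (N q) (wedge n m) = 0 := by
  rw [h.eq_wedge q hq, bform_smul_left, bform_wedge, hn, hn]; ring

/-- The commutator of the shape operators in the directions of two normal vectors, up to a
factor. -/
noncomputable def shapeCommutator (X : Plane → E41) (q : Plane) (n m : E41) : ℝ :=
  form (pd 1 X q) (pd 1 X q) * (form (pd 0 (pd 0 X) q) n * form (pd 0 (pd 1 X) q) m
      - form (pd 0 (pd 0 X) q) m * form (pd 0 (pd 1 X) q) n)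
    - form (pd 0 X q) (pd 1 X q) * (form (pd 0 (pd 0 X) q) n * form (pd 1 (pd 1 X) q) m
      - form (pd 0 (pd 0 X) q) m * form (pd 1 (pd 1 X) q) n)
    + form (pd 0 X q) (pd 0 X q) * (form (pd 0 (pd 1 X) q) n * form (pd 1 (pd 1 X) q) m
      - form (pd 0 (pd 1 X) q) m * form (pd 1 (pd 1 X) q) n)

/-- If the Laplacian of the Gauss map is proportional to the Gauss map, then the mean curvature
vector is parallel and the normal bundle is flat. -/
lemma parallel_of_laplace_eq_smul (h : IsTrappedPatch X μ N V) (hq : q ∈ V) {t : ℝ}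
    (ht : laplaceCoord X N q = t • N q) {n : E41} (hn : ∀ l, form (pd l X q) n = 0) :
    (∀ k, form (pd k (meanCurvatureCoord X) q) n = 0) ∧
      shapeCommutator X q (meanCurvatureCoord X q) n = 0 := by
  have hμ := h.mu_ne hq
  constructor
  · have e : ∀ k, form (pd 0 (meanCurvatureCoord X) q) n * form (pd 1 X q) (pd k X q)
        - form (pd 1 (meanCurvatureCoord X) q) n * form (pd 0 X q) (pd k X q) = 0 := by
      intro k
      have := h.bform_laplace_normal_tangent hq hn k
      rw [ht, bform_smul_left, h.bform_N_normal_tangent hq hn, mul_zero] at this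
      exact (mul_eq_zero.1 this.symm).resolve_left (mul_ne_zero (by norm_num) hμ)
    have e0 := e 0
    have e1 := e 1
    have hd := h.det_ne hq
    rw [form_comm (pd 1 X q) (pd 0 X q)] at e0
    have a0 : gramDet X q * form (pd 0 (meanCurvatureCoord X) q) n = 0 := by
      rw [gramDet]
      linear_combination form (pd 0 X q) (pd 0 X q) * e1 - form (pd 0 X q) (pd 1 X q) * e0
    have a1 : gramDet X q * form (pd 1 (meanCurvatureCoord X) q) n = 0 := by
      rw [gramDet]
      linear_combination form (pd 0 X q) (pd 1 X q) * e1 - form (pd 1 X q) (pd 1 X q) * e0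
    intro k
    fin_cases k
    · exact (mul_eq_zero.1 a0).resolve_left hd
    · exact (mul_eq_zero.1 a1).resolve_left hd
  · have := h.bform_laplace_normal_normal hq (h.form_pd_H hq) hn
    rw [ht, bform_smul_left, h.bform_N_normal_normal hq (h.form_pd_H hq), mul_zero, mul_zero] at this
    exact (mul_eq_zero.1 this.symm).resolve_left (mul_ne_zero (by norm_num) hμ)

/-- Converse of `parallel_of_laplace_eq_smul`. -/
lemma laplace_eq_smul_of_parallel (h : IsTrappedPatch X μ N V) (hq : q ∈ V) {n : E41}
    (hn : ∀ l, form (pd l X q) n = 0) (hHn : form (meanCurvatureCoord X q) n = -1)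
    (hp : ∀ k, form (pd k (meanCurvatureCoord X) q) n = 0)
    (hc : shapeCommutator X q (meanCurvatureCoord X q) n = 0) :
    laplaceCoord X N q = bform (laplaceCoord X N q) (N q) • N q := by
  rw [← sub_eq_zero]
  have hNN := h.bform_N_N hq
  have hd := h.det_ne hq
  have hHt := fun k => h.bform_laplace_H_tangent hq k
  have hnt : ∀ k, bform (laplaceCoord X N q) (wedge n (pd k X q)) = 0 := fun k => by
    rw [h.bform_laplace_normal_tangent hq hn, hp, hp]; ring
  have hnn : bform (laplaceCoord X N q) (wedge (meanCurvatureCoord X q) n) = 0 := by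
    have := h.bform_laplace_normal_normal hq (h.form_pd_H hq) hn
    change _ = _ * shapeCommutator X q (meanCurvatureCoord X q) n at this
    rw [hc, mul_zero] at this
    exact (mul_eq_zero.1 this).resolve_left hd
  have n1 := fun k => h.bform_N_normal_tangent hq (h.form_pd_H hq) k
  have n2 := fun k => h.bform_N_normal_tangent hq hn k
  have n3 := h.bform_N_normal_normal hq (h.form_pd_H hq) (m := n)
  apply (h.isFrame hq hn hHn).bivector_eq_zero
  · have : wedge (pd 0 X q) (pd 1 X q) = (μ q)⁻¹ • N q := by
      rw [h.eq_wedge q hq, smul_smul, inv_mul_cancel₀ (h.mu_ne hq), one_smul]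
    rw [this, bform_smul_right, bform_sub_left, bform_smul_left, hNN]
    ring
  all_goals rw [bform_sub_left, bform_smul_left]
  · rw [hnn, n3]; ring
  · rw [hHt, n1]; ring
  · rw [hHt, n1]; ring
  · rw [hnt, n2]; ring
  · rw [hnt, n2]; ring

end IsTrappedPatch

lemma wedge_anti (a b : E41) : wedge a b = -wedge b a := by
  funext k; simp only [wedge, Pi.neg_apply]; ring

lemma wedge_self (a : E41) : wedge a a = 0 := by
  funext k; simp only [wedge, Pi.zero_apply]; ring

lemma wedge_sub_left (a b c : E41) : wedge (a - b) c = wedge a c - wedge b c := by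
  funext k; simp only [wedge, Pi.sub_apply]; ring

lemma wedge_sub_right (a b c : E41) : wedge a (b - c) = wedge a b - wedge a c := by
  funext k; simp only [wedge, Pi.sub_apply]; ring

lemma bform_zero_left (B : Bivector) : bform 0 B = 0 := by simp [bform]

lemma bform_zero_right (B : Bivector) : bform B 0 = 0 := by simp [bform]

lemma bform_sub_right (A B C : Bivector) : bform A (B - C) = bform A B - bform A C := by
  simp only [bform, Pi.sub_apply]; ring

lemma bform_neg_right (A C : Bivector) : bform A (-C) = -bform A C := by
  simp only [bform, Pi.neg_apply]; ring

/-! ### The constant 2-vector vanishes where `H` changes its direction -/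

namespace IsTrappedPatch

variable {X η : Plane → E41} {μ : Plane → ℝ} {N : Plane → Bivector} {V V' : Set Plane} {q : Plane}

lemma mono (h : IsTrappedPatch X μ N V) (ho : IsOpen V') (hs : V' ⊆ V) :
    IsTrappedPatch X μ N V' :=
  { isOpen := ho
    smooth := fun q hq => h.smooth q (hs hq)
    pos := fun q hq => h.pos q (hs hq)
    det_pos := fun q hq => h.det_pos q (hs hq)
    smooth_mu := fun q hq => h.smooth_mu q (hs hq)
    mu_sq := fun q hq => h.mu_sq q (hs hq)
    eq_wedge := fun q hq => h.eq_wedge q (hs hq)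
    H_ne := fun q hq => h.H_ne q (hs hq)
    H_null := fun q hq => h.H_null q (hs hq) }

lemma quad_pos {E F G b₀ b₁ : ℝ} (hE : 0 < E) (hD : 0 < E * G - F ^ 2)
    (h0 : E * b₁ ^ 2 - 2 * F * b₀ * b₁ + G * b₀ ^ 2 = 0) : b₀ = 0 ∧ b₁ = 0 := by
  have h1 : (E * b₁ - F * b₀) ^ 2 + (E * G - F ^ 2) * b₀ ^ 2 = 0 := by
    linear_combination E * h0
  have h2 : b₀ ^ 2 = 0 := by nlinarith [sq_nonneg (E * b₁ - F * b₀), sq_nonneg b₀]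
  have h3 : b₀ = 0 := by simpa using h2
  refine ⟨h3, ?_⟩
  rw [h3] at h1
  have : (E * b₁) ^ 2 = 0 := by linarith
  exact (mul_eq_zero.1 (by simpa using this : E * b₁ = 0)).resolve_left hE.ne'

/-- Differentiating C ⟂ H ∧ X_k and expanding ∂H and ∂X_k in the frame gives two linear equations
for the two pairings, with coefficients ⟨∂ᵢH, X_k⟩. -/
lemma bform_wedge_eq_zero (h : IsTrappedPatch X μ N V) (hη : IsConjugateNormal X η V)
    {C : Bivector} (hC : ∀ w ∈ V, ∀ k, bform C (wedge (meanCurvatureCoord X w) (pd k X w)) = 0)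
    (hq : q ∈ V) {i k : Fin 2} (hne : form (pd i (meanCurvatureCoord X) q) (pd k X q) ≠ 0) :
    bform C (wedge (pd 0 X q) (pd 1 X q)) = 0 ∧
      bform C (wedge (meanCurvatureCoord X q) (η q)) = 0 := by
  have hE := h.pos q hq
  have hD := h.det_pos q hq
  have fr := h.isFrame hq (hη.normal q hq) (hη.H_η q hq)
  have hder : ∀ k, bform C (wedge (pd i (meanCurvatureCoord X) q) (pd k X q)) +
      bform C (wedge (meanCurvatureCoord X q) (pd i (pd k X) q)) = 0 := by
    intro k
    have d1 := (h.smooth_H hq).diff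
    have d2 := (contDiffAt_pd k (h.smooth q hq)).diff
    have e := pd_congr i h.isOpen (fun w hw => hC w hw k) hq
    rw [pd_const] at e
    have e2 := pd_bform i (differentiableAt_const C (x := q))
      ((contDiffAt_wedge (h.smooth_H hq) (contDiffAt_pd k (h.smooth q hq))).diff)
    rw [pd_const, pd_wedge i d1 d2, bform_zero_left, bform_add_right, zero_add] at e2
    rw [← e2, e]
  have x1 := fr.expand (hη.null q hq) (pd i (meanCurvatureCoord X) q)
  have x2 := fun k => fr.expand (hη.null q hq) (pd i (pd k X) q)
  have c0 := hC q hq 0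
  have c1 := hC q hq 1
  have e0 := hder 0
  have e1 := hder 1
  rw [x1, x2 0] at e0
  rw [x1, x2 1] at e1
  simp only [wedge_add_left, wedge_sub_left, wedge_smul_left, wedge_add_right, wedge_sub_right,
    wedge_smul_right, bform_add_right, bform_sub_right, bform_smul_right, c0, c1, wedge_self,
    bform_zero_right, wedge_anti (pd 1 X q) (pd 0 X q), bform_neg_right] at e0 e1
  have b1 := h.form_pdH_pdX hq i 1
  have b0 := h.form_pdH_pdX hq i 0
  rw [h.form_pdH_H hq] at e0 e1
  rw [form_comm (pd 0 X q) (pd i (meanCurvatureCoord X) q),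
    form_comm (pd 1 X q) (pd i (meanCurvatureCoord X) q)] at e0 e1
  rw [show form (pd i (pd 0 X) q) (meanCurvatureCoord X q)
    = -form (pd i (meanCurvatureCoord X) q) (pd 0 X q) by rw [b0]; ring] at e0
  rw [show form (pd i (pd 1 X) q) (meanCurvatureCoord X q)
    = -form (pd i (meanCurvatureCoord X) q) (pd 1 X q) by rw [b1]; ring] at e1
  have hd := mul_inv_cancel₀ hD.ne'
  simp only [div_eq_mul_inv] at e0 e1
  rw [gramDet] at hd hD
  generalize bform C (wedge (pd 0 X q) (pd 1 X q)) = P at *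
  generalize bform C (wedge (meanCurvatureCoord X q) (η q)) = Q at *
  generalize hβ0 : form (pd i (meanCurvatureCoord X) q) (pd 0 X q) = β0 at *
  generalize hβ1 : form (pd i (meanCurvatureCoord X) q) (pd 1 X q) = β1 at *
  generalize form (pd 0 X q) (pd 0 X q) = E at *
  generalize form (pd 0 X q) (pd 1 X q) = F at *
  generalize form (pd 1 X q) (pd 1 X q) = G at *
  generalize (E * G - F ^ 2)⁻¹ = d at *
  have k0 : P * (F * β0 - E * β1) + (E * G - F ^ 2) * β0 * Q = 0 := by
    linear_combination (E * G - F ^ 2) * e0 - P * (F * β0 - E * β1) * hd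
  have k1 : P * (G * β0 - F * β1) + (E * G - F ^ 2) * β1 * Q = 0 := by
    linear_combination (E * G - F ^ 2) * e1 - P * (G * β0 - F * β1) * hd
  have hββ : ¬ (β0 = 0 ∧ β1 = 0) := by
    rintro ⟨z0, z1⟩
    fin_cases k
    · exact hne (hβ0.trans z0)
    · exact hne (hβ1.trans z1)
  -- Eliminating Q leaves P times a definite quadratic form at (β0, β1) ≠ 0.
  have hP : P = 0 := by
    by_contra hP
    refine hββ (quad_pos hE hD ?_)
    have : P * (E * β1 ^ 2 - 2 * F * β0 * β1 + G * β0 ^ 2) = 0 := by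
      linear_combination β0 * k1 - β1 * k0
    exact (mul_eq_zero.1 this).resolve_left hP
  refine ⟨hP, ?_⟩
  by_contra hQ
  refine hββ ⟨?_, ?_⟩
  · rw [hP] at k0
    have : ((E * G - F ^ 2) * Q) * β0 = 0 := by linarith
    exact (mul_eq_zero.1 this).resolve_left (mul_ne_zero hD.ne' hQ)
  · rw [hP] at k1
    have : ((E * G - F ^ 2) * Q) * β1 = 0 := by linarith
    exact (mul_eq_zero.1 this).resolve_left (mul_ne_zero hD.ne' hQ)

/-- If the Gauss map satisfies `Δν = f (ν + C)`, `f ≠ 0`, and `H` changes its direction, then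
`C = 0`. -/
lemma const_eq_zero (h : IsTrappedPatch X μ N V) {f : Plane → ℝ} {C : Bivector}
    (hf : ∀ w ∈ V, f w ≠ 0) (hL : ∀ w ∈ V, laplaceCoord X N w = f w • (N w + C))
    (hq : q ∈ V) {i k : Fin 2}
    (hne : form (pd i (meanCurvatureCoord X) q) (pd k X q) ≠ 0) : C = 0 := by
  obtain ⟨η, hη⟩ := h.exists_conjugateNormal
  have hC : ∀ w ∈ V, ∀ k, bform C (wedge (meanCurvatureCoord X w) (pd k X w)) = 0 := by
    intro w hw k
    have e := h.bform_laplace_H_tangent hw k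
    rw [hL w hw, bform_smul_left, bform_add_left,
      h.bform_N_normal_tangent hw (h.form_pd_H hw), zero_add] at e
    exact (mul_eq_zero.1 e).resolve_left (hf w hw)
  have hPQ := h.bform_wedge_eq_zero hη hC hq hne
  have hcont : ContinuousAt (fun w => form (pd i (meanCurvatureCoord X) w) (pd k X w)) q :=
    (contDiffAt_form (contDiffAt_pd i (h.smooth_H hq)) (contDiffAt_pd k (h.smooth q hq))).continuousAt
  -- The non-vanishing of the entry persists near q, so C·(X₀ ∧ X₁) = 0 holds on a neighbourhood.
  -- Differentiating it once more reaches the pairings with η ∧ X_k.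
  have hev : (fun w => bform C (wedge (pd 0 X w) (pd 1 X w))) =ᶠ[𝓝 q] fun _ => 0 := by
    filter_upwards [hcont.eventually_ne hne, h.isOpen.mem_nhds hq] with w hw hwV
    exact (h.bform_wedge_eq_zero hη hC hwV hw).1
  have fr := h.isFrame hq (hη.normal q hq) (hη.H_η q hq)
  have hder : ∀ j, bform C (wedge (pd j (pd 0 X) q) (pd 1 X q)) +
      bform C (wedge (pd 0 X q) (pd j (pd 1 X) q)) = 0 := by
    intro j
    have s0 := contDiffAt_pd 0 (h.smooth q hq)
    have s1 := contDiffAt_pd 1 (h.smooth q hq)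
    have e := (pd_eventuallyEq' j hev).eq_of_nhds
    rw [pd_const] at e
    have e2 := pd_bform j (differentiableAt_const C (x := q)) ((contDiffAt_wedge s0 s1).diff)
    rw [pd_const, pd_wedge j s0.diff s1.diff, bform_zero_left, bform_add_right, zero_add] at e2
    rw [← e2, e]
  have hy : ∀ j, form (pd j (meanCurvatureCoord X) q) (pd 0 X q) * bform C (wedge (η q) (pd 1 X q))
      = form (pd j (meanCurvatureCoord X) q) (pd 1 X q) * bform C (wedge (η q) (pd 0 X q)) := by
    intro j
    have e := hder j
    have x2 := fun k => fr.expand (hη.null q hq) (pd j (pd k X) q)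
    rw [x2 0, x2 1] at e
    simp only [wedge_add_left, wedge_sub_left, wedge_smul_left, wedge_add_right, wedge_sub_right,
      wedge_smul_right, bform_add_right, bform_sub_right, bform_smul_right, wedge_self, hPQ.1,
      bform_zero_right, wedge_anti (pd 0 X q) (meanCurvatureCoord X q), hC q hq,
      wedge_anti (pd 0 X q) (η q), bform_neg_right] at e
    rw [h.form_pdH_pdX hq, h.form_pdH_pdX hq]
    linarith
  have hE := h.pos q hq
  have hD := h.det_pos q hq
  rw [gramDet] at hD
  -- A non-zero trace-free symmetric form is non-singular, so the system `hy` has only the zero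
  -- solution.
  have hdet : form (pd 0 (meanCurvatureCoord X) q) (pd 0 X q)
      * form (pd 1 (meanCurvatureCoord X) q) (pd 1 X q)
      ≠ form (pd 0 (meanCurvatureCoord X) q) (pd 1 X q) ^ 2 := by
    intro h0
    obtain ⟨z0, z1, z2⟩ := eq_zero_of_trace_eq_zero_of_det_eq_zero hE hD (h.trace_pdH hq) h0
    have z3 := h.form_pdH_comm hq
    rw [z1] at z3
    fin_cases i <;> fin_cases k <;> simp_all
  have h0 := hy 0
  have h1 := hy 1
  rw [h.form_pdH_comm hq] at h1
  have y0 : bform C (wedge (η q) (pd 0 X q)) = 0 := by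
    by_contra hz
    apply hdet
    have : (form (pd 0 (meanCurvatureCoord X) q) (pd 0 X q)
      * form (pd 1 (meanCurvatureCoord X) q) (pd 1 X q)
      - form (pd 0 (meanCurvatureCoord X) q) (pd 1 X q) ^ 2)
        * bform C (wedge (η q) (pd 0 X q)) = 0 := by
      linear_combination form (pd 0 (meanCurvatureCoord X) q) (pd 1 X q) * h0
        - form (pd 0 (meanCurvatureCoord X) q) (pd 0 X q) * h1
    exact sub_eq_zero.1 ((mul_eq_zero.1 this).resolve_right hz)
  have y1 : bform C (wedge (η q) (pd 1 X q)) = 0 := by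
    by_contra hz
    apply hdet
    have : (form (pd 0 (meanCurvatureCoord X) q) (pd 0 X q)
      * form (pd 1 (meanCurvatureCoord X) q) (pd 1 X q)
      - form (pd 0 (meanCurvatureCoord X) q) (pd 1 X q) ^ 2)
        * bform C (wedge (η q) (pd 1 X q)) = 0 := by
      linear_combination form (pd 1 (meanCurvatureCoord X) q) (pd 1 X q) * h0
        - form (pd 0 (meanCurvatureCoord X) q) (pd 1 X q) * h1
    exact sub_eq_zero.1 ((mul_eq_zero.1 this).resolve_right hz)
  exact fr.bivector_eq_zero hPQ.1 hPQ.2 (hC q hq 0) (hC q hq 1) y0 y1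

end IsTrappedPatch

section

variable {V : Type*} [NormedAddCommGroup V] [NormedSpace ℝ V]

lemma is_const_of_pd_eq_zero {Z : Plane → V} {S : Set Plane} (hS : IsOpen S)
    (hc : IsPreconnected S) (hZ : ∀ w ∈ S, DifferentiableAt ℝ Z w) (h : ∀ w ∈ S, ∀ i, pd i Z w = 0)
    {p q : Plane} (hp : p ∈ S) (hq : q ∈ S) : Z p = Z q := by
  refine hS.is_const_of_fderiv_eq_zero hc (fun w hw => (hZ w hw).differentiableWithinAt)
    (fun w hw => ?_) hp hq
  ext v
  rw [fderiv_eq_pd, h w hw, h w hw]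
  simp

lemma eventually_const_of_pd_eq_zero {Z : Plane → V} {q : Plane}
    (h : ∀ᶠ w in 𝓝 q, DifferentiableAt ℝ Z w ∧ ∀ i, pd i Z w = 0) : ∀ᶠ w in 𝓝 q, Z w = Z q := by
  obtain ⟨r, hr, hb⟩ := Metric.eventually_nhds_iff_ball.1 h
  filter_upwards [Metric.ball_mem_nhds q hr] with w hw
  exact is_const_of_pd_eq_zero Metric.isOpen_ball (convex_ball q r).isPreconnected
    (fun w hw => (hb w hw).1) (fun w hw => (hb w hw).2) hw (Metric.mem_ball_self hr)

end

/-! ### The position vector is normal where `H` is parallel and changes its direction -/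

/-- Two trace-free symmetric forms that commute are proportional. -/
lemma exists_factor {E F G D b₀ b₁ b₂ t₀ t₁ t₂ : ℝ} (hE : 0 < E) (hD : D = E * G - F ^ 2)
    (hD0 : D ≠ 0) (hb : G * b₀ - 2 * F * b₁ + E * b₂ = 0) (ht : G * t₀ - 2 * F * t₁ + E * t₂ = 0)
    (hc : G * (b₀ * t₁ - t₀ * b₁) - F * (b₀ * t₂ - t₀ * b₂) + E * (b₁ * t₂ - t₁ * b₂) = 0)
    (hne : b₀ ^ 2 + b₁ ^ 2 ≠ 0) :
    t₀ = (t₀ * b₀ + t₁ * b₁) / (b₀ ^ 2 + b₁ ^ 2) * b₀ ∧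
    t₁ = (t₀ * b₀ + t₁ * b₁) / (b₀ ^ 2 + b₁ ^ 2) * b₁ ∧
    t₂ = (t₀ * b₀ + t₁ * b₁) / (b₀ ^ 2 + b₁ ^ 2) * b₂ := by
  have hm : b₀ * t₁ - t₀ * b₁ = 0 := by
    have : 2 * D * (b₀ * t₁ - t₀ * b₁) = 0 := by
      rw [hD]
      linear_combination E * hc + (F * b₀ - E * b₁) * ht - (F * t₀ - E * t₁) * hb
    exact (mul_eq_zero.1 this).resolve_left (mul_ne_zero two_ne_zero hD0)
  have e0 : t₀ = (t₀ * b₀ + t₁ * b₁) / (b₀ ^ 2 + b₁ ^ 2) * b₀ := by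
    rw [div_mul_eq_mul_div, eq_div_iff hne]; linear_combination -b₁ * hm
  have e1 : t₁ = (t₀ * b₀ + t₁ * b₁) / (b₀ ^ 2 + b₁ ^ 2) * b₁ := by
    rw [div_mul_eq_mul_div, eq_div_iff hne]; linear_combination b₀ * hm
  refine ⟨e0, e1, ?_⟩
  generalize (t₀ * b₀ + t₁ * b₁) / (b₀ ^ 2 + b₁ ^ 2) = l at e0 e1
  apply mul_left_cancel₀ hE.ne'
  linear_combination ht - G * e0 + 2 * F * e1 - l * hb

/-- The translate of `X` by `y` is a normal field whose product with `H` is `-1`. -/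
def IsNormalTranslate (X : Plane → E41) (y : E41) (q : Plane) : Prop :=
  (∀ l, form (pd l X q) (X q + y) = 0) ∧ form (meanCurvatureCoord X q) (X q + y) = -1

namespace IsTrappedPatch

variable {X η : Plane → E41} {μ : Plane → ℝ} {N : Plane → Bivector} {V V' : Set Plane} {q : Plane}

lemma trace_pd_conjugateNormal (h : IsTrappedPatch X μ N V) (hη : IsConjugateNormal X η V)
    (hq : q ∈ V) :
    form (pd 1 X q) (pd 1 X q) * form (pd 0 η q) (pd 0 X q)
      - 2 * form (pd 0 X q) (pd 1 X q) * form (pd 0 η q) (pd 1 X q)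
      + form (pd 0 X q) (pd 0 X q) * form (pd 1 η q) (pd 1 X q) = 2 * gramDet X q := by
  have := trace_second_normal (h.smooth q hq) (h.det_ne hq) (hη.normal q hq)
  rw [hη.H_η q hq] at this
  simp only [h.form_pdn_pdX hη.smooth hη.normal hq]
  linarith

/-- The form ⟨∂η, ∂X⟩ minus the metric is symmetric, trace-free and commutes with the non-zero form
⟨∂H, ∂X⟩, hence is a multiple of it. The normal components of dη and dH vanish because H is
parallel. -/
lemma pd_conjugateNormal (h : IsTrappedPatch X μ N V) (hη : IsConjugateNormal X η V)
    (hp : ∀ w ∈ V, ∀ k, form (pd k (meanCurvatureCoord X) w) (η w) = 0)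
    (hc : ∀ w ∈ V, shapeCommutator X w (meanCurvatureCoord X w) (η w) = 0)
    (hb : ∀ w ∈ V, form (pd 0 (meanCurvatureCoord X) w) (pd 0 X w) ^ 2
      + form (pd 0 (meanCurvatureCoord X) w) (pd 1 X w) ^ 2 ≠ 0) :
    ∃ l : Plane → ℝ, (∀ w ∈ V, ContDiffAt ℝ ∞ l w) ∧
      ∀ w ∈ V, ∀ i, pd i η w = pd i X w + l w • pd i (meanCurvatureCoord X) w := by
  set H := meanCurvatureCoord X with hH
  set t : Fin 2 → Fin 2 → Plane → ℝ :=
    fun i j w => form (pd i η w) (pd j X w) - form (pd i X w) (pd j X w) with ht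
  have hXs := fun w hw i => contDiffAt_pd i (h.smooth w hw)
  have hHs := fun w hw i => contDiffAt_pd i (h.smooth_H (q := w) hw)
  have hts : ∀ w ∈ V, ∀ i j, ContDiffAt ℝ ∞ (t i j) w := fun w hw i j =>
    (contDiffAt_form (contDiffAt_pd i (hη.smooth w hw)) (hXs w hw j)).sub
      (contDiffAt_form (hXs w hw i) (hXs w hw j))
  refine ⟨fun w => (t 0 0 w * form (pd 0 H w) (pd 0 X w) + t 0 1 w * form (pd 0 H w) (pd 1 X w))
    / (form (pd 0 H w) (pd 0 X w) ^ 2 + form (pd 0 H w) (pd 1 X w) ^ 2), fun w hw => ?_,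
    fun w hw => ?_⟩
  · have b := fun k => contDiffAt_form (hHs w hw 0) (hXs w hw k)
    exact (((hts w hw 0 0).mul (b 0)).add ((hts w hw 0 1).mul (b 1))).div
      (((b 0).pow 2).add ((b 1).pow 2)) (hb w hw)
  have fr := h.isFrame hw (hη.normal w hw) (hη.H_η w hw)
  have hηc : form (pd 1 η w) (pd 0 X w) = form (pd 0 η w) (pd 1 X w) := by
    rw [h.form_pdn_pdX hη.smooth hη.normal hw, h.form_pdn_pdX hη.smooth hη.normal hw,
      pd_comm 1 0 (h.smooth w hw)]
  have hfac := exists_factor (t₀ := t 0 0 w) (t₁ := t 0 1 w) (t₂ := t 1 1 w)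
    (h.pos w hw) rfl (h.det_ne hw) (h.trace_pdH hw)
    (by
      simp only [ht]
      have := h.trace_pd_conjugateNormal hη hw
      rw [gramDet] at this
      linear_combination this)
    (by
      simp only [ht]
      have := hc w hw
      rw [shapeCommutator] at this
      simp only [h.form_pdH_pdX hw, h.form_pdn_pdX hη.smooth hη.normal hw]
      linear_combination this) (hb w hw)
  obtain ⟨e0, e1, e2⟩ := hfac
  beta_reduce
  generalize (t 0 0 w * form (pd 0 H w) (pd 0 X w) + t 0 1 w * form (pd 0 H w) (pd 1 X w))
    / (form (pd 0 H w) (pd 0 X w) ^ 2 + form (pd 0 H w) (pd 1 X w) ^ 2) = l at *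
  have hcomm := h.form_pdH_comm hw
  have hηη : ∀ k, form (pd k η w) (η w) = 0 := fun k => by
    have d := (hη.smooth w hw).diff
    have e := pd_form k d d
    rw [pd_congr k h.isOpen hη.null hw, pd_const, form_comm (η w)] at e
    linarith
  have hηH : ∀ k, form (H w) (pd k η w) = 0 := fun k => by
    have e := pd_form k (h.smooth_H hw).diff (hη.smooth w hw).diff
    rw [pd_congr k h.isOpen hη.H_η hw, pd_const, hp w hw] at e
    linarith
  simp only [ht] at e0 e1 e2
  have hsy := form_comm (pd 0 X w) (pd 1 X w)
  intro i
  rw [← sub_eq_zero]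
  apply fr.eq_zero
  all_goals simp only [form_sub_right, form_add_right, form_smul_right]
  · rw [form_comm _ (pd i η w), form_comm _ (pd i X w), form_comm _ (pd i H w)]
    fin_cases i
    · simp only [Fin.zero_eta]; linarith
    · simp only [Fin.mk_one]; rw [hηc, hcomm]; linarith
  · rw [form_comm _ (pd i η w), form_comm _ (pd i X w), form_comm _ (pd i H w)]
    fin_cases i
    · simp only [Fin.zero_eta]; linarith
    · simp only [Fin.mk_one]; linarith
  · rw [hηH, form_comm _ (pd i X w), h.form_pd_H hw, form_comm _ (pd i H w), h.form_pdH_H hw]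
    ring
  · rw [form_comm _ (pd i η w), hηη, form_comm _ (pd i X w), hη.normal w hw,
      form_comm _ (pd i H w), hp w hw]
    ring

/-- Equality of mixed derivatives in dη = dX + l dH gives l₀H₁ = l₁H₀. Where the tangential form of
dH is non-zero it has rank two, so dl = 0 and η - X - lH is a constant y; then X + y = η - lH. -/
lemma exists_isNormalTranslate (h : IsTrappedPatch X μ N V) (hη : IsConjugateNormal X η V)
    (hp : ∀ w ∈ V, ∀ k, form (pd k (meanCurvatureCoord X) w) (η w) = 0)
    (hc : ∀ w ∈ V, shapeCommutator X w (meanCurvatureCoord X w) (η w) = 0) (hq : q ∈ V)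
    {i k : Fin 2} (hne : form (pd i (meanCurvatureCoord X) q) (pd k X q) ≠ 0) :
    ∃ y, ∀ᶠ w in 𝓝 q, IsNormalTranslate X y w := by
  set H := meanCurvatureCoord X
  set S : Plane → ℝ := fun w => form (pd 0 H w) (pd 0 X w) ^ 2 + form (pd 0 H w) (pd 1 X w) ^ 2
    with hS
  have hdet : ∀ w ∈ V, S w ≠ 0 → form (pd 0 H w) (pd 0 X w) * form (pd 1 H w) (pd 1 X w)
      ≠ form (pd 0 H w) (pd 1 X w) ^ 2 := by
    intro w hw hSw h0
    obtain ⟨z0, z1, z2⟩ := eq_zero_of_trace_eq_zero_of_det_eq_zero (h.pos w hw) (h.det_pos w hw)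
      (h.trace_pdH hw) h0
    apply hSw
    simp only [hS]
    rw [z0, z1]
    ring
  have hSq : S q ≠ 0 := by
    intro h0
    have z0 : form (pd 0 H q) (pd 0 X q) = 0 := by
      simp only [hS] at h0
      nlinarith [sq_nonneg (form (pd 0 H q) (pd 0 X q)), sq_nonneg (form (pd 0 H q) (pd 1 X q))]
    have z1 : form (pd 0 H q) (pd 1 X q) = 0 := by
      simp only [hS] at h0
      nlinarith [sq_nonneg (form (pd 0 H q) (pd 0 X q)), sq_nonneg (form (pd 0 H q) (pd 1 X q))]
    have z2 := h.trace_pdH hq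
    rw [z0, z1] at z2
    have z3 : form (pd 1 H q) (pd 1 X q) = 0 := by
      have : form (pd 0 X q) (pd 0 X q) * form (pd 1 H q) (pd 1 X q) = 0 := by linarith
      exact (mul_eq_zero.1 this).resolve_left (h.pos q hq).ne'
    have z4 : form (pd 1 H q) (pd 0 X q) = 0 := (h.form_pdH_comm hq).trans z1
    fin_cases i <;> fin_cases k <;> simp_all
  have hXs := fun w hw i => contDiffAt_pd i (h.smooth w hw)
  have hHs := fun w hw i => contDiffAt_pd i (h.smooth_H (q := w) hw)
  have hSc : ContinuousOn S V := fun w hw => by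
    have b := fun k => contDiffAt_form (hHs w hw 0) (hXs w hw k)
    exact (((b 0).pow 2).add ((b 1).pow 2)).continuousAt.continuousWithinAt
  -- If the first row of a trace-free symmetric form vanishes, so does the form. Thus S ≠ 0 is the
  -- open condition that ⟨∂H, ∂X⟩ is non-zero.
  set V' := V ∩ S ⁻¹' {0}ᶜ with hV'
  have hV'o : IsOpen V' := hSc.isOpen_inter_preimage h.isOpen isOpen_compl_singleton
  have h' := h.mono hV'o Set.inter_subset_left
  have hη' : IsConjugateNormal X η V' := ⟨fun w hw => hη.smooth w hw.1,
    fun w hw => hη.normal w hw.1, fun w hw => hη.null w hw.1, fun w hw => hη.H_η w hw.1⟩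
  obtain ⟨l, hl, hel⟩ := h'.pd_conjugateNormal hη' (fun w hw => hp w hw.1)
    (fun w hw => hc w hw.1) (fun w hw => hw.2)
  have hdl : ∀ w ∈ V', ∀ i, pd i l w = 0 := by
    intro w hw
    have e1 : ∀ i j, pd j (pd i η) w = pd j (pd i X) w + (l w • pd j (pd i H) w
        + pd j l w • pd i H w) := by
      intro i j
      rw [pd_congr j hV'o (fun w hw => hel w hw i) hw, pd_add _ (hXs w hw.1 i).diff
        ((hl w hw).diff.fun_smul (hHs w hw.1 i).diff), pd_smul _ (hl w hw).diff (hHs w hw.1 i).diff]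
    have e2 : pd 0 l w • pd 1 H w = pd 1 l w • pd 0 H w := by
      have a := e1 0 1
      rw [pd_comm 1 0 (hη.smooth w hw.1), e1, pd_comm 1 0 (h.smooth w hw.1),
        pd_comm 1 0 (h.smooth_H hw.1)] at a
      exact add_left_cancel (add_left_cancel a)
    have e3 := fun k => congrArg (fun v => form v (pd k X w)) e2
    simp only [form_smul_left] at e3
    have f0 := e3 0
    have f1 := e3 1
    rw [h.form_pdH_comm hw.1] at f0
    have hd := sub_ne_zero.2 (hdet w hw.1 hw.2)
    intro i
    fin_cases i
    · simp only [Fin.zero_eta]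
      refine (mul_eq_zero.1 (?_ : _ * pd 0 l w = 0)).resolve_left hd
      linear_combination form (pd 0 H w) (pd 0 X w) * f1 - form (pd 0 H w) (pd 1 X w) * f0
    · simp only [Fin.mk_one]
      refine (mul_eq_zero.1 (?_ : _ * pd 1 l w = 0)).resolve_left hd
      linear_combination form (pd 0 H w) (pd 1 X w) * f1 - form (pd 1 H w) (pd 1 X w) * f0
  have hZ := eventually_const_of_pd_eq_zero (Z := fun w => η w - X w - l w • H w) (q := q) (by
    filter_upwards [hV'o.mem_nhds ⟨hq, hSq⟩] with w hw
    have s1 := hη.smooth w hw.1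
    have s2 := h.smooth w hw.1
    have s3 := h.smooth_H hw.1
    refine ⟨((s1.sub s2).sub ((hl w hw).smul s3)).diff, fun i => ?_⟩
    rw [pd_sub _ (s1.sub s2).diff ((hl w hw).diff.fun_smul s3.diff), pd_sub _ s1.diff s2.diff,
      pd_smul _ (hl w hw).diff s3.diff, hdl w hw, hel w hw]
    simp)
  refine ⟨η q - X q - l q • H q, ?_⟩
  filter_upwards [hZ, h.isOpen.mem_nhds hq] with w hw hwV
  have e : X w + (η q - X q - l q • H q) = η w - l w • H w := by
    rw [← hw]; abel
  refine ⟨fun k => ?_, ?_⟩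
  · rw [e, form_sub_right, form_smul_right, hη.normal w hwV, h.form_pd_H hwV]; ring
  · rw [e, form_sub_right, form_smul_right, hη.H_η w hwV, h.H_null w hwV]; ring

end IsTrappedPatch

/-! ### Light-cone coordinates -/

/-- The light-cone coordinate `v₀ + δ v₃`, `δ = ± 1`. -/
noncomputable def lightP (δ : ℝ) : E41 →L[ℝ] ℂ :=
  Complex.ofRealCLM.comp (ContinuousLinearMap.proj (R := ℝ) (φ := fun _ : Fin 4 => ℝ) 0
    + δ • ContinuousLinearMap.proj (R := ℝ) (φ := fun _ : Fin 4 => ℝ) 3)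

/-- The complex coordinate `v₁ + i v₂`. -/
noncomputable def lightC : E41 →L[ℝ] ℂ :=
  Complex.ofRealCLM.comp (ContinuousLinearMap.proj (R := ℝ) (φ := fun _ : Fin 4 => ℝ) 1)
    + Complex.I • Complex.ofRealCLM.comp
      (ContinuousLinearMap.proj (R := ℝ) (φ := fun _ : Fin 4 => ℝ) 2)

lemma lightP_apply (δ : ℝ) (v : E41) : lightP δ v = (v 0 : ℂ) + δ * v 3 := by
  simp [lightP]

lemma lightC_apply (v : E41) : lightC v = (v 1 : ℂ) + Complex.I * v 2 := by
  simp [lightC]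

/-- The conjugate coordinate `v₁ - i v₂`. -/
noncomputable def lightD : E41 →L[ℝ] ℂ := (Complex.conjCLE : ℂ →L[ℝ] ℂ).comp lightC

lemma lightD_eq (v : E41) : lightD v = starRingEnd ℂ (lightC v) := rfl

lemma lightD_apply (v : E41) : lightD v = (v 1 : ℂ) - Complex.I * v 2 := by
  rw [lightD_eq, lightC_apply]; simp [sub_eq_add_neg]

lemma conj_lightP (δ : ℝ) (v : E41) : starRingEnd ℂ (lightP δ v) = lightP δ v := by
  rw [lightP_apply]; simp

/-- With P = v₀ + δv₃, M = v₀ - δv₃ and C = v₁ + iv₂ the square of v is |C|² - PM, so null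
directions with P ≠ 0 are parametrized stereographically by w = C/P. Both signs of δ are needed
because either light-cone coordinate may vanish. -/
lemma two_mul_form {δ : ℝ} (hδ : δ ^ 2 = 1) (a b : E41) :
    2 * (form a b : ℂ) = -(lightP δ a * lightP (-δ) b + lightP (-δ) a * lightP δ b)
      + (lightC a * lightD b + lightD a * lightC b) := by
  have hd : (δ : ℂ) ^ 2 = 1 := by exact_mod_cast hδ
  have hI := Complex.I_sq
  simp only [lightP_apply, lightC_apply, lightD_apply, form]
  push_cast
  linear_combination (-2 * (a 3 : ℂ) * b 3) * hd + (2 * (a 2 : ℂ) * b 2) * hI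

lemma ext_light {δ : ℝ} (hδ : δ ^ 2 = 1) {a b : E41} (hP : lightP δ a = lightP δ b)
    (hM : lightP (-δ) a = lightP (-δ) b) (hC : lightC a = lightC b) : a = b := by
  simp only [lightP_apply, lightC_apply] at hP hM hC
  have r := congrArg Complex.re hC
  have i := congrArg Complex.im hC
  simp at r i
  norm_cast at hP hM
  have h0 : a 0 = b 0 := by linarith
  have h3 : a 3 = b 3 := by
    have : δ * a 3 = δ * b 3 := by linarith
    have hδ0 : δ ≠ 0 := by rintro rfl; norm_num at hδ
    exact mul_left_cancel₀ hδ0 this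
  funext k; fin_cases k <;> assumption

lemma exists_lightP_ne_zero {v : E41} (hv : form v v = 0) (h : v ≠ 0) :
    ∃ δ : ℝ, δ ^ 2 = 1 ∧ lightP δ v ≠ 0 := by
  by_contra! hc
  have h1 := hc 1 (by norm_num)
  have h2 := hc (-1) (by norm_num)
  have h1 := congrArg Complex.re h1
  have h2 := congrArg Complex.re h2
  simp [lightP_apply] at h1 h2
  exact apply_zero_ne_of_null hv h (by linarith)

/-- A null vector `H` with `P(H) ≠ 0` satisfies `M(H) = w w̄ P(H)` for `w = C(H)/P(H)`; the
vectors orthogonal to it satisfy a linear equation. -/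
lemma light_orthogonal {δ : ℝ} (hδ : δ ^ 2 = 1) {H : E41} (hH : form H H = 0)
    (hP : lightP δ H ≠ 0) {w : ℂ} (hw : lightC H = w * lightP δ H) {v : E41} (hv : form v H = 0) :
    lightP (-δ) v = lightC v * starRingEnd ℂ w + lightD v * w
      - lightP δ v * (w * starRingEnd ℂ w) := by
  have hD : lightD H = starRingEnd ℂ w * lightP δ H := by
    rw [lightD_eq, hw, map_mul, conj_lightP]
  have e1 := two_mul_form hδ H H
  have e2 := two_mul_form hδ v H
  rw [hH, hw, hD] at e1
  rw [hv, hw, hD] at e2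
  have e3 : lightP (-δ) H = w * starRingEnd ℂ w * lightP δ H := by
    apply mul_left_cancel₀ hP
    push_cast at e1
    linear_combination e1 / 2
  rw [e3] at e2
  apply mul_left_cancel₀ hP
  push_cast at e2
  linear_combination e2

lemma light_null {δ : ℝ} (hδ : δ ^ 2 = 1) {H : E41} (hH : form H H = 0)
    (hP : lightP δ H ≠ 0) {w : ℂ} (hw : lightC H = w * lightP δ H) :
    lightP (-δ) H = w * lightD H := by
  have hD : lightD H = starRingEnd ℂ w * lightP δ H := by
    rw [lightD_eq, hw, map_mul, conj_lightP]
  rw [light_orthogonal hδ hH hP hw hH, hD, hw]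
  ring

/-- Near each of its points a marginally trapped patch carries an elliptic structure `m` and a
complex function `w`, the direction of `H`, with the following property. -/
structure IsLightPatch (X : Plane → E41) (δ : ℝ) (m w : Plane → ℂ) (V : Set Plane) : Prop where
  isOpen : IsOpen V
  sq : δ ^ 2 = 1
  smooth_m : ∀ q ∈ V, ContDiffAt ℝ ∞ m q
  im_ne : ∀ q ∈ V, (m q).im ≠ 0
  smooth_w : ∀ q ∈ V, ContDiffAt ℝ ∞ w q
  H_ne : ∀ q ∈ V, lightP δ (meanCurvatureCoord X q) ≠ 0
  H_eq : ∀ q ∈ V, lightC (meanCurvatureCoord X q) = w q * lightP δ (meanCurvatureCoord X q)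
  key : ∀ q ∈ V, ∀ a b : E41, form a (meanCurvatureCoord X q) = 0 →
    form b (meanCurvatureCoord X q) = 0 → form a (pd 0 X q) = form b (pd 1 X q) →
    form (pd 1 X q) (pd 1 X q) * form b (pd 0 X q)
      - 2 * form (pd 0 X q) (pd 1 X q) * form b (pd 1 X q)
      + form (pd 0 X q) (pd 0 X q) * form a (pd 1 X q) = 0 →
    lightC a - m q * lightC b = w q * (lightP δ a - m q * lightP δ b) ∧
      lightP (-δ) a - m q * lightP (-δ) b = w q * (lightD a - m q * lightD b)

/-- Here w' stands for the conjugate of w. The hypotheses say that the complex vector Z is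
orthogonal to the null direction w and isotropic; it then belongs to one of two families. -/
lemma light_factor {w w' Zp Zm Zc Zd : ℂ} (h1 : Zm = Zc * w' + Zd * w - Zp * (w * w'))
    (h2 : Zp * Zm = Zc * Zd) : (Zc - w * Zp) * (Zd - w' * Zp) = 0 := by
  rw [h1] at h2; linear_combination -h2

/-- With Z in the first family only, the vectors u orthogonal to H and Z form a plane cut out by
equations that involve w but not its conjugate. This is what produces Beltrami equations. -/
lemma light_solve {w w' Zp Zm Zc Zd up um uc ud : ℂ}
    (h1 : Zm = Zc * w' + Zd * w - Zp * (w * w')) (hZ : Zc - w * Zp = 0)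
    (hne : Zd - w' * Zp ≠ 0) (hu : um = uc * w' + ud * w - up * (w * w'))
    (huZ : up * Zm + um * Zp = uc * Zd + ud * Zc) :
    uc = w * up ∧ um = w * ud := by
  have hZc : Zc = w * Zp := by linear_combination hZ
  have e : (Zd - w' * Zp) * (uc - w * up) = 0 := by
    rw [h1, hu, hZc] at huZ; linear_combination -huZ
  have e2 : uc = w * up := sub_eq_zero.1 ((mul_eq_zero.1 e).resolve_left hne)
  refine ⟨e2, ?_⟩
  rw [hu, e2]; ring

/-- The quantity `C(Z) - w P(Z)` for `Z = X₁ - m X₀`. -/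
noncomputable def lightDefect (X : Plane → E41) (δ : ℝ) (m w : ℂ) (q : Plane) : ℂ :=
  (lightC (pd 1 X q) - m * lightC (pd 0 X q)) - w * (lightP δ (pd 1 X q) - m * lightP δ (pd 0 X q))

namespace IsTrappedPatch

variable {X η : Plane → E41} {μ : Plane → ℝ} {N : Plane → Bivector} {V V' : Set Plane} {q : Plane}

lemma light_eqs (h : IsTrappedPatch X μ N V) (hq : q ∈ V) {δ : ℝ} (hδ : δ ^ 2 = 1)
    (hP : lightP δ (meanCurvatureCoord X q) ≠ 0) {w : ℂ}
    (hw : lightC (meanCurvatureCoord X q) = w * lightP δ (meanCurvatureCoord X q)) {m : ℂ} {a b : E41}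
    (ha : form a (meanCurvatureCoord X q) = 0) (hb : form b (meanCurvatureCoord X q) = 0) :
    lightP (-δ) a - m * lightP (-δ) b = (lightC a - m * lightC b) * starRingEnd ℂ w
      + (lightD a - m * lightD b) * w
      - (lightP δ a - m * lightP δ b) * (w * starRingEnd ℂ w) := by
  rw [light_orthogonal hδ (h.H_null q hq) hP hw ha, light_orthogonal hδ (h.H_null q hq) hP hw hb]
  ring

/-- The equation for m says that X₁ - m X₀ is isotropic, and both fields are orthogonal to H, so
`light_factor` applies. -/
lemma lightDefect_mul (h : IsTrappedPatch X μ N V) (hq : q ∈ V) {δ : ℝ} (hδ : δ ^ 2 = 1)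
    (hP : lightP δ (meanCurvatureCoord X q) ≠ 0) {w : ℂ}
    (hw : lightC (meanCurvatureCoord X q) = w * lightP δ (meanCurvatureCoord X q)) {m : ℂ}
    (hm : (form (pd 1 X q) (pd 1 X q) : ℂ) - 2 * m * form (pd 0 X q) (pd 1 X q)
      + m ^ 2 * form (pd 0 X q) (pd 0 X q) = 0) :
    lightDefect X δ m w q
      * starRingEnd ℂ (lightDefect X δ (starRingEnd ℂ m) w q) = 0 := by
  have e := light_factor (h.light_eqs hq hδ hP hw (m := m) (h.form_pd_H hq 1) (h.form_pd_H hq 0)) (by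
    have e00 := two_mul_form hδ (pd 0 X q) (pd 0 X q)
    have e01 := two_mul_form hδ (pd 0 X q) (pd 1 X q)
    have e11 := two_mul_form hδ (pd 1 X q) (pd 1 X q)
    linear_combination -hm + e11 / 2 - m * e01 + m ^ 2 / 2 * e00)
  rw [← e]
  simp only [lightDefect, map_sub, map_mul, Complex.conj_conj, conj_lightP, ← lightD_eq]

/-- Two vanishing defects would give C(X₀) = w P(X₀), and X₀, being orthogonal to H, would be null.
-/
lemma lightDefect_ne (h : IsTrappedPatch X μ N V) (hq : q ∈ V) {δ : ℝ} (hδ : δ ^ 2 = 1)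
    (hP : lightP δ (meanCurvatureCoord X q) ≠ 0) {w : ℂ}
    (hw : lightC (meanCurvatureCoord X q) = w * lightP δ (meanCurvatureCoord X q)) {m m' : ℂ}
    (hmm : m ≠ m') (h1 : lightDefect X δ m w q = 0) : lightDefect X δ m' w q ≠ 0 := by
  intro h2
  rw [lightDefect] at h1 h2
  have e : lightC (pd 0 X q) = w * lightP δ (pd 0 X q) := by
    apply mul_left_cancel₀ (sub_ne_zero.2 hmm)
    linear_combination h2 - h1
  have e' : lightD (pd 0 X q) = starRingEnd ℂ w * lightP δ (pd 0 X q) := by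
    rw [lightD_eq, e, map_mul, conj_lightP]
  have e1 := two_mul_form hδ (pd 0 X q) (pd 0 X q)
  rw [light_orthogonal hδ (h.H_null q hq) hP hw (h.form_pd_H hq 0), e', e] at e1
  have e2 : (form (pd 0 X q) (pd 0 X q) : ℂ) = 0 := by linear_combination e1 / 2
  exact (h.pos q hq).ne' (by exact_mod_cast e2)

/-- The complex coefficient `(F + i ε √D) / E` of the conformal structure of the metric. -/
noncomputable def _root_.MinkSurf.conformalCoeff (X : Plane → E41) (ε : ℝ) (q : Plane) : ℂ :=
  ((form (pd 0 X q) (pd 0 X q))⁻¹ : ℝ) * ((form (pd 0 X q) (pd 1 X q) : ℝ)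
    + ((ε * Real.sqrt (gramDet X q) : ℝ) : ℂ) * Complex.I)

lemma conj_conformalCoeff (ε : ℝ) :
    starRingEnd ℂ (conformalCoeff X ε q) = conformalCoeff X (-ε) q := by
  simp [conformalCoeff]

lemma conformalCoeff_sq (h : IsTrappedPatch X μ N V) (hq : q ∈ V) {ε : ℝ} (hε : ε ^ 2 = 1) :
    (form (pd 1 X q) (pd 1 X q) : ℂ) - 2 * conformalCoeff X ε q * form (pd 0 X q) (pd 1 X q)
      + conformalCoeff X ε q ^ 2 * form (pd 0 X q) (pd 0 X q) = 0 := by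
  have hE : (form (pd 0 X q) (pd 0 X q) : ℂ) ≠ 0 := by exact_mod_cast (h.pos q hq).ne'
  have hs : ((Real.sqrt (gramDet X q) : ℝ) : ℂ) ^ 2 = form (pd 0 X q) (pd 0 X q)
      * form (pd 1 X q) (pd 1 X q) - (form (pd 0 X q) (pd 1 X q) : ℂ) ^ 2 := by
    exact_mod_cast Real.sq_sqrt (h.det_pos q hq).le
  have hε' : (ε : ℂ) ^ 2 = 1 := by exact_mod_cast hε
  rw [conformalCoeff]
  push_cast
  have hI := Complex.I_sq
  field_simp
  linear_combination (ε : ℂ) ^ 2 * ((Real.sqrt (gramDet X q) : ℝ) : ℂ) ^ 2 * hI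
    - ((Real.sqrt (gramDet X q) : ℝ) : ℂ) ^ 2 * hε' - hs

lemma conformalCoeff_norm (h : IsTrappedPatch X μ N V) (hq : q ∈ V) {ε : ℝ} (hε : ε ^ 2 = 1) :
    conformalCoeff X ε q * conformalCoeff X (-ε) q * form (pd 0 X q) (pd 0 X q)
      = form (pd 1 X q) (pd 1 X q) := by
  have hE : (form (pd 0 X q) (pd 0 X q) : ℂ) ≠ 0 := by exact_mod_cast (h.pos q hq).ne'
  have hs : ((Real.sqrt (gramDet X q) : ℝ) : ℂ) ^ 2 = form (pd 0 X q) (pd 0 X q)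
      * form (pd 1 X q) (pd 1 X q) - (form (pd 0 X q) (pd 1 X q) : ℂ) ^ 2 := by
    exact_mod_cast Real.sq_sqrt (h.det_pos q hq).le
  have hε' : (ε : ℂ) ^ 2 = 1 := by exact_mod_cast hε
  rw [conformalCoeff, conformalCoeff]
  push_cast
  have hI := Complex.I_sq
  field_simp
  linear_combination -(ε : ℂ) ^ 2 * ((Real.sqrt (gramDet X q) : ℝ) : ℂ) ^ 2 * hI
    + ((Real.sqrt (gramDet X q) : ℝ) : ℂ) ^ 2 * hε' + hs

lemma conformalCoeff_add (h : IsTrappedPatch X μ N V) (hq : q ∈ V) (ε : ℝ) :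
    (conformalCoeff X ε q + conformalCoeff X (-ε) q) * form (pd 0 X q) (pd 0 X q)
      = 2 * form (pd 0 X q) (pd 1 X q) := by
  have hE : (form (pd 0 X q) (pd 0 X q) : ℂ) ≠ 0 := by exact_mod_cast (h.pos q hq).ne'
  rw [conformalCoeff, conformalCoeff]
  push_cast
  field_simp
  ring

lemma conformalCoeff_im (h : IsTrappedPatch X μ N V) (hq : q ∈ V) {ε : ℝ} (hε : ε ^ 2 = 1) :
    (conformalCoeff X ε q).im ≠ 0 := by
  have : (conformalCoeff X ε q).im
      = (form (pd 0 X q) (pd 0 X q))⁻¹ * (ε * Real.sqrt (gramDet X q)) := by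
    rw [conformalCoeff, Complex.im_ofReal_mul]
    simp
  rw [this]
  have hε0 : ε ≠ 0 := by rintro rfl; norm_num at hε
  exact mul_ne_zero (inv_ne_zero (h.pos q hq).ne')
    (mul_ne_zero hε0 (Real.sqrt_pos.2 (h.det_pos q hq)).ne')

lemma contDiffAt_conformalCoeff (h : IsTrappedPatch X μ N V) (hq : q ∈ V) (ε : ℝ) :
    ContDiffAt ℝ ∞ (conformalCoeff X ε) q := by
  have hX := h.smooth q hq
  have g := fun i j => contDiffAt_metric hX i j
  have o : ∀ {a : Plane → ℝ}, ContDiffAt ℝ ∞ a q → ContDiffAt ℝ ∞ (fun w => (a w : ℂ)) q :=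
    fun ha => Complex.ofRealCLM.contDiff.contDiffAt.comp q ha
  exact (o ((g 0 0).inv (h.pos q hq).ne')).mul ((o (g 0 1)).add
    ((o (contDiffAt_const.mul ((contDiffAt_gramDet hX).sqrt (h.det_ne hq)))).mul contDiffAt_const))

/-- Of the two conjugate roots of the isotropy equation, m is one with non-zero defect at q, hence
near q; then the defect of m̄ vanishes. The hypotheses of `key` say that a - m b is orthogonal to H
and to X₁ - m̄ X₀. -/
lemma exists_isLightPatch (h : IsTrappedPatch X μ N V) (hq : q ∈ V) :
    ∃ δ m w V', IsLightPatch X δ m w V' ∧ q ∈ V' ∧ V' ⊆ V := by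
  set H := meanCurvatureCoord X with hH
  obtain ⟨δ, hδ, hne⟩ := exists_lightP_ne_zero (h.H_null q hq) (h.H_ne q hq)
  have hPs : ∀ p ∈ V, ContDiffAt ℝ ∞ (fun p => lightP δ (H p)) p := fun p hp =>
    (lightP δ).contDiff.contDiffAt.comp p (h.smooth_H hp)
  have hCs : ∀ p ∈ V, ContDiffAt ℝ ∞ (fun p => lightC (H p)) p := fun p hp =>
    lightC.contDiff.contDiffAt.comp p (h.smooth_H hp)
  set w : Plane → ℂ := fun p => lightC (H p) * (lightP δ (H p))⁻¹ with hw
  have hws : ∀ p ∈ V, lightP δ (H p) ≠ 0 → ContDiffAt ℝ ∞ w p := fun p hp h0 =>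
    (hCs p hp).mul ((hPs p hp).inv h0)
  have hwe : ∀ p, lightP δ (H p) ≠ 0 → lightC (H p) = w p * lightP δ (H p) := fun p h0 => by
    simp only [hw]; field_simp
  have hdef : ∀ ε : ℝ, ContinuousAt (fun p => lightDefect X δ (conformalCoeff X ε p) (w p) p) q := by
    intro ε
    have x := fun k => contDiffAt_pd k (h.smooth q hq)
    have cc := fun k => lightC.contDiff.contDiffAt.comp q (x k)
    have pp := fun k => (lightP δ).contDiff.contDiffAt.comp q (x k)
    have m := h.contDiffAt_conformalCoeff hq ε
    exact (((cc 1).sub (m.mul (cc 0))).sub ((hws q hq hne).mul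
      ((pp 1).sub (m.mul (pp 0))))).continuousAt
  obtain ⟨ε, hε, hεq⟩ : ∃ ε : ℝ, ε ^ 2 = 1 ∧
      lightDefect X δ (conformalCoeff X ε q) (w q) q ≠ 0 := by
    by_cases h1 : lightDefect X δ (conformalCoeff X 1 q) (w q) q = 0
    · refine ⟨-1, by norm_num, h.lightDefect_ne hq hδ hne (hwe q hne) ?_ h1⟩
      intro he
      have := h.conformalCoeff_im hq (ε := 1) (by norm_num)
      rw [← conj_conformalCoeff] at he
      exact this (Complex.conj_eq_iff_im.1 he.symm)
    · exact ⟨1, by norm_num, h1⟩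
  have hev : ∀ᶠ p in 𝓝 q, p ∈ V ∧ lightP δ (H p) ≠ 0 ∧
      lightDefect X δ (conformalCoeff X ε p) (w p) p ≠ 0 :=
    (h.isOpen.eventually_mem hq).and (((hPs q hq).continuousAt.eventually_ne hne).and
      ((hdef ε).eventually_ne hεq))
  obtain ⟨V', hV', hVo, hqV⟩ := eventually_nhds_iff.1 hev
  refine ⟨δ, conformalCoeff X ε, w, V', ⟨hVo, hδ,
    fun p hp => h.contDiffAt_conformalCoeff (hV' p hp).1 ε,
    fun p hp => h.conformalCoeff_im (hV' p hp).1 hε,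
    fun p hp => hws p (hV' p hp).1 (hV' p hp).2.1, fun p hp => (hV' p hp).2.1,
    fun p hp => hwe p (hV' p hp).2.1, ?_⟩, hqV, fun p hp => (hV' p hp).1⟩
  intro p hp a b ha hb hsym htr
  obtain ⟨hpV, hpP, hpd⟩ := hV' p hp
  have hε' : (-ε) ^ 2 = 1 := by rw [neg_sq, hε]
  have hmul := h.lightDefect_mul hpV hδ hpP (hwe p hpP) (h.conformalCoeff_sq hpV hε')
  rw [conj_conformalCoeff, neg_neg] at hmul
  have hcd : starRingEnd ℂ (lightDefect X δ (conformalCoeff X ε p) (w p) p) ≠ 0 := by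
    rwa [Ne, map_eq_zero]
  have hz := (mul_eq_zero.1 hmul).resolve_right hcd
  simp only [lightDefect, map_sub, map_mul, conj_lightP, ← lightD_eq, conj_conformalCoeff] at hcd
  refine light_solve
    (h.light_eqs hpV hδ hpP (hwe p hpP) (m := conformalCoeff X (-ε) p) (h.form_pd_H hpV 1)
      (h.form_pd_H hpV 0)) hz hcd
    (h.light_eqs hpV hδ hpP (hwe p hpP) (m := conformalCoeff X ε p) ha hb) ?_
  have e00 := two_mul_form hδ b (pd 0 X p)
  have e01 := two_mul_form hδ b (pd 1 X p)
  have e10 := two_mul_form hδ a (pd 0 X p)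
  have e11 := two_mul_form hδ a (pd 1 X p)
  have ctr : (form (pd 1 X p) (pd 1 X p) : ℂ) * form b (pd 0 X p)
      - 2 * form (pd 0 X p) (pd 1 X p) * form b (pd 1 X p)
      + form (pd 0 X p) (pd 0 X p) * form a (pd 1 X p) = 0 := by exact_mod_cast htr
  have csy : (form a (pd 0 X p) : ℂ) = form b (pd 1 X p) := by exact_mod_cast hsym
  have hE : (form (pd 0 X p) (pd 0 X p) : ℂ) ≠ 0 := by exact_mod_cast (h.pos p hpV).ne'
  have k1 := h.conformalCoeff_norm hpV hε
  have k2 := h.conformalCoeff_add hpV ε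
  -- The product of a - m b and X₁ - m̄ X₀ vanishes by the symmetry and trace conditions, because m
  -- m̄ = G/E and m + m̄ = 2F/E.
  have k3 : (form a (pd 1 X p) : ℂ) - conformalCoeff X (-ε) p * form a (pd 0 X p)
      - conformalCoeff X ε p * form b (pd 1 X p)
      + conformalCoeff X ε p * conformalCoeff X (-ε) p * form b (pd 0 X p) = 0 := by
    apply mul_left_cancel₀ hE
    linear_combination ctr + form b (pd 0 X p) * k1 - form b (pd 1 X p) * k2
      - form (pd 0 X p) (pd 0 X p) * conformalCoeff X (-ε) p * csy
  linear_combination -2 * k3 + e11 - conformalCoeff X (-ε) p * e10 - conformalCoeff X ε p * e01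
    + conformalCoeff X ε p * conformalCoeff X (-ε) p * e00

end IsTrappedPatch

/-! ### Unique continuation -/

/-- A solution of a Beltrami equation that vanishes near points arbitrarily close to `q` vanishes
near `q`. -/
lemma eventually_eq_zero_of_frequently {f m : Plane → ℂ} {V : Set Plane} {q : Plane}
    (hV : IsOpen V) (hm : ∀ w ∈ V, ContDiffAt ℝ ∞ m w) (him : ∀ w ∈ V, (m w).im ≠ 0)
    (hf : ∀ w ∈ V, ContDiffAt ℝ ∞ f w) (hD : ∀ w ∈ V, pd 1 f w = m w * pd 0 f w) (hq : q ∈ V)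
    (h : ∃ᶠ c in 𝓝 q, ∀ᶠ p in 𝓝 c, f p = 0) : ∀ᶠ p in 𝓝 q, f p = 0 := by
  have hB : IsBeltrami (fun w => (m w).re) (fun w => (m w).im) (fun w => (f w).re)
      (fun w => (f w).im) V := by
    have hre : ∀ w ∈ V, ∀ i, pd i (fun w => (f w).re) w = (pd i f w).re := fun w hw i =>
      pd_clm i Complex.reCLM (hf w hw).diff
    have him' : ∀ w ∈ V, ∀ i, pd i (fun w => (f w).im) w = (pd i f w).im := fun w hw i =>
      pd_clm i Complex.imCLM (hf w hw).diff
    refine ⟨hV, fun w hw => Complex.reCLM.contDiff.contDiffAt.comp w (hm w hw),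
      fun w hw => Complex.imCLM.contDiff.contDiffAt.comp w (hm w hw), him,
      fun w hw => Complex.reCLM.contDiff.contDiffAt.comp w (hf w hw),
      fun w hw => Complex.imCLM.contDiff.contDiffAt.comp w (hf w hw), fun w hw => ?_,
      fun w hw => ?_⟩
    · rw [hre w hw, hre w hw, him' w hw, hD w hw, Complex.mul_re]
    · rw [him' w hw, hre w hw, him' w hw, hD w hw, Complex.mul_im]
  obtain ⟨ρ, hρ, hb⟩ := Metric.isOpen_iff.1 hV q hq
  -- With c within ρ/4 of q, the disc of radius ρ/2 about c contains q and its closure lies in V.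
  obtain ⟨c, hc, hcq⟩ := (h.and_eventually (Metric.ball_mem_nhds q (ε := ρ / 4) (by positivity))).exists
  obtain ⟨R, hR, hR0⟩ := Metric.eventually_nhds_iff_ball.1 hc
  have hcq' : dist c q < ρ / 4 := hcq
  have hcl : Metric.closedBall c (ρ / 2) ⊆ V := fun p hp => hb (by
    rw [Metric.mem_closedBall] at hp
    rw [Metric.mem_ball]
    linarith [dist_triangle p c q])
  have key := hB.eq_zero_of_eq_zero_on_ball hR hcl (fun p hp => by rw [hR0 p hp]; simp)
  filter_upwards [Metric.isOpen_ball.mem_nhds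
    (show q ∈ Metric.ball c (ρ / 2) by rw [Metric.mem_ball, dist_comm]; linarith)] with p hp
  have := key p hp
  apply Complex.ext
  · simp only [Complex.zero_re]; nlinarith [sq_nonneg (f p).re, sq_nonneg (f p).im]
  · simp only [Complex.zero_im]; nlinarith [sq_nonneg (f p).re, sq_nonneg (f p).im]

lemma pd_complex_mul {f g : Plane → ℂ} {q : Plane} (i : Fin 2) (hf : DifferentiableAt ℝ f q)
    (hg : DifferentiableAt ℝ g q) :
    pd i (fun w => f w * g w) q = pd i f q * g q + f q * pd i g q :=
  pd_bilin i (ContinuousLinearMap.mul ℝ ℂ) hf hg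

lemma frequently_eventually_mono {V : Set Plane} (hV : IsOpen V) {q : Plane} (hq : q ∈ V)
    {P Q : Plane → Prop} (hPQ : ∀ w ∈ V, P w → Q w)
    (h : ∃ᶠ c in 𝓝 q, ∀ᶠ p in 𝓝 c, P p) : ∃ᶠ c in 𝓝 q, ∀ᶠ p in 𝓝 c, Q p := by
  refine (h.and_eventually (hV.eventually_mem hq)).mono fun c hc => ?_
  filter_upwards [hc.1, hV.eventually_mem hc.2] with p hp hpV using hPQ p hpV hp

namespace IsTrappedPatch

variable {X η Y : Plane → E41} {μ : Plane → ℝ} {N : Plane → Bivector} {V V' : Set Plane}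
  {q : Plane} {δ : ℝ} {m w : Plane → ℂ}

/-- The form ⟨∂H, ∂X⟩ is symmetric, and trace-free since H is null, so `key` applies to the
derivatives of H. Differentiating C(H) = w P(H) then leaves (w₁ - m w₀) P(H) = 0. -/
lemma pd_direction (h : IsTrappedPatch X μ N V) (hl : IsLightPatch X δ m w V') (hs : V' ⊆ V)
    (hq : q ∈ V') : pd 1 w q = m q * pd 0 w q := by
  have sH := h.smooth_H (hs hq)
  have dP : DifferentiableAt ℝ (fun p => lightP δ (meanCurvatureCoord X p)) q :=
    (lightP δ).differentiableAt.comp q sH.diff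
  have e : ∀ i, lightC (pd i (meanCurvatureCoord X) q)
      = pd i w q * lightP δ (meanCurvatureCoord X q)
        + w q * lightP δ (pd i (meanCurvatureCoord X) q) := by
    intro i
    rw [← pd_clm i lightC sH.diff, pd_congr i hl.isOpen hl.H_eq hq,
      pd_complex_mul i (hl.smooth_w q hq).diff dP, pd_clm i (lightP δ) sH.diff]
  have k := (hl.key q hq (pd 1 (meanCurvatureCoord X) q) (pd 0 (meanCurvatureCoord X) q)
    (h.form_pdH_H (hs hq) 1) (h.form_pdH_H (hs hq) 0) (h.form_pdH_comm (hs hq))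
    (h.trace_pdH (hs hq))).1
  rw [e, e] at k
  apply mul_right_cancel₀ (hl.H_ne q hq)
  linear_combination k

/-- Unique continuation is applied to these two expressions, which both vanish exactly when Y is a
multiple of H. The uses are Y constant and Y = η - X - y. -/
lemma pd_light_of_symm (h : IsTrappedPatch X μ N V) (hl : IsLightPatch X δ m w V')
    (hs : V' ⊆ V) (hq : q ∈ V') (hY : DifferentiableAt ℝ Y q)
    (h1 : ∀ i, form (pd i Y q) (meanCurvatureCoord X q) = 0)
    (h2 : form (pd 1 Y q) (pd 0 X q) = form (pd 0 Y q) (pd 1 X q))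
    (h3 : form (pd 1 X q) (pd 1 X q) * form (pd 0 Y q) (pd 0 X q)
      - 2 * form (pd 0 X q) (pd 1 X q) * form (pd 0 Y q) (pd 1 X q)
      + form (pd 0 X q) (pd 0 X q) * form (pd 1 Y q) (pd 1 X q) = 0) :
    pd 1 (fun p => lightC (Y p) - w p * lightP δ (Y p)) q
        = m q * pd 0 (fun p => lightC (Y p) - w p * lightP δ (Y p)) q ∧
      pd 1 (fun p => lightP (-δ) (Y p) - w p * lightD (Y p)) q
        = m q * pd 0 (fun p => lightP (-δ) (Y p) - w p * lightD (Y p)) q := by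
  have dw := (hl.smooth_w q hq).diff
  have hw := h.pd_direction hl hs hq
  obtain ⟨k1, k2⟩ := hl.key q hq _ _ (h1 1) (h1 0) h2 h3
  have dL : ∀ L : E41 →L[ℝ] ℂ, DifferentiableAt ℝ (fun p => L (Y p)) q := fun L =>
    L.differentiableAt.comp q hY
  have e : ∀ (L L' : E41 →L[ℝ] ℂ) i, pd i (fun p => L (Y p) - w p * L' (Y p)) q
      = L (pd i Y q) - (pd i w q * L' (Y q) + w q * L' (pd i Y q)) := by
    intro L L' i
    rw [pd_sub i (dL L) (dw.fun_mul (dL L')), pd_complex_mul i dw (dL L'), pd_clm i L hY,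
      pd_clm i L' hY]
  constructor
  · rw [e, e, hw]; linear_combination k1
  · rw [e, e, hw]; linear_combination k2

lemma eq_smul_H_of_light (h : IsTrappedPatch X μ N V) (hl : IsLightPatch X δ m w V')
    (hs : V' ⊆ V) (hq : q ∈ V') {v : E41} (hC : lightC v - w q * lightP δ v = 0)
    (hM : lightP (-δ) v - w q * lightD v = 0) : ∃ t : ℝ, v = t • meanCurvatureCoord X q := by
  have hne := hl.H_ne q hq
  have hr : ∀ v, lightP δ v = ((v 0 + δ * v 3 : ℝ) : ℂ) := fun v => by
    rw [lightP_apply]; push_cast; ring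
  -- The factor is P(v)/P(H), written in real coordinates so that it is a real number.
  refine ⟨(v 0 + δ * v 3) / (meanCurvatureCoord X q 0 + δ * meanCurvatureCoord X q 3), ?_⟩
  have ht : (((v 0 + δ * v 3) / (meanCurvatureCoord X q 0 + δ * meanCurvatureCoord X q 3) : ℝ) : ℂ)
      * lightP δ (meanCurvatureCoord X q) = lightP δ v := by
    rw [hr, hr] at *
    push_cast at hne ⊢
    field_simp
  generalize (v 0 + δ * v 3) / (meanCurvatureCoord X q 0 + δ * meanCurvatureCoord X q 3) = t at ht
  have hCv : lightC v = (t : ℂ) * lightC (meanCurvatureCoord X q) := by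
    rw [hl.H_eq q hq]; linear_combination hC - w q * ht
  have hDv : lightD v = (t : ℂ) * lightD (meanCurvatureCoord X q) := by
    rw [lightD_eq, lightD_eq, hCv, map_mul, Complex.conj_ofReal]
  apply ext_light hl.sq
  · rw [map_smul, Complex.real_smul, ht]
  · rw [map_smul, Complex.real_smul, light_null hl.sq (h.H_null q (hs hq)) hne (hl.H_eq q hq)]
    rw [hDv] at hM
    linear_combination hM
  · rw [map_smul, Complex.real_smul, hCv]

lemma light_smul_H (h : IsTrappedPatch X μ N V) (hl : IsLightPatch X δ m w V')
    (hs : V' ⊆ V) (hq : q ∈ V') (t : ℝ) :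
    lightC (t • meanCurvatureCoord X q) - w q * lightP δ (t • meanCurvatureCoord X q) = 0 ∧
      lightP (-δ) (t • meanCurvatureCoord X q) - w q * lightD (t • meanCurvatureCoord X q) = 0 := by
  simp only [map_smul, Complex.real_smul,
    light_null hl.sq (h.H_null q (hs hq)) (hl.H_ne q hq) (hl.H_eq q hq), hl.H_eq q hq]
  constructor <;> ring

/-- Unique continuation for the direction of `H`. -/
lemma eventually_H_smul (h : IsTrappedPatch X μ N V) (hq : q ∈ V) {n : E41}
    (hf : ∃ᶠ c in 𝓝 q, ∀ᶠ p in 𝓝 c, ∃ t : ℝ, meanCurvatureCoord X p = t • n) :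
    ∀ᶠ p in 𝓝 q, ∃ t : ℝ, meanCurvatureCoord X p = t • n := by
  obtain ⟨δ, m, w, V', hl, hqV, hs⟩ := h.exists_isLightPatch hq
  have hn : ∀ p ∈ V', (∃ t : ℝ, meanCurvatureCoord X p = t • n) →
      ∃ t : ℝ, n = t • meanCurvatureCoord X p := by
    rintro p hp ⟨t, ht⟩
    have ht0 : t ≠ 0 := by
      rintro rfl
      exact h.H_ne p (hs hp) (by rw [ht, zero_smul])
    exact ⟨t⁻¹, by rw [ht, smul_smul, inv_mul_cancel₀ ht0, one_smul]⟩
  -- A constant vector satisfies the derivative conditions trivially; only the coefficient w varies.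
  have z1 := fun p (hp : p ∈ V') => h.pd_light_of_symm (Y := fun _ => n) hl hs hp
    (differentiableAt_const _) (fun i => by rw [pd_const, form_zero_left])
    (by simp only [pd_const, form_zero_left]) (by simp only [pd_const, form_zero_left]; ring)
  have fr : ∀ p ∈ V', (∃ t : ℝ, meanCurvatureCoord X p = t • n) →
      lightC n - w p * lightP δ n = 0 ∧ lightP (-δ) n - w p * lightD n = 0 := by
    intro p hp hH
    obtain ⟨t, ht⟩ := hn p hp hH
    have := h.light_smul_H hl hs hp t
    rwa [← ht] at this
  have c1 := eventually_eq_zero_of_frequently hl.isOpen hl.smooth_m hl.im_ne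
    (f := fun p => lightC n - w p * lightP δ n)
    (fun p hp => contDiffAt_const.sub ((hl.smooth_w p hp).mul contDiffAt_const))
    (fun p hp => (z1 p hp).1) hqV
    (frequently_eventually_mono hl.isOpen hqV (fun p hp hH => (fr p hp hH).1) hf)
  have c2 := eventually_eq_zero_of_frequently hl.isOpen hl.smooth_m hl.im_ne
    (f := fun p => lightP (-δ) n - w p * lightD n)
    (fun p hp => contDiffAt_const.sub ((hl.smooth_w p hp).mul contDiffAt_const))
    (fun p hp => (z1 p hp).2) hqV
    (frequently_eventually_mono hl.isOpen hqV (fun p hp hH => (fr p hp hH).2) hf)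
  have hn0 : n ≠ 0 := by
    obtain ⟨c, hc, hcV⟩ := (hf.and_eventually (hl.isOpen.eventually_mem hqV)).exists
    obtain ⟨t, ht⟩ := hc.self_of_nhds
    rintro rfl
    exact h.H_ne c (hs hcV) (by rw [ht, smul_zero])
  filter_upwards [c1, c2, hl.isOpen.eventually_mem hqV] with p h1 h2 hp
  obtain ⟨t, ht⟩ := h.eq_smul_H_of_light hl hs hp h1 h2
  have ht0 : t ≠ 0 := by
    rintro rfl
    exact hn0 (by rw [ht, zero_smul])
  exact ⟨t⁻¹, by rw [ht, smul_smul, inv_mul_cancel₀ ht0, one_smul]⟩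

/-- A normal vector orthogonal to the null vector H is a multiple of H, since the normal plane is
Lorentzian. -/
lemma isNormalTranslate_iff (h : IsTrappedPatch X μ N V) (hη : IsConjugateNormal X η V)
    (hq : q ∈ V) (y : E41) :
    IsNormalTranslate X y q ↔ ∃ t : ℝ, η q - (X q + y) = t • meanCurvatureCoord X q := by
  have fr := h.isFrame hq (hη.normal q hq) (hη.H_η q hq)
  constructor
  · rintro ⟨h1, h2⟩
    refine ⟨-form (η q - (X q + y)) (η q), ?_⟩
    have e := fr.expand (hη.null q hq) (η q - (X q + y))
    have a := fun l => form_comm (pd l X q) (η q - (X q + y))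
    simp only [form_sub_right, hη.normal q hq, h1, sub_self] at a
    have b : form (η q - (X q + y)) (meanCurvatureCoord X q) = 0 := by
      rw [form_comm, form_sub_right, hη.H_η q hq, h2]; ring
    have a' : ∀ l, form (pd l X q) (η q - (X q + y)) = 0 := fun l => by
      rw [form_sub_right, hη.normal q hq, h1, sub_self]
    rw [a', a', b] at e
    rw [neg_smul]
    simpa using e
  · rintro ⟨t, ht⟩
    have e : X q + y = η q - t • meanCurvatureCoord X q := by rw [← ht]; abel
    refine ⟨fun l => ?_, ?_⟩
    · rw [e, form_sub_right, form_smul_right, hη.normal q hq, h.form_pd_H hq]; ring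
    · rw [e, form_sub_right, form_smul_right, hη.H_η q hq, h.H_null q hq]; ring

/-- Unique continuation for the property of `X + y` to be normal. -/
lemma eventually_isNormalTranslate (h : IsTrappedPatch X μ N V) (hη : IsConjugateNormal X η V)
    (hp : ∀ w ∈ V, ∀ k, form (pd k (meanCurvatureCoord X) w) (η w) = 0) (hq : q ∈ V) {y : E41}
    (hf : ∃ᶠ c in 𝓝 q, ∀ᶠ p in 𝓝 c, IsNormalTranslate X y p) :
    ∀ᶠ p in 𝓝 q, IsNormalTranslate X y p := by
  obtain ⟨δ, m, w, V', hl, hqV, hs⟩ := h.exists_isLightPatch hq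
  set Y : Plane → E41 := fun p => η p - (X p + y) with hY
  have sY : ∀ p ∈ V', ContDiffAt ℝ ∞ Y p := fun p hp =>
    (hη.smooth p (hs hp)).sub ((h.smooth p (hs hp)).add contDiffAt_const)
  have dY : ∀ p ∈ V', ∀ i, pd i Y p = pd i η p - pd i X p := fun p hp i => by
    have s1 := (hη.smooth p (hs hp)).diff
    have s2 := (h.smooth p (hs hp)).diff
    rw [hY, pd_sub i s1 (s2.fun_add (differentiableAt_const y)),
      pd_add i s2 (differentiableAt_const y), pd_const, add_zero]
  have hηH : ∀ p ∈ V, ∀ k, form (meanCurvatureCoord X p) (pd k η p) = 0 := fun p hpV k => by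
    have e := pd_form k (h.smooth_H hpV).diff (hη.smooth p hpV).diff
    rw [pd_congr k h.isOpen hη.H_η hpV, pd_const, hp p hpV] at e
    linarith
  -- Both dη and dX pair symmetrically with dX and have the same trace, and dη is orthogonal to H
  -- because H is parallel. So the difference is admissible.
  have z1 := fun p (hp : p ∈ V') => h.pd_light_of_symm (Y := Y) hl hs hp (sY p hp).diff
    (fun i => by
      rw [dY p hp, form_sub_left, h.form_pd_H (hs hp), form_comm, hηH p (hs hp), sub_zero])
    (by
      rw [dY p hp, dY p hp, form_sub_left, form_sub_left,
        h.form_pdn_pdX hη.smooth hη.normal (hs hp), h.form_pdn_pdX hη.smooth hη.normal (hs hp),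
        pd_comm 1 0 (h.smooth p (hs hp)), form_comm (pd 1 X p) (pd 0 X p)])
    (by
      have := h.trace_pd_conjugateNormal hη (hs hp)
      rw [gramDet] at this
      simp only [dY p hp, form_sub_left]
      linear_combination this)
  have sL : ∀ p ∈ V', ∀ L : E41 →L[ℝ] ℂ, ContDiffAt ℝ ∞ (fun p => L (Y p)) p := fun p hp L =>
    L.contDiff.contDiffAt.comp p (sY p hp)
  have fr : ∀ p ∈ V', IsNormalTranslate X y p →
      lightC (Y p) - w p * lightP δ (Y p) = 0 ∧ lightP (-δ) (Y p) - w p * lightD (Y p) = 0 := by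
    intro p hp hH
    obtain ⟨t, ht⟩ := (h.isNormalTranslate_iff hη (hs hp) y).1 hH
    have := h.light_smul_H hl hs hp t
    rwa [← ht] at this
  have c1 := eventually_eq_zero_of_frequently hl.isOpen hl.smooth_m hl.im_ne
    (f := fun p => lightC (Y p) - w p * lightP δ (Y p))
    (fun p hp => (sL p hp _).sub ((hl.smooth_w p hp).mul (sL p hp _)))
    (fun p hp => (z1 p hp).1) hqV
    (frequently_eventually_mono hl.isOpen hqV (fun p hp hH => (fr p hp hH).1) hf)
  have c2 := eventually_eq_zero_of_frequently hl.isOpen hl.smooth_m hl.im_ne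
    (f := fun p => lightP (-δ) (Y p) - w p * lightD (Y p))
    (fun p hp => (sL p hp _).sub ((hl.smooth_w p hp).mul (sL p hp _)))
    (fun p hp => (z1 p hp).2) hqV
    (frequently_eventually_mono hl.isOpen hqV (fun p hp hH => (fr p hp hH).2) hf)
  filter_upwards [c1, c2, hl.isOpen.eventually_mem hqV] with p h1 h2 hp
  exact (h.isNormalTranslate_iff hη (hs hp) y).2 (h.eq_smul_H_of_light hl hs hp h1 h2)

end IsTrappedPatch

/-! ### Marginally trapped surfaces -/

section Trapped

variable {M : Type*} [TopologicalSpace M] [ChartedSpace Plane M]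

lemma eventually_chart_symm (p : M) (Q : M → Prop) {q : Plane} (hq : q ∈ (chartAt Plane p).target) :
    (∀ᶠ w in 𝓝 q, Q ((chartAt Plane p).symm w)) ↔ ∀ᶠ p' in 𝓝 ((chartAt Plane p).symm q), Q p' :=
  ((chartAt Plane p).symm.eventually_nhds Q hq).symm

lemma frequently_chart_symm (p : M) (Q : M → Prop)
    (h : ∃ᶠ c in 𝓝 p, ∀ᶠ p' in 𝓝 c, Q p') :
    ∃ᶠ c in 𝓝 (chartAt Plane p p), ∀ᶠ w in 𝓝 c, Q ((chartAt Plane p).symm w) := by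
  intro hn
  apply h
  rw [← (chartAt Plane p).eventually_nhds' _ (mem_chart_source Plane p)]
  filter_upwards [hn, (chartAt Plane p).open_target.eventually_mem
    ((chartAt Plane p).map_source (mem_chart_source Plane p))] with c hc hct
  rwa [← eventually_chart_symm p Q hct]

/-- A property that holds near some point and continues uniquely holds everywhere. -/
lemma forall_of_unique_continuation {M : Type*} [TopologicalSpace M] [PreconnectedSpace M]
    {Q : M → Prop} {p₀ : M} (h0 : ∀ᶠ p in 𝓝 p₀, Q p)
    (h : ∀ p, (∃ᶠ c in 𝓝 p, ∀ᶠ p' in 𝓝 c, Q p') → ∀ᶠ p' in 𝓝 p, Q p') (p : M) : Q p := by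
  -- The set of points near which Q holds is open automatically; the hypothesis says that it is
  -- closed.
  have hcl : IsClopen {p | ∀ᶠ p' in 𝓝 p, Q p'} := by
    refine ⟨isClosed_iff_frequently.2 fun p hp => h p hp, isOpen_iff_mem_nhds.2 fun p hp => ?_⟩
    exact eventually_eventually_nhds.2 hp
  have := hcl.eq_univ ⟨p₀, h0⟩
  have hp : p ∈ {p | ∀ᶠ p' in 𝓝 p, Q p'} := by rw [this]; trivial
  exact hp.self_of_nhds

lemma inChart_apply_self {W : Type*} (p : M) (G : M → W) :
    inChart p G (chartAt Plane p p) = G p := by simp [inChart]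

lemma chart_mem_target (p : M) : chartAt Plane p p ∈ (chartAt Plane p).target :=
  (chartAt Plane p).map_source (mem_chart_source Plane p)

variable [IsManifold (𝓡 2) ∞ M] {x : M → E41} {ν : M → Bivector}

lemma meanCurvature_inChart (hx : IsSpacelikeSurface x) (p : M) {q : Plane}
    (hq : q ∈ (chartAt Plane p).target) :
    meanCurvature x ((chartAt Plane p).symm q) = meanCurvatureCoord (inChart p x) q :=
  meanCurvature_param (hx.1 _) (contMDiffAt_chart_symm p hq) (gramDet_inChart_pos hx p hq).ne'

lemma laplace_inChart {W : Type*} [NormedAddCommGroup W] [NormedSpace ℝ W] {G : M → W}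
    (hx : IsSpacelikeSurface x) (p : M) {q : Plane} (hq : q ∈ (chartAt Plane p).target)
    (hG : ContMDiffAt (𝓡 2) 𝓘(ℝ, W) ∞ G ((chartAt Plane p).symm q)) :
    laplace x G ((chartAt Plane p).symm q) = laplaceCoord (inChart p x) (inChart p G) q :=
  laplace_param (hx.1 _) hG (contMDiffAt_chart_symm p hq) (gramDet_inChart_pos hx p hq).ne'

lemma isTrappedPatch_inChart (hx : IsMarginallyTrapped x) (hν : IsGaussMap x ν) (p : M) :
    IsTrappedPatch (inChart p x) (gaussCoeff (inChart p x) (inChart p ν)) (inChart p ν)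
      (chartAt Plane p).target :=
  { isGaussPatch_inChart hx.1 hν p with
    H_ne := fun q hq => by
      rw [← meanCurvature_inChart hx.1 p hq]; exact (hx.2 _).1
    H_null := fun q hq => by
      rw [← meanCurvature_inChart hx.1 p hq]; exact (hx.2 _).2 }

lemma contMDiff_gaussMap (hx : IsSpacelikeSurface x) (hν : IsGaussMap x ν) :
    ContMDiff (𝓡 2) 𝓘(ℝ, Bivector) ∞ ν := fun p =>
  contMDiffAt_of_inChart p (mem_chart_source Plane p)
    ((isGaussPatch_inChart hx hν p).smooth_N ((chartAt Plane p).map_source (mem_chart_source Plane p)))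

lemma contMDiff_laplace {W : Type*} [NormedAddCommGroup W] [NormedSpace ℝ W] {G : M → W}
    (hx : IsSpacelikeSurface x) (hG : ContMDiff (𝓡 2) 𝓘(ℝ, W) ∞ G) :
    ContMDiff (𝓡 2) 𝓘(ℝ, W) ∞ (laplace x G) := fun p => by
  have ht := (chartAt Plane p).map_source (mem_chart_source Plane p)
  refine contMDiffAt_of_inChart p (mem_chart_source Plane p) ?_
  refine (contDiffAt_laplaceCoord (contDiffAt_inChart p ht (hx.1 _))
    (gramDet_inChart_pos hx p ht).ne' (contDiffAt_inChart p ht (hG _))).congr_of_eventuallyEq ?_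
  filter_upwards [(chartAt Plane p).open_target.eventually_mem ht] with q hq
  exact laplace_inChart hx p hq (hG _)

lemma isOpen_nonHarmonicSet (hx : IsSpacelikeSurface x) (hν : IsGaussMap x ν) :
    IsOpen (nonHarmonicSet x ν) :=
  isOpen_ne_fun (contMDiff_laplace hx (contMDiff_gaussMap hx hν)).continuous continuous_const

lemma bform_gaussMap_self (hx : IsSpacelikeSurface x) (hν : IsGaussMap x ν) (p : M) :
    bform (ν p) (ν p) = 1 := by
  have := (isGaussPatch_inChart hx hν p).bform_N_N
    ((chartAt Plane p).map_source (mem_chart_source Plane p))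
  simpa [inChart] using this

lemma bform_laplace_gaussMap (hx : IsMarginallyTrapped x) (hν : IsGaussMap x ν) (p : M) :
    bform (laplace x ν p) (ν p) = -2 * gaussCurvature x p := by
  have ht := (chartAt Plane p).map_source (mem_chart_source Plane p)
  have h := isTrappedPatch_inChart hx hν p
  have := h.bform_laplace_N ht (h.H_null _ ht)
  simpa [inChart, laplace, gaussCurvature] using this

/-- The direction of `H` is constant if it is so near some point. -/
lemma meanCurvature_smul_of_eventually [PreconnectedSpace M] (hx : IsMarginallyTrapped x)
    (hν : IsGaussMap x ν) {n : E41} {p₀ : M}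
    (h0 : ∀ᶠ p in 𝓝 p₀, ∃ t : ℝ, meanCurvature x p = t • n) (p : M) :
    ∃ t : ℝ, meanCurvature x p = t • n := by
  refine forall_of_unique_continuation h0 (fun p hp => ?_) p
  have hf := frequently_chart_symm p _ hp
  have ht := chart_mem_target p
  have h := (isTrappedPatch_inChart hx hν p).eventually_H_smul (n := n) ht
    (frequently_eventually_mono (chartAt Plane p).open_target ht (fun w hw hH => by
      rwa [meanCurvature_inChart hx.1 p hw] at hH) hf)
  rw [← (chartAt Plane p).eventually_nhds' _ (mem_chart_source Plane p)]
  filter_upwards [h, (chartAt Plane p).open_target.eventually_mem ht] with q hq hqt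
  rwa [meanCurvature_inChart hx.1 p hqt]

/-- The translate of `x` by `y` is normal at `p` and its product with `H` is `-1`. -/
def IsNormalTranslateAt (x : M → E41) (y : E41) (p : M) : Prop :=
  (∀ v : TangentSpace (𝓡 2) p, form (mfderiv (𝓡 2) 𝓘(ℝ, E41) x p v) (x p + y) = 0) ∧
    form (meanCurvature x p) (x p + y) = -1

lemma isNormalTranslateAt_iff (hx : IsSpacelikeSurface x) (y : E41) (p : M) {q : Plane}
    (hq : q ∈ (chartAt Plane p).target) :
    IsNormalTranslateAt x y ((chartAt Plane p).symm q) ↔ IsNormalTranslate (inChart p x) y q := by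
  rw [IsNormalTranslateAt, IsNormalTranslate, meanCurvature_inChart hx p hq]
  refine and_congr ⟨fun h l => ?_, fun h v => ?_⟩ Iff.rfl
  · have e := mfderiv_param (hx.1 ((chartAt Plane p).symm q)) (contMDiffAt_chart_symm p hq)
      (EuclideanSpace.single l 1)
    have e2 := h (mfderiv (𝓡 2) (𝓡 2) (chartAt Plane p).symm q (EuclideanSpace.single l 1))
    rw [e] at e2
    change form (_ • pd 0 (inChart p x) q + _ • pd 1 (inChart p x) q) (inChart p x q + y) = 0 at e2
    fin_cases l <;> simpa using e2
  · obtain ⟨a, b, hab⟩ := exists_mfderiv_eq p hq (hx.1 _) v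
    rw [hab]
    change form _ (inChart p x q + y) = 0
    rw [form_add_left, form_smul_left, form_smul_left, h, h]
    ring

/-- Constancy of a function on a connected surface. -/
lemma eq_of_pd_inChart_eq_zero [PreconnectedSpace M] {W : Type*} [NormedAddCommGroup W]
    [NormedSpace ℝ W] {G : M → W} (hG : ContMDiff (𝓡 2) 𝓘(ℝ, W) ∞ G)
    (h : ∀ p : M, ∀ q ∈ (chartAt Plane p).target, ∀ i, pd i (inChart p G) q = 0) (p p' : M) :
    G p = G p' := by
  have hl : IsLocallyConstant G := by
    rw [IsLocallyConstant.iff_eventually_eq]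
    intro p
    have ht := chart_mem_target p
    have := eventually_const_of_pd_eq_zero (Z := inChart p G) (q := chartAt Plane p p) (by
      filter_upwards [(chartAt Plane p).open_target.eventually_mem ht] with w hw
      exact ⟨(contDiffAt_inChart p hw (hG _)).diff, h p w hw⟩)
    rw [inChart_apply_self] at this
    exact ((chartAt Plane p).eventually_nhds' _ (mem_chart_source Plane p)).1 this
  exact hl.apply_eq_of_preconnectedSpace p p'

end Trapped

/-! ### Surfaces in quadrics -/

namespace IsTrappedPatch

variable {X η : Plane → E41} {μ : Plane → ℝ} {N : Plane → Bivector} {V V' : Set Plane} {q : Plane}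

/-- If `⟨X + y, X + y⟩` is constant, then the Laplacian of the Gauss map is proportional to the
Gauss map. -/
lemma laplace_eq_smul_of_form_const (h : IsTrappedPatch X μ N V) {y : E41} {k : ℝ}
    (hk : ∀ w ∈ V, form (X w + y) (X w + y) = k) (hq : q ∈ V) :
    laplaceCoord X N q = bform (laplaceCoord X N q) (N q) • N q := by
  have dX : ∀ w ∈ V, DifferentiableAt ℝ (fun w => X w + y) w := fun w hw =>
    (h.smooth w hw).diff.fun_add (differentiableAt_const y)
  have pX : ∀ w ∈ V, ∀ i, pd i (fun w => X w + y) w = pd i X w := fun w hw i => by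
    rw [pd_add i (h.smooth w hw).diff (differentiableAt_const y), pd_const, add_zero]
  have h1 : ∀ w ∈ V, ∀ l, form (pd l X w) (X w + y) = 0 := by
    intro w hw l
    have e := pd_form l (dX w hw) (dX w hw)
    rw [pd_congr l h.isOpen hk hw, pd_const, form_comm (X w + y), pX w hw] at e
    linarith
  -- The second fundamental form in the direction X + y is minus the metric, so its commutator with
  -- any other shape operator vanishes.
  have h2 : ∀ w ∈ V, ∀ i l, form (pd i (pd l X) w) (X w + y) = -form (pd i X w) (pd l X w) := by
    intro w hw i l
    have e := pd_form i (contDiffAt_pd l (h.smooth w hw)).diff (dX w hw)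
    rw [pd_congr i h.isOpen (fun w hw => h1 w hw l) hw, pd_const, pX w hw,
      form_comm (pd l X w)] at e
    linarith
  have h3 : ∀ w ∈ V, form (meanCurvatureCoord X w) (X w + y) = -1 := by
    intro w hw
    have e := trace_second_normal (h.smooth w hw) (h.det_ne hw) (h1 w hw)
    rw [h2 w hw, h2 w hw, h2 w hw, gramDet] at e
    apply mul_left_cancel₀ (h.det_ne hw)
    rw [gramDet]
    linear_combination -e / 2
  have h4 : ∀ k, form (pd k (meanCurvatureCoord X) q) (X q + y) = 0 := by
    intro k
    have e := pd_form k (h.smooth_H hq).diff (dX q hq)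
    rw [pd_congr k h.isOpen h3 hq, pd_const, pX q hq, form_comm (meanCurvatureCoord X q),
      h.form_pd_H hq] at e
    linarith
  refine h.laplace_eq_smul_of_parallel hq (h1 q hq) (h3 q hq) h4 ?_
  simp only [shapeCommutator, h2 q hq]
  ring

/-- If a null translate of `X` is normal, then `X` is flat. -/
lemma gaussCurvature_eq_zero (h : IsTrappedPatch X μ N V) {y : E41}
    (hy : ∀ w ∈ V, IsNormalTranslate X y w) (h0 : form (X q + y) (X q + y) = 0) (hq : q ∈ V) :
    gaussCurvatureCoord X q = 0 := by
  have h1 : ∀ w ∈ V, ∀ l, form (pd l X w) (X w + y) = 0 := fun w hw => (hy w hw).1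
  have h2 : ∀ i l, form (pd i (pd l X) q) (X q + y) = -form (pd i X q) (pd l X q) := by
    intro i l
    have e := pd_form i (contDiffAt_pd l (h.smooth q hq)).diff
      ((h.smooth q hq).diff.fun_add (differentiableAt_const y))
    rw [pd_congr i h.isOpen (fun w hw => h1 w hw l) hq, pd_const,
      pd_add i (h.smooth q hq).diff (differentiableAt_const y), pd_const, add_zero,
      form_comm (pd l X q)] at e
    linarith
  have fr := h.isFrame hq (h1 q hq) (hy q hq).2
  -- Once h is expanded in the null frame (H, X + y), the Gauss equation expresses K det g by the
  -- trace of ⟨h, H⟩, which is zero.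
  have hs : ∀ i j, secondFormCoord X i j q = form (pd i X q) (pd j X q) • meanCurvatureCoord X q
      - form (pd i (pd j X) q) (meanCurvatureCoord X q) • (X q + y) := by
    intro i j
    have e := fr.expand h0 (secondFormCoord X i j q)
    have t := fun l => form_secondFormCoord_pd (h.smooth q hq) (h.det_ne hq) i j l
    have t' := fun l => (form_comm (pd l X q) _).trans (t l)
    rw [t', t', form_secondFormCoord_normal (h1 q hq), form_secondFormCoord_normal (h.form_pd_H hq),
      h2] at e
    rw [e]
    simp
  have ge := gauss_equation h.isOpen h.smooth (fun w hw => h.det_ne hw) hq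
  rw [hs, hs, hs] at ge
  have tr := trace_second_normal (h.smooth q hq) (h.det_ne hq) (h.form_pd_H hq)
  simp only [form_sub_left, form_sub_right, form_smul_left, form_smul_right, h0, h.H_null q hq,
    form_comm (X q + y) (meanCurvatureCoord X q), (hy q hq).2] at ge tr
  have : gramDet X q * gaussCurvatureCoord X q = 0 := by
    rw [ge]; linear_combination tr
  exact (mul_eq_zero.1 this).resolve_left (h.det_ne hq)

end IsTrappedPatch

section Quadric

variable {M : Type*} [TopologicalSpace M] [ChartedSpace Plane M] [IsManifold (𝓡 2) ∞ M]
  {x : M → E41} {ν : M → Bivector}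

lemma exists_pos_inv_sq {k : ℝ} (hk : 0 < k) : ∃ r : ℝ, 0 < r ∧ (r ^ 2)⁻¹ = k :=
  ⟨(Real.sqrt k)⁻¹, by positivity, by rw [inv_pow, inv_inv, Real.sq_sqrt hk.le]⟩

/-- Take C = 0 and f = ⟨Δν, ν⟩ = -2K. Where Δν = 0 this f vanishes too, so the equation also holds
outside the set. -/
theorem isPointwiseOneType_of_isNonflatInQuadric (hx : IsMarginallyTrapped x)
    (hν : IsGaussMap x ν) (h : IsNonflatInQuadric x (nonHarmonicSet x ν)) :
    IsPointwiseOneType x ν := by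
  obtain ⟨⟨p₀, hp₀, hK⟩, T, r, hT, hr, hQ⟩ := h
  have hf : ContMDiff (𝓡 2) 𝓘(ℝ, ℝ) ∞ (fun p => bform (laplace x ν p) (ν p)) := by
    have h1 := contMDiff_laplace hx.1 (contMDiff_gaussMap hx.1 hν)
    have h2 := contMDiff_gaussMap hx.1 hν
    exact ((bformL.contDiff.contMDiff.comp h1).clm_apply h2)
  refine ⟨fun p => bform (laplace x ν p) (ν p), 0, hf, ⟨p₀, ?_⟩, fun p => ?_⟩
  · beta_reduce
    rw [bform_laplace_gaussMap hx hν]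
    exact mul_ne_zero (by norm_num) hK
  beta_reduce
  rw [add_zero]
  by_cases hp : p ∈ nonHarmonicSet x ν
  swap
  · rw [nonHarmonicSet, Set.mem_ofPred_eq, not_not] at hp
    rw [hp, bform_zero_left, zero_smul]
  obtain ⟨k, hk⟩ : ∃ k : ℝ, ∀ p ∈ nonHarmonicSet x ν, form (T (x p)) (T (x p)) = k := by
    rcases hQ with hQ | hQ
    · exact ⟨_, hQ⟩
    · exact ⟨_, hQ⟩
  -- T is the translation by y followed by its linear part, so the quadric condition becomes
  -- constancy of ⟨x + y, x + y⟩.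
  set y : E41 := T.linear.symm (T 0) with hy
  have hTx : ∀ v, form (v + y) (v + y) = form (T v) (T v) := by
    intro v
    have : T v = T.linear (v + y) := by
      rw [map_add, hy, LinearEquiv.apply_symm_apply]
      have := T.map_vadd 0 v
      simpa using this
    rw [this, hT]
  have ht := chart_mem_target p
  have hpatch := (isTrappedPatch_inChart hx hν p)
  have hcont : ContinuousOn (chartAt Plane p).symm (chartAt Plane p).target :=
    (chartAt Plane p).continuousOn_symm
  have hVo := hcont.isOpen_inter_preimage (chartAt Plane p).open_target
    (isOpen_nonHarmonicSet hx.1 hν)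
  have hmono := hpatch.mono hVo Set.inter_subset_left
  have := hmono.laplace_eq_smul_of_form_const (y := y) (k := k) (q := chartAt Plane p p)
    (fun w hw => by
      rw [hTx]
      exact hk _ hw.2) ⟨ht, by simpa using hp⟩
  rwa [inChart_apply_self] at this

/-- A surface with pointwise 1-type Gauss map on which `H` changes its direction lies in a
quadric. -/
theorem isNonflatInQuadric_of_pd_ne [PreconnectedSpace M] (hx : IsMarginallyTrapped x)
    (hν : IsGaussMap x ν) {f : M → ℝ} {C : Bivector} (hf : ContMDiff (𝓡 2) 𝓘(ℝ, ℝ) ∞ f)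
    (hL : ∀ p, laplace x ν p = f p • (ν p + C)) {p₀ : M} {q₀ : Plane}
    (hq₀ : q₀ ∈ (chartAt Plane p₀).target) (hp₀ : f ((chartAt Plane p₀).symm q₀) ≠ 0) {i k : Fin 2}
    (hne : form (pd i (meanCurvatureCoord (inChart p₀ x)) q₀) (pd k (inChart p₀ x) q₀) ≠ 0) :
    IsNonflatInQuadric x (nonHarmonicSet x ν) := by
  have hpatch := fun p => isTrappedPatch_inChart hx hν p
  have hLc : ∀ p, ∀ q ∈ (chartAt Plane p).target, laplaceCoord (inChart p x) (inChart p ν) q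
      = f ((chartAt Plane p).symm q) • (inChart p ν q + C) := fun p q hq => by
    rw [← laplace_inChart hx.1 p hq (contMDiff_gaussMap hx.1 hν _), hL]; rfl
  -- C is a constant, so it suffices to work in one chart on the open set where f ≠ 0.
  have hC : C = 0 := by
    have hcont : ContinuousOn (chartAt Plane p₀).symm (chartAt Plane p₀).target :=
      (chartAt Plane p₀).continuousOn_symm
    have hVo := hcont.isOpen_inter_preimage (chartAt Plane p₀).open_target
      (isOpen_ne_fun hf.continuous continuous_const : IsOpen {p | f p ≠ 0})
    exact ((hpatch p₀).mono hVo Set.inter_subset_left).const_eq_zero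
      (f := fun q => f ((chartAt Plane p₀).symm q)) (fun w hw => hw.2) (fun w hw => hLc p₀ w hw.1)
      ⟨hq₀, hp₀⟩ hne
  subst hC
  simp only [add_zero] at hL hLc
  choose η hη using fun p => (hpatch p).exists_conjugateNormal
  have hpar := fun p q (hq : q ∈ (chartAt Plane p).target) =>
    (hpatch p).parallel_of_laplace_eq_smul hq (hLc p q hq) ((hη p).normal q hq)
  obtain ⟨y, hy⟩ := (hpatch p₀).exists_isNormalTranslate (hη p₀) (fun w hw => (hpar p₀ w hw).1)
    (fun w hw => (hpar p₀ w hw).2) hq₀ hne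
  have hall : ∀ p, IsNormalTranslateAt x y p := by
    refine forall_of_unique_continuation (p₀ := (chartAt Plane p₀).symm q₀) ?_ (fun p hp => ?_)
    · rw [← (chartAt Plane p₀).eventually_nhds' _ ((chartAt Plane p₀).map_target hq₀),
        (chartAt Plane p₀).right_inv hq₀]
      filter_upwards [hy, (chartAt Plane p₀).open_target.eventually_mem hq₀] with q hq hqt
      rwa [isNormalTranslateAt_iff hx.1 y p₀ hqt]
    · have hfq := frequently_chart_symm p _ hp
      have ht := chart_mem_target p
      have h := (hpatch p).eventually_isNormalTranslate (hη p) (fun w hw => (hpar p w hw).1) ht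
        (frequently_eventually_mono (chartAt Plane p).open_target ht (fun w hw hH => by
          rwa [isNormalTranslateAt_iff hx.1 y p hw] at hH) hfq)
      rw [← (chartAt Plane p).eventually_nhds' _ (mem_chart_source Plane p)]
      filter_upwards [h, (chartAt Plane p).open_target.eventually_mem ht] with q hq hqt
      rwa [isNormalTranslateAt_iff hx.1 y p hqt]
  have hallc : ∀ p, ∀ q ∈ (chartAt Plane p).target, IsNormalTranslate (inChart p x) y q :=
    fun p q hq => (isNormalTranslateAt_iff hx.1 y p hq).1 (hall _)
  have hxy : ContMDiff (𝓡 2) 𝓘(ℝ, E41) ∞ (fun p => x p + y) := hx.1.1.add contMDiff_const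
  have hconst : ∀ p p', form (x p + y) (x p + y) = form (x p' + y) (x p' + y) := by
    refine eq_of_pd_inChart_eq_zero (G := fun p => form (x p + y) (x p + y))
      ((formL.contDiff.contMDiff.comp hxy).clm_apply hxy) (fun p q hq i => ?_)
    have hd : DifferentiableAt ℝ (fun w => inChart p x w + y) q :=
      (contDiffAt_inChart p hq (hx.1.1 _)).diff.fun_add (differentiableAt_const y)
    have e := pd_form i hd hd
    rw [pd_add i (contDiffAt_inChart p hq (hx.1.1 _)).diff (differentiableAt_const y), pd_const,
      add_zero, form_comm (inChart p x q + y), (hallc p q hq).1] at e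
    change pd i (fun w => form (inChart p x w + y) (inChart p x w + y)) q = 0
    simpa using e
  set p₁ := (chartAt Plane p₀).symm q₀ with hp₁
  have hK : gaussCurvature x p₁ ≠ 0 := by
    intro h0
    have := bform_laplace_gaussMap hx hν p₁
    rw [hL, bform_smul_left, bform_gaussMap_self hx.1 hν, h0] at this
    exact hp₀ (by linarith)
  -- If x + y were null the surface would be flat at p₁, where f = -2K is not zero.
  have hk0 : form (x p₁ + y) (x p₁ + y) ≠ 0 := by
    intro h0
    exact hK ((hpatch p₁).gaussCurvature_eq_zero (hallc p₁)
      (by rwa [inChart_apply_self]) (chart_mem_target p₁))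
  refine ⟨⟨p₁, ?_, hK⟩, ?_⟩
  · rw [nonHarmonicSet, Set.mem_ofPred_eq, hL]
    refine smul_ne_zero hp₀ fun h0 => ?_
    have := bform_gaussMap_self hx.1 hν p₁
    rw [h0, bform_zero_left] at this
    norm_num at this
  have hcong : IsCongruence (AffineEquiv.constVAdd ℝ E41 y) := fun a b => by simp
  have hTv : ∀ v, AffineEquiv.constVAdd ℝ E41 y v = v + y := fun v => by simp [add_comm]
  rcases lt_or_gt_of_ne hk0 with hneg | hpos
  · obtain ⟨r, hr, hrk⟩ := exists_pos_inv_sq (neg_pos.2 hneg)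
    refine ⟨_, r, hcong, hr, Or.inr fun p _ => ?_⟩
    change form _ _ = _
    rw [hTv, hconst p p₁, hrk, neg_neg]
  · obtain ⟨r, hr, hrk⟩ := exists_pos_inv_sq hpos
    refine ⟨_, r, hcong, hr, Or.inl fun p _ => ?_⟩
    change form _ _ = _
    rw [hTv, hconst p p₁, hrk]

end Quadric

/-! ### Local coordinates -/

/-- Shrinking the source to points with non-zero Jacobian makes the inverse smooth on the whole
target, not only at the image of q. -/
lemma exists_localInverse {τ : Plane → Plane} {V : Set Plane} {q : Plane} (hV : IsOpen V)
    (hτ : ∀ w ∈ V, ContDiffAt ℝ ∞ τ w) (hq : q ∈ V) (hj : jac τ q ≠ 0) :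
    ∃ Θ : OpenPartialHomeomorph Plane Plane, q ∈ Θ.source ∧ Θ.source ⊆ V ∧ (∀ w, Θ w = τ w) ∧
      (∀ w ∈ Θ.source, jac τ w ≠ 0) ∧ ∀ z ∈ Θ.target, ContDiffAt ℝ ∞ Θ.symm z := by
  have heq : ∀ w ∈ V, jac τ w ≠ 0 → ∃ f' : Plane ≃L[ℝ] Plane,
      HasFDerivAt τ (f' : Plane →L[ℝ] Plane) w := by
    intro w hw hjw
    have hinj : Function.Injective (fderiv ℝ τ w : Plane →ₗ[ℝ] Plane) := by
      rw [injective_iff_map_eq_zero]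
      intro v hv
      change fderiv ℝ τ w v = 0 at hv
      rw [fderiv_eq_pd] at hv
      have h0 : v 0 * pd 0 τ w 0 + v 1 * pd 1 τ w 0 = 0 := by
        simpa using congrArg (fun u : Plane => u 0) hv
      have h1 : v 0 * pd 0 τ w 1 + v 1 * pd 1 τ w 1 = 0 := by
        simpa using congrArg (fun u : Plane => u 1) hv
      have z0 : v 0 * jac τ w = 0 := by
        rw [jac]; linear_combination pd 1 τ w 1 * h0 - pd 1 τ w 0 * h1
      have z1 : v 1 * jac τ w = 0 := by
        rw [jac]; linear_combination pd 0 τ w 0 * h1 - pd 0 τ w 1 * h0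
      ext k
      fin_cases k
      · exact (mul_eq_zero.1 z0).resolve_right hjw
      · exact (mul_eq_zero.1 z1).resolve_right hjw
    refine ⟨(LinearEquiv.ofInjectiveEndo _ hinj).toContinuousLinearEquiv, ?_⟩
    have e : ((LinearEquiv.ofInjectiveEndo _ hinj).toContinuousLinearEquiv : Plane →L[ℝ] Plane)
        = fderiv ℝ τ w := by ext1 v; rfl
    rw [e]
    exact (hτ w hw).diff.hasFDerivAt
  have hjc : ContinuousOn (jac τ) V := fun w hw => by
    have p := fun i k => ((contDiff_coord k).continuous.continuousAt.comp
      (contDiffAt_pd i (hτ w hw)).continuousAt : ContinuousAt (fun z => pd i τ z k) w)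
    exact (((p 0 0).mul (p 1 1)).sub ((p 0 1).mul (p 1 0))).continuousWithinAt
  have hVo := hjc.isOpen_inter_preimage hV (isOpen_compl_singleton (x := (0 : ℝ)))
  obtain ⟨f', hf'⟩ := heq q hq hj
  set Θ₀ := (hτ q hq).toOpenPartialHomeomorph τ hf' (by simp) with hΘ₀
  have hq₀ : q ∈ Θ₀.source := (hτ q hq).mem_toOpenPartialHomeomorph_source hf' (by simp)
  have hcoe : ∀ w, Θ₀ w = τ w := fun w => rfl
  refine ⟨Θ₀.restrOpen _ hVo, ⟨hq₀, hq, hj⟩, fun w hw => hw.2.1, hcoe, fun w hw => hw.2.2, ?_⟩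
  intro z hz
  set Θ := Θ₀.restrOpen _ hVo
  have hw : Θ.symm z ∈ Θ.source := Θ.map_target hz
  obtain ⟨g', hg'⟩ := heq _ hw.2.1 hw.2.2
  exact Θ.contDiffAt_symm hz hg' (hτ _ hw.2.1)

/-! ### Division of smooth functions -/

/-- Differentiation under the integral sign, iterated. The value space varies in the induction
because the derivative of the integrand has values in linear maps. -/
lemma contDiff_integral_param {E : Type} [NormedAddCommGroup E] [NormedSpace ℝ E]
    [FiniteDimensional ℝ E] (n : ℕ) :
    ∀ {W : Type} [NormedAddCommGroup W] [NormedSpace ℝ W] [CompleteSpace W] {g : ℝ × E → W},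
      ContDiff ℝ ∞ g → ContDiff ℝ n (fun w => ∫ s in (0 : ℝ)..1, g (s, w)) := by
  have hder : ∀ {W : Type} [NormedAddCommGroup W] [NormedSpace ℝ W] [CompleteSpace W]
      {g : ℝ × E → W}, ContDiff ℝ ∞ g → ∀ w, HasFDerivAt (fun w => ∫ s in (0 : ℝ)..1, g (s, w))
        (∫ s in (0 : ℝ)..1, (fderiv ℝ g (s, w)).comp (ContinuousLinearMap.inr ℝ ℝ E)) w := by
    intro W _ _ _ g hg w
    have hF : Continuous (fun p : ℝ × E => (fderiv ℝ g p).comp (ContinuousLinearMap.inr ℝ ℝ E)) :=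
      (hg.continuous_fderiv (by simp)).clm_comp continuous_const
    obtain ⟨B, hB⟩ := ((isCompact_Icc (a := (0 : ℝ)) (b := 1)).prod
      (isCompact_closedBall w 1)).exists_bound_of_continuousOn hF.continuousOn
    refine intervalIntegral.hasFDerivAt_integral_of_dominated_of_fderiv_le
      (F := fun w s => g (s, w)) (bound := fun _ => B)
      (F' := fun w s => (fderiv ℝ g (s, w)).comp (ContinuousLinearMap.inr ℝ ℝ E))
      (Metric.closedBall_mem_nhds w one_pos) ?_ ?_ ?_ ?_ ?_ ?_
    · exact Filter.Eventually.of_forall fun z =>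
        (hg.continuous.comp (by fun_prop : Continuous fun s : ℝ => (s, z))).aestronglyMeasurable
    · exact (hg.continuous.comp (by fun_prop : Continuous fun s : ℝ => (s, w))).intervalIntegrable _ _
    · exact (hF.comp (by fun_prop : Continuous fun s : ℝ => (s, w))).aestronglyMeasurable
    · refine Filter.Eventually.of_forall fun s hs z hz => hB (s, z) ⟨?_, hz⟩
      rw [Set.uIoc_of_le zero_le_one] at hs
      exact ⟨hs.1.le, hs.2⟩
    · exact continuous_const.intervalIntegrable _ _
    · refine Filter.Eventually.of_forall fun s hs z hz => ?_
      have h1 := (hg.differentiable (by simp) (s, z)).hasFDerivAt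
      exact h1.comp z (hasFDerivAt_prodMk_right s z)
  induction n with
  | zero =>
    intro W _ _ _ g hg
    rw [Nat.cast_zero, contDiff_zero]
    exact continuous_iff_continuousAt.2 fun w => (hder hg w).continuousAt
  | succ n ih =>
    intro W _ _ _ g hg
    rw [Nat.cast_succ, contDiff_succ_iff_hasFDerivAt]
    refine ⟨_, ih (g := fun p => (fderiv ℝ g p).comp (ContinuousLinearMap.inr ℝ ℝ E)) ?_, hder hg⟩
    exact (hg.fderiv_right (m := ∞) (by simp)).clm_comp contDiff_const

/-- A smooth function that vanishes on the first coordinate axis is the product of the second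
coordinate and a smooth function. -/
lemma exists_smooth_factor {G : Plane → ℝ} {V : Set Plane} {q : Plane} (hV : IsOpen V)
    (hG : ∀ w ∈ V, ContDiffAt ℝ ∞ G w) (hz : ∀ w ∈ V, w 1 = 0 → G w = 0) (hq : q ∈ V) :
    ∃ K : Plane → ℝ, ContDiff ℝ ∞ K ∧ ∀ᶠ w in 𝓝 q, G w = w 1 * K w := by
  obtain ⟨ρ, hρ, hb⟩ := Metric.isOpen_iff.1 hV q hq
  -- The cut-off makes the function smooth on the whole plane and keeps it zero on the axis.
  let χ : ContDiffBump q := ⟨ρ / 4, ρ / 2, by positivity, by linarith⟩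
  set H : Plane → ℝ := fun w => χ w * G w with hH
  have hHs : ContDiff ℝ ∞ H := by
    rw [contDiff_iff_contDiffAt]
    intro w
    by_cases hw : w ∈ tsupport χ
    · rw [χ.tsupport_eq] at hw
      have hwV : w ∈ V := hb (Metric.closedBall_subset_ball (by change ρ / 2 < ρ; linarith) hw)
      exact χ.contDiffAt.mul (hG w hwV)
    · have : H =ᶠ[𝓝 w] fun _ => 0 := by
        filter_upwards [notMem_tsupport_iff_eventuallyEq.1 hw] with z hz
        simp [hH, hz]
      exact contDiffAt_const.congr_of_eventuallyEq this
  have hH0 : ∀ w : Plane, w 1 = 0 → H w = 0 := by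
    intro w hw
    by_cases hwV : w ∈ V
    · simp [hH, hz w hwV hw]
    · have : χ w = 0 := χ.zero_of_le_dist (by
        by_contra hc
        push Not at hc
        exact hwV (hb (hc.trans (by change ρ / 2 < ρ; linarith))))
      simp [hH, this]
  set e : Plane := EuclideanSpace.single 1 1 with he
  -- For s from 0 to 1 this runs along the vertical segment from the axis to w. The fundamental
  -- theorem of calculus on it gives Hadamard's factor.
  set γ : ℝ × Plane → Plane := fun p => p.2 + ((p.1 - 1) * p.2 1) • e with hγ
  have hγs : ContDiff ℝ ∞ γ := contDiff_snd.add (((contDiff_fst.sub contDiff_const).mul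
    ((contDiff_coord 1).comp contDiff_snd)).smul contDiff_const)
  have hKs : ContDiff ℝ ∞ (fun p => pd 1 H (γ p)) :=
    ((hHs.fderiv_right (m := ∞) (by simp)).clm_apply contDiff_const).comp hγs
  refine ⟨fun w => ∫ s in (0 : ℝ)..1, pd 1 H (γ (s, w)),
    contDiff_infty.2 fun n => contDiff_integral_param n hKs, ?_⟩
  have hHG : ∀ᶠ w in 𝓝 q, H w = G w := by
    filter_upwards [χ.eventuallyEq_one] with w hw
    simp [hH, hw]
  filter_upwards [hHG] with w hw
  have hd : ∀ s ∈ Set.uIcc (0 : ℝ) 1, HasDerivAt (fun s => H (γ (s, w)))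
      (w 1 * pd 1 H (γ (s, w))) s := by
    intro s _
    have h1 : HasDerivAt (fun s : ℝ => γ (s, w)) ((1 * w 1) • e) s :=
      ((((hasDerivAt_id s).sub_const 1).mul_const (w 1)).smul_const e).const_add w
    have h2 := (hHs.differentiable (by simp) (γ (s, w))).hasFDerivAt.comp_hasDerivAt s h1
    rw [map_smul, one_mul] at h2
    exact h2
  have hint : IntervalIntegrable (fun s => w 1 * pd 1 H (γ (s, w))) MeasureTheory.volume 0 1 :=
    (continuous_const.mul (hKs.continuous.comp
      (by fun_prop : Continuous fun s : ℝ => (s, w)))).intervalIntegrable _ _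
  have := intervalIntegral.integral_eq_sub_of_hasDerivAt hd hint
  rw [intervalIntegral.integral_const_mul] at this
  rw [this, ← hw, hH0 (γ (0, w)) (by simp [hγ, he])]
  simp [hγ]

/-! ### Functions with proportional differentials -/

lemma contDiffAt_pair {a b : Plane → ℝ} {q : Plane} (ha : ContDiffAt ℝ ∞ a q)
    (hb : ContDiffAt ℝ ∞ b q) : ContDiffAt ℝ ∞ (fun w => (!₂[a w, b w] : Plane)) q := by
  rw [contDiffAt_euclidean]
  intro k
  fin_cases k
  · exact ha
  · exact hb

lemma pd_pair_zero {a b : Plane → ℝ} {q : Plane} (ha : ContDiffAt ℝ ∞ a q)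
    (hb : ContDiffAt ℝ ∞ b q) (i : Fin 2) :
    pd i (fun w => (!₂[a w, b w] : Plane)) q 0 = pd i a q :=
  (pd_plane_apply i (contDiffAt_pair ha hb).diff 0).symm

lemma pd_pair_one {a b : Plane → ℝ} {q : Plane} (ha : ContDiffAt ℝ ∞ a q)
    (hb : ContDiffAt ℝ ∞ b q) (i : Fin 2) :
    pd i (fun w => (!₂[a w, b w] : Plane)) q 1 = pd i b q :=
  (pd_plane_apply i (contDiffAt_pair ha hb).diff 1).symm

lemma jac_pair {a b : Plane → ℝ} {q : Plane} (ha : ContDiffAt ℝ ∞ a q)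
    (hb : ContDiffAt ℝ ∞ b q) :
    jac (fun w => (!₂[a w, b w] : Plane)) q = pd 0 a q * pd 1 b q - pd 0 b q * pd 1 a q := by
  rw [jac, pd_pair_zero ha hb, pd_pair_zero ha hb, pd_pair_one ha hb, pd_pair_one ha hb]

/-- A function without critical points is locally a coordinate. -/
lemma exists_coordinates {g : Plane → ℝ} {V : Set Plane} {q : Plane} (hV : IsOpen V)
    (hg : ∀ w ∈ V, ContDiffAt ℝ ∞ g w) (hq : q ∈ V) {j : Fin 2} (hj : pd j g q ≠ 0) :
    ∃ Θ : OpenPartialHomeomorph Plane Plane, q ∈ Θ.source ∧ Θ.source ⊆ V ∧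
      (∀ w ∈ V, ContDiffAt ℝ ∞ Θ w) ∧ (∀ w, Θ w 1 = g w) ∧ (∀ w ∈ Θ.source, pd j g w ≠ 0) ∧
      ∀ z ∈ Θ.target, ContDiffAt ℝ ∞ Θ.symm z := by
  have hc : ∀ (k : Fin 2) (w : Plane), ContDiffAt ℝ ∞ (fun w : Plane => w k) w := fun k w =>
    (contDiff_coord k).contDiffAt
  have hτ : ∀ w ∈ V, ContDiffAt ℝ ∞ (fun w => (!₂[w (1 - j), g w] : Plane)) w := fun w hw =>
    contDiffAt_pair (hc _ w) (hg w hw)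
  have hjac : ∀ w ∈ V, jac (fun w => (!₂[w (1 - j), g w] : Plane)) w ≠ 0 ↔ pd j g w ≠ 0 := by
    intro w hw
    rw [jac_pair (hc _ w) (hg w hw), pd_coord, pd_coord]
    fin_cases j <;> simp
  obtain ⟨Θ, h1, h2, h3, h4, h5⟩ := exists_localInverse hV hτ hq ((hjac q hq).2 hj)
  have he : (Θ : Plane → Plane) = fun w => (!₂[w (1 - j), g w] : Plane) := funext h3
  refine ⟨Θ, h1, h2, fun w hw => ?_, fun w => ?_, fun w hw => (hjac w (h2 hw)).1 (h4 w hw), h5⟩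
  · rw [he]; exact hτ w hw
  · rw [h3]; simp

lemma eq_of_frequently_eq {Z : Type*} [TopologicalSpace Z] {A B : Z → ℝ} {q : Z}
    (hA : ContinuousAt A q) (hB : ContinuousAt B q) (h : ∃ᶠ w in 𝓝 q, A w = B w) : A q = B q := by
  by_contra hne
  have := (hA.sub hB).eventually_ne (sub_ne_zero.2 hne)
  obtain ⟨w, h1, h2⟩ := (h.and_eventually this).exists
  exact h2 (sub_eq_zero.2 h1)

/-- If `dL` is everywhere a multiple of `dψ` and the Laplacian of `ψ` does not vanish, then the
factor can be chosen smooth. -/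
theorem exists_smooth_ratio {ψ L : Plane → ℝ} {V : Set Plane} {q : Plane} (hV : IsOpen V)
    (hψ : ∀ w ∈ V, ContDiffAt ℝ ∞ ψ w) (hL : ∀ w ∈ V, ContDiffAt ℝ ∞ L w)
    (hp : ∀ w ∈ V, ∃ t : ℝ, ∀ i, pd i L w = t * pd i ψ w) (hq : q ∈ V)
    (hne : pd 0 (pd 0 ψ) q + pd 1 (pd 1 ψ) q ≠ 0) :
    ∃ f : Plane → ℝ, ∀ᶠ w in 𝓝 q, ContDiffAt ℝ ∞ f w ∧ ∀ i, pd i L w = f w * pd i ψ w := by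
  have sψ := fun w hw i => contDiffAt_pd i (hψ w hw)
  have sL := fun w hw i => contDiffAt_pd i (hL w hw)
  by_cases hcrit : pd 0 ψ q ^ 2 + pd 1 ψ q ^ 2 = 0
  swap
  -- Away from critical points the factor is ⟨dL, dψ⟩ / |dψ|².
  · refine ⟨fun w => (pd 0 L w * pd 0 ψ w + pd 1 L w * pd 1 ψ w)
      / (pd 0 ψ w ^ 2 + pd 1 ψ w ^ 2), ?_⟩
    have hc : ContinuousAt (fun w => pd 0 ψ w ^ 2 + pd 1 ψ w ^ 2) q :=
      (((sψ q hq 0).pow 2).add ((sψ q hq 1).pow 2)).continuousAt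
    filter_upwards [hc.eventually_ne hcrit, hV.eventually_mem hq] with w hw hwV
    refine ⟨(((sL w hwV 0).mul (sψ w hwV 0)).add ((sL w hwV 1).mul (sψ w hwV 1))).div
      (((sψ w hwV 0).pow 2).add ((sψ w hwV 1).pow 2)) hw, fun i => ?_⟩
    obtain ⟨t, ht⟩ := hp w hwV
    rw [ht, ht, ht]
    field_simp
  have hcr : ∀ i, pd i ψ q = 0 := by
    intro i
    fin_cases i
    · simp only [Fin.zero_eta]; nlinarith [sq_nonneg (pd 0 ψ q), sq_nonneg (pd 1 ψ q)]
    · simp only [Fin.mk_one]; nlinarith [sq_nonneg (pd 0 ψ q), sq_nonneg (pd 1 ψ q)]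
  -- At a critical point some ψ_jj ≠ 0, so ψ_j serves as a coordinate. As L_j = t ψ_j, the function
  -- L_j vanishes where ψ_j does and is smoothly divisible by it.
  obtain ⟨j, hj⟩ : ∃ j, pd j (pd j ψ) q ≠ 0 := by
    by_contra! hc
    exact hne (by rw [hc, hc, add_zero])
  obtain ⟨Θ, h1, h2, h3, h4, h5, h6⟩ := exists_coordinates hV (fun w hw => sψ w hw j) hq hj
  obtain ⟨K, hK, hKe⟩ := exists_smooth_factor (G := fun z => pd j L (Θ.symm z)) Θ.open_target
    (fun z hz => ContDiffAt.comp z (sL _ (h2 (Θ.map_target hz)) j) (h6 z hz))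
    (fun z hz hz1 => by
      obtain ⟨t, ht⟩ := hp _ (h2 (Θ.map_target hz))
      rw [ht, ← h4, Θ.right_inv hz, hz1, mul_zero]) (Θ.map_source h1)
  have hf : ∀ w ∈ V, ContDiffAt ℝ ∞ (fun w => K (Θ w)) w := fun w hw =>
    hK.contDiffAt.comp w (h3 w hw)
  refine ⟨fun w => K (Θ w), ?_⟩
  rw [Θ.eventually_nhds (fun z => pd j L (Θ.symm z) = z 1 * K z) h1] at hKe
  filter_upwards [hKe.eventually_nhds, Θ.open_source.eventually_mem h1] with w hw hws
  refine ⟨hf w (h2 hws), fun i => ?_⟩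
  -- The zero set of ψ_j has no interior, so the identity for each derivative follows by continuity
  -- from points with ψ_j ≠ 0.
  refine eq_of_frequently_eq (A := pd i L) (B := fun w => K (Θ w) * pd i ψ w)
    (sL w (h2 hws) i).continuousAt ((hf w (h2 hws)).mul (sψ w (h2 hws) i)).continuousAt ?_
  have hfr : ∃ᶠ w' in 𝓝 w, pd j ψ w' ≠ 0 := by
    intro hn
    have : pd j ψ =ᶠ[𝓝 w] fun _ => 0 := by
      filter_upwards [hn] with w' hw'
      exact not_not.1 hw'
    exact h5 w hws (by rw [pd_eventuallyEq j this, pd_const])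
  refine (hfr.and_eventually (hw.and (Θ.open_source.eventually_mem hws))).mono ?_
  rintro w' ⟨a1, a2, a3⟩
  rw [Θ.left_inv a3, h4] at a2
  obtain ⟨t, ht⟩ := hp w' (h2 a3)
  rw [ht, mul_comm] at a2
  rw [ht, mul_left_cancel₀ a1 a2]

lemma isOpen_image_coord {B : Set Plane} (hB : IsOpen B) (k : Fin 2) :
    IsOpen ((fun z : Plane => z k) '' B) := by
  have hs : Function.Surjective (EuclideanSpace.proj k : Plane →L[ℝ] ℝ) := fun s =>
    ⟨EuclideanSpace.single k s, by simp⟩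
  exact ContinuousLinearMap.isOpenMap _ hs B hB

/-- If `dL = f dψ` and `dψ ≠ 0`, then locally `L` is a function of `ψ`. -/
theorem exists_function_of {ψ L f : Plane → ℝ} {V : Set Plane} {q : Plane} (hV : IsOpen V)
    (hψ : ∀ w ∈ V, ContDiffAt ℝ ∞ ψ w) (hL : ∀ w ∈ V, ContDiffAt ℝ ∞ L w)
    (hp : ∀ w ∈ V, ∀ i, pd i L w = f w * pd i ψ w) (hq : q ∈ V) {j : Fin 2}
    (hj : pd j ψ q ≠ 0) :
    ∃ (F : ℝ → ℝ) (Ω : Set Plane), IsOpen Ω ∧ q ∈ Ω ∧ Ω ⊆ V ∧ IsOpen (ψ '' Ω) ∧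
      (∀ w ∈ Ω, L w = F (ψ w)) ∧ ∀ w ∈ Ω, HasDerivAt F (f w) (ψ w) := by
  obtain ⟨Θ, h1, h2, -, h4, -, h6⟩ := exists_coordinates hV hψ hq hj
  obtain ⟨r, hr, hb⟩ := Metric.isOpen_iff.1 Θ.open_target _ (Θ.map_source h1)
  set B := Metric.ball (Θ q) r with hB
  set e : Fin 2 → Plane := fun i => EuclideanSpace.single i 1 with he
  have hLd : ∀ z ∈ B, DifferentiableAt ℝ (fun z => L (Θ.symm z)) z := fun z hz =>
    (hL _ (h2 (Θ.map_target (hb hz)))).diff.comp z (h6 z (hb hz)).diff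
  have hpd : ∀ z ∈ B, ∀ i, pd i (fun z => L (Θ.symm z)) z
      = if i = 1 then f (Θ.symm z) else 0 := by
    intro z hz i
    have hV' := h2 (Θ.map_target (hb hz))
    have e1 := pd_comp i (hL _ hV').diff (h6 z (hb hz)).diff
    have e2 := pd_comp i (hψ _ hV').diff (h6 z (hb hz)).diff
    have e3 : pd i (fun z => ψ (Θ.symm z)) z = if i = 1 then 1 else 0 := by
      rw [pd_congr i Θ.open_target (G := fun z => z 1)
        (fun z hz => by rw [← h4, Θ.right_inv hz]) (hb hz), pd_coord]
    rw [e3] at e2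
    rw [e1, hp _ hV', hp _ hV']
    simp only [smul_eq_mul] at e2 ⊢
    have : pd i (⇑Θ.symm) z 0 * (f (Θ.symm z) * pd 0 ψ (Θ.symm z))
        + pd i (⇑Θ.symm) z 1 * (f (Θ.symm z) * pd 1 ψ (Θ.symm z))
        = f (Θ.symm z) * (pd i (⇑Θ.symm) z 0 * pd 0 ψ (Θ.symm z)
          + pd i (⇑Θ.symm) z 1 * pd 1 ψ (Θ.symm z)) := by ring
    rw [this, ← e2]
    split_ifs <;> simp
  have hline : ∀ (z : Plane) (i : Fin 2) (t : ℝ), z + t • e i ∈ B →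
      HasDerivAt (fun t : ℝ => L (Θ.symm (z + t • e i)))
        (if i = 1 then f (Θ.symm (z + t • e i)) else 0) t := by
    intro z i t hz
    have a : HasDerivAt (fun t : ℝ => z + t • e i) ((1 : ℝ) • e i) t :=
      ((hasDerivAt_id t).smul_const (e i)).const_add z
    have b := (hLd _ hz).hasFDerivAt.comp_hasDerivAt t a
    rw [one_smul] at b
    rw [← hpd _ hz i]
    exact b
  -- In the coordinates of Θ the function L depends on the second coordinate, which is ψ, alone. F
  -- is its restriction to the vertical line through Θ q.
  set F : ℝ → ℝ := fun s => L (Θ.symm (Θ q + (s - Θ q 1) • e 1)) with hF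
  have hFL : ∀ z ∈ B, L (Θ.symm z) = F (z 1) := by
    intro z hz
    have hz' : z + (Θ q 0 - z 0) • e 0 = Θ q + (z 1 - Θ q 1) • e 1 := by
      ext k; fin_cases k <;> simp [he]
    -- The horizontal projection of z to this line is no further from the centre than z. By
    -- convexity the segment joining them stays in B.
    have hmem : Θ q + (z 1 - Θ q 1) • e 1 ∈ B := by
      rw [hB, Metric.mem_ball, dist_eq_norm] at hz ⊢
      rw [add_sub_cancel_left, norm_smul, he, PiLp.norm_single, norm_one, mul_one]
      refine lt_of_le_of_lt ?_ hz
      have := EuclideanSpace.norm_eq (z - Θ q)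
      rw [this]
      apply Real.le_sqrt_of_sq_le
      simp
      positivity
    have hseg : ∀ t ∈ Set.Icc (0 : ℝ) 1, z + (t * (Θ q 0 - z 0)) • e 0 ∈ B := by
      intro t ht
      have := (convex_ball (Θ q) r).add_smul_sub_mem hz hmem ht
      rw [← hz', add_sub_cancel_left, smul_smul] at this
      exact this
    have hd : ∀ t ∈ Set.Icc (0 : ℝ) 1,
        HasDerivAt (fun t : ℝ => L (Θ.symm (z + (t * (Θ q 0 - z 0)) • e 0))) 0 t := by
      intro t ht
      have a := hline z 0 _ (hseg t ht)
      have b := a.comp t ((hasDerivAt_id t).mul_const (Θ q 0 - z 0))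
      rw [if_neg (by decide), zero_mul] at b
      exact b
    have hc := constant_of_has_deriv_right_zero
      (fun t ht => (hd t ht).continuousAt.continuousWithinAt)
      (fun t ht => (hd t ⟨ht.1, ht.2.le⟩).hasDerivWithinAt) 1 (by simp)
    simp only [one_mul, zero_mul, zero_smul, add_zero, hz'] at hc
    rw [← hc]
  have hBo : IsOpen B := Metric.isOpen_ball
  have hqB : Θ q ∈ B := Metric.mem_ball_self hr
  clear_value F B
  refine ⟨F, Θ.source ∩ Θ ⁻¹' B, Θ.isOpen_inter_preimage hBo, ⟨h1, hqB⟩, fun w hw => h2 hw.1,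
    ?_, ?_, ?_⟩
  · have : ψ '' (Θ.source ∩ Θ ⁻¹' B) = (fun z : Plane => z 1) '' B := by
      ext s
      constructor
      · rintro ⟨w, hw, rfl⟩
        exact ⟨Θ w, hw.2, h4 w⟩
      · rintro ⟨z, hz, rfl⟩
        refine ⟨Θ.symm z, ⟨Θ.map_target (hb hz), ?_⟩, ?_⟩
        · rw [Set.mem_preimage, Θ.right_inv (hb hz)]; exact hz
        · rw [← h4, Θ.right_inv (hb hz)]
    rw [this]
    exact isOpen_image_coord hBo 1
  · intro w hw
    have := hFL _ hw.2
    rwa [Θ.left_inv hw.1, h4] at this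
  · intro w hw
    have a := hline (Θ w) 1 0 (by rw [zero_smul, add_zero]; exact hw.2)
    simp only [zero_smul, add_zero, Θ.left_inv hw.1, if_true] at a
    have b : HasDerivAt (fun s => s - ψ w) 1 (ψ w) := (hasDerivAt_id _).sub_const _
    have c := a.comp_of_eq (ψ w) b (sub_self _).symm
    rw [mul_one] at c
    refine c.congr_of_eventuallyEq ?_
    have hcont : ContinuousAt (fun s : ℝ => Θ w + (s - ψ w) • e 1) (ψ w) := by fun_prop
    have hm : ∀ᶠ s in 𝓝 (ψ w), Θ w + (s - ψ w) • e 1 ∈ B :=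
      hcont.eventually_mem (hBo.mem_nhds (by
        rw [sub_self, zero_smul, add_zero]; exact hw.2))
    filter_upwards [hm] with s hs
    have := hFL _ hs
    change F s = L (Θ.symm (Θ w + (s - ψ w) • e 1))
    rw [this]
    congr 1
    simp [he, h4]

/-! ### Graph surfaces in a light-like direction -/

/-- A light-cone frame. -/
structure IsLightFrame (a b ξ η : E41) : Prop extends IsFrame a b ξ η where
  aa : form a a = 1
  bb : form b b = 1
  ab : form a b = 0
  ηη : form η η = 0

namespace IsLightFrame

variable {a b ξ η : E41}

lemma expand_eq (h : IsLightFrame a b ξ η) (v : E41) :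
    v = form v a • a + form v b • b - form v η • ξ - form v ξ • η := by
  have e := h.toIsFrame.expand h.ηη v
  rw [h.aa, h.bb, h.ab, form_comm a v, form_comm b v] at e
  simpa using e

/-- The coordinates `(u, v)` with respect to the frame with origin `y`. -/
noncomputable def _root_.MinkSurf.frameCoord (a b y v : E41) : Plane :=
  !₂[form (v - y) a, form (v - y) b]

end IsLightFrame

/-- `X` is the graph of `Φ` over the plane spanned by `a` and `b`, in the direction `ξ`. -/
structure IsGraphPatch (X : Plane → E41) (Φ : Plane → ℝ) (a b ξ y : E41) (V : Set Plane) :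
    Prop where
  isOpen : IsOpen V
  smooth : ∀ w ∈ V, ContDiffAt ℝ ∞ Φ w
  eq : ∀ w ∈ V, X w = y + w 0 • a + w 1 • b + Φ w • ξ

lemma flatLaplace_comm {Φ : Plane → ℝ} {V : Set Plane} {q : Plane} (hV : IsOpen V)
    (hs : ∀ w ∈ V, ContDiffAt ℝ ∞ Φ w) (hq : q ∈ V) (i : Fin 2) :
    pd i (flatLaplace Φ) q = flatLaplace (pd i Φ) q := by
  have hΦ := hs q hq
  have s : ∀ j, ContDiffAt ℝ ∞ (pd j (pd j Φ)) q := fun j => contDiffAt_pd j (contDiffAt_pd j hΦ)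
  have c : ∀ j, pd i (pd j (pd j Φ)) q = pd j (pd j (pd i Φ)) q := by
    intro j
    rw [pd_comm i j (contDiffAt_pd j hΦ)]
    exact pd_congr j hV (fun w hw => pd_comm i j (hs w hw)) hq
  have e : flatLaplace Φ = fun w => -(pd 0 (pd 0 Φ) w) - pd 1 (pd 1 Φ) w := rfl
  rw [e, pd_sub i (s 0).neg.diff (s 1).diff, pd_neg, c, c, flatLaplace]

lemma laplaceCoord_of_metric_eq_one {W : Type*} [NormedAddCommGroup W] [NormedSpace ℝ W]
    {X : Plane → E41} {G : Plane → W} {q : Plane} (h : ∀ᶠ w in 𝓝 q, metric X w = 1) :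
    laplaceCoord X G q = -(pd 0 (pd 0 G) q) - pd 1 (pd 1 G) q := by
  have hm : metric X q = 1 := h.self_of_nhds
  have hp : ∀ a b c, pd a (fun w => metric X w b c) q = 0 := fun a b c => by
    rw [pd_eventuallyEq a (h.mono fun w hw => by beta_reduce; rw [hw] :
      (fun w => metric X w b c) =ᶠ[𝓝 q] fun _ => (1 : Matrix (Fin 2) (Fin 2) ℝ) b c), pd_const]
  have hΓ : ∀ k i j, christoffel X k i j q = 0 := fun k i j => by
    simp only [christoffel, hp]; simp
  simp only [laplaceCoord, hm, hΓ, Fin.sum_univ_two, inv_one]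
  simp
  abel

namespace IsGraphPatch

variable {X : Plane → E41} {Φ : Plane → ℝ} {a b ξ η y : E41} {V : Set Plane} {q : Plane}

lemma smooth_X (h : IsGraphPatch X Φ a b ξ y V) (hq : q ∈ V) : ContDiffAt ℝ ∞ X q := by
  have hc : ∀ k : Fin 2, ContDiffAt ℝ ∞ (fun w : Plane => w k) q := fun k =>
    (contDiff_coord k).contDiffAt
  exact (((contDiffAt_const.add ((hc 0).smul contDiffAt_const)).add
    ((hc 1).smul contDiffAt_const)).add ((h.smooth q hq).smul contDiffAt_const)).congr_of_eventuallyEq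
    (Filter.eventuallyEq_of_mem (h.isOpen.mem_nhds hq) h.eq)

lemma pd_X (h : IsGraphPatch X Φ a b ξ y V) (hq : q ∈ V) (i : Fin 2) :
    pd i X q = (if i = 0 then a else b) + pd i Φ q • ξ := by
  have hc : ∀ k : Fin 2, DifferentiableAt ℝ (fun w : Plane => w k) q := fun k =>
    ((contDiff_coord k).contDiffAt (x := q)).diff
  have d0 := (hc 0).fun_smul (differentiableAt_const a)
  have d1 := (hc 1).fun_smul (differentiableAt_const b)
  have d2 := (h.smooth q hq).diff.fun_smul (differentiableAt_const ξ)
  rw [pd_congr i h.isOpen h.eq hq,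
    pd_add i (((differentiableAt_const y).fun_add d0).fun_add d1) d2,
    pd_add i ((differentiableAt_const y).fun_add d0) d1, pd_add i (differentiableAt_const y) d0,
    pd_smul i (hc 0) (differentiableAt_const a), pd_smul i (hc 1) (differentiableAt_const b),
    pd_smul i (h.smooth q hq).diff (differentiableAt_const ξ), pd_coord, pd_coord]
  simp only [pd_const]
  fin_cases i <;> simp

lemma metric_eq_one (h : IsGraphPatch X Φ a b ξ y V) (fr : IsLightFrame a b ξ η) (hq : q ∈ V) :
    metric X q = 1 := by
  ext i j
  rw [metric_apply, h.pd_X hq, h.pd_X hq]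
  have e1 := form_comm ξ a
  have e2 := form_comm ξ b
  rw [fr.aξ] at e1
  rw [fr.bξ] at e2
  have e3 := form_comm b a
  rw [fr.ab] at e3
  fin_cases i <;> fin_cases j <;>
    simp [form_add_left, form_add_right, form_smul_left, form_smul_right, fr.aa, fr.bb, fr.ab,
      fr.aξ, fr.bξ, fr.ξξ, e1, e2, e3]

lemma gramDet_eq_one (h : IsGraphPatch X Φ a b ξ y V) (fr : IsLightFrame a b ξ η) (hq : q ∈ V) :
    gramDet X q = 1 := by
  rw [← det_metric, h.metric_eq_one fr hq, Matrix.det_one]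

lemma laplaceCoord_eq (h : IsGraphPatch X Φ a b ξ y V) (fr : IsLightFrame a b ξ η) (hq : q ∈ V)
    {W : Type*} [NormedAddCommGroup W] [NormedSpace ℝ W] (G : Plane → W) :
    laplaceCoord X G q = -(pd 0 (pd 0 G) q) - pd 1 (pd 1 G) q :=
  laplaceCoord_of_metric_eq_one ((h.isOpen.eventually_mem hq).mono fun _ hw =>
    h.metric_eq_one fr hw)

lemma laplaceCoord_X (h : IsGraphPatch X Φ a b ξ y V) (fr : IsLightFrame a b ξ η) (hq : q ∈ V) :
    laplaceCoord X X q = flatLaplace Φ q • ξ := by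
  have e : ∀ i, pd i (pd i X) q = pd i (pd i Φ) q • ξ := by
    intro i
    have s := (contDiffAt_pd i (h.smooth q hq)).diff
    rw [pd_congr i h.isOpen (fun w hw => h.pd_X hw i) hq,
      pd_add i (differentiableAt_const _) (s.fun_smul (differentiableAt_const ξ)), pd_const,
      pd_smul i s (differentiableAt_const ξ), pd_const]
    simp
  rw [h.laplaceCoord_eq fr hq, e, e, flatLaplace, sub_smul, neg_smul]

/-- The wedge product of the coordinate fields. -/
lemma wedge_pd (h : IsGraphPatch X Φ a b ξ y V) (hq : q ∈ V) :
    wedge (pd 0 X q) (pd 1 X q)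
      = wedge a b + pd 0 Φ q • wedge ξ b - pd 1 Φ q • wedge ξ a := by
  rw [h.pd_X hq, h.pd_X hq, if_pos rfl, if_neg (by decide)]
  simp only [wedge_add_left, wedge_add_right, wedge_smul_left, wedge_smul_right, wedge_self,
    wedge_anti a ξ]
  simp
  abel

/-- The metric is Euclidean, so the Laplacian acts on the coefficients of constant bivectors and
commutes with ∂ᵢ. -/
lemma laplaceCoord_wedge (h : IsGraphPatch X Φ a b ξ y V) (fr : IsLightFrame a b ξ η)
    (hq : q ∈ V) {N : Plane → Bivector} {ε : ℝ}
    (hN : ∀ w ∈ V, N w = ε • (wedge a b + pd 0 Φ w • wedge ξ b - pd 1 Φ w • wedge ξ a)) :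
    laplaceCoord X N q = ε • (pd 0 (flatLaplace Φ) q • wedge ξ b
      - pd 1 (flatLaplace Φ) q • wedge ξ a) := by
  have sΦ := fun w hw i => contDiffAt_pd i (h.smooth w hw)
  have e1 : ∀ w ∈ V, ∀ i, pd i N w
      = ε • (pd i (pd 0 Φ) w • wedge ξ b - pd i (pd 1 Φ) w • wedge ξ a) := by
    intro w hw i
    have d0 := (sΦ w hw 0).diff.fun_smul (differentiableAt_const (wedge ξ b))
    have d1 := (sΦ w hw 1).diff.fun_smul (differentiableAt_const (wedge ξ a))
    rw [pd_congr i h.isOpen hN hw, pd_smul i (differentiableAt_const ε)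
      (((differentiableAt_const (wedge a b)).fun_add d0).fun_sub d1),
      pd_sub i ((differentiableAt_const (wedge a b)).fun_add d0) d1,
      pd_add i (differentiableAt_const (wedge a b)) d0,
      pd_smul i (sΦ w hw 0).diff (differentiableAt_const _),
      pd_smul i (sΦ w hw 1).diff (differentiableAt_const _)]
    simp only [pd_const]
    simp
  have e2 : ∀ i, pd i (pd i N) q
      = ε • (pd i (pd i (pd 0 Φ)) q • wedge ξ b - pd i (pd i (pd 1 Φ)) q • wedge ξ a) := by
    intro i
    have s0 := (contDiffAt_pd i (sΦ q hq 0)).diff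
    have s1 := (contDiffAt_pd i (sΦ q hq 1)).diff
    have d0 := s0.fun_smul (differentiableAt_const (wedge ξ b))
    have d1 := s1.fun_smul (differentiableAt_const (wedge ξ a))
    rw [pd_congr i h.isOpen (fun w hw => e1 w hw i) hq, pd_smul i (differentiableAt_const ε)
      (d0.fun_sub d1), pd_sub i d0 d1, pd_smul i s0 (differentiableAt_const _),
      pd_smul i s1 (differentiableAt_const _)]
    simp only [pd_const]
    simp
  rw [h.laplaceCoord_eq fr hq, e2, e2, flatLaplace_comm h.isOpen h.smooth hq,
    flatLaplace_comm h.isOpen h.smooth hq, flatLaplace, flatLaplace]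
  module

end IsGraphPatch

/-! ### Graph charts of surfaces in a null hyperplane -/

section GraphChart

variable {M : Type*} [TopologicalSpace M] [ChartedSpace Plane M] {a b ξ η y : E41}
  {x : M → E41} {ν : M → Bivector} {k : OpenPartialHomeomorph M Plane}

/-- The coordinates of the surface over the plane of `a` and `b` are a chart, in which the surface
is a graph. -/
structure IsGraphChart (x : M → E41) (a b ξ η y : E41) (k : OpenPartialHomeomorph M Plane) :
    Prop where
  coe : ∀ p ∈ k.source, k p = frameCoord a b y (x p)
  smooth_symm : ∀ w ∈ k.target, ContMDiffAt (𝓡 2) (𝓡 2) ∞ k.symm w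
  patch : IsGraphPatch (fun w => x (k.symm w)) (fun w => -form (x (k.symm w) - y) η) a b ξ y k.target

lemma IsGraphChart.smooth (h : IsGraphChart x a b ξ η y k) (hx : IsSpacelikeSurface x) {p : M}
    (hp : p ∈ k.source) : ContMDiffAt (𝓡 2) (𝓡 2) ∞ k p := by
  have e : ∀ c, ContMDiffAt (𝓡 2) 𝓘(ℝ, ℝ) ∞ (fun p => form (x p - y) c) p := fun c => by
    have h1 : ContMDiffAt (𝓡 2) 𝓘(ℝ, E41) ∞ (fun p => x p - y) p := (hx.1 p).sub contMDiffAt_const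
    exact (formL.flip c).contDiff.contMDiff.contMDiffAt.comp p h1
  have hpair : ContDiff ℝ ∞ (fun z : ℝ × ℝ => (!₂[z.1, z.2] : Plane)) := by
    rw [contDiff_euclidean]
    intro i
    fin_cases i
    · exact contDiff_fst
    · exact contDiff_snd
  have h3 := hpair.contMDiff.contMDiffAt.comp p ((e a).prodMk_space (e b))
  refine h3.congr_of_eventuallyEq ?_
  filter_upwards [k.open_source.mem_nhds hp] with p' hp'
  exact h.coe p' hp'

variable [IsManifold (𝓡 2) ∞ M]

/-- Tangent vectors are orthogonal to the null vector ξ, so the metric sees only their a- and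
b-components. Its determinant is the squared Jacobian of (u, v), and it is positive. -/
theorem exists_isGraphChart (hx : IsSpacelikeSurface x) (fr : IsLightFrame a b ξ η)
    (hξ : ∀ p, form (x p - y) ξ = 0) (p₀ : M) :
    ∃ k : OpenPartialHomeomorph M Plane, p₀ ∈ k.source ∧ IsGraphChart x a b ξ η y k := by
  set e := chartAt Plane p₀ with he
  set X := inChart p₀ x with hX
  have sX : ∀ q ∈ e.target, ContDiffAt ℝ ∞ X q := fun q hq => contDiffAt_inChart p₀ hq (hx.1 _)
  have sXy : ∀ q ∈ e.target, ContDiffAt ℝ ∞ (fun q => X q - y) q := fun q hq =>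
    (sX q hq).sub contDiffAt_const
  have sF : ∀ c, ∀ q ∈ e.target, ContDiffAt ℝ ∞ (fun q => form (X q - y) c) q := fun c q hq =>
    contDiffAt_form (sXy q hq) contDiffAt_const
  have pF : ∀ c, ∀ q ∈ e.target, ∀ i, pd i (fun q => form (X q - y) c) q = form (pd i X q) c := by
    intro c q hq i
    rw [pd_form i (sXy q hq).diff (differentiableAt_const c),
      pd_sub i (sX q hq).diff (differentiableAt_const y), pd_const, pd_const, form_zero_right]
    simp
  set τ : Plane → Plane := fun q => frameCoord a b y (X q) with hτ
  have sτ : ∀ q ∈ e.target, ContDiffAt ℝ ∞ τ q := fun q hq =>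
    contDiffAt_pair (sF a q hq) (sF b q hq)
  have hjac : ∀ q ∈ e.target, jac τ q ≠ 0 := by
    intro q hq h0
    have hj : jac τ q = form (pd 0 X q) a * form (pd 1 X q) b
        - form (pd 0 X q) b * form (pd 1 X q) a := by
      have := jac_pair (sF a q hq) (sF b q hq)
      rw [pF a q hq, pF a q hq, pF b q hq, pF b q hq] at this
      exact this
    have hξ' : ∀ i, form (pd i X q) ξ = 0 := fun i => by
      rw [← pF ξ q hq i, pd_congr i e.open_target (F := fun q => form (X q - y) ξ) (G := fun _ => 0)
        (fun w _ => hξ _) hq, pd_const]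
    have ex : ∀ i, pd i X q = form (pd i X q) a • a + form (pd i X q) b • b
        - form (pd i X q) η • ξ := fun i => by
      conv_lhs => rw [fr.expand_eq (pd i X q), hξ', zero_smul, sub_zero]
    have hg : ∀ i j, form (pd i X q) (pd j X q)
        = form (pd i X q) a * form (pd j X q) a + form (pd i X q) b * form (pd j X q) b := by
      intro i j
      conv_lhs => rw [ex j]
      rw [form_sub_right, form_add_right, form_smul_right, form_smul_right, form_smul_right, hξ']
      ring
    have hpos := gramDet_inChart_pos hx p₀ hq
    rw [gramDet, ← hX, hg, hg, hg] at hpos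
    rw [hj] at h0
    nlinarith [hpos]
  have hmem : e p₀ ∈ e.target := chart_mem_target p₀
  obtain ⟨Θ, h1, h2, h3, -, h5⟩ := exists_localInverse e.open_target sτ hmem (hjac _ hmem)
  set k : OpenPartialHomeomorph M Plane := e.trans Θ with hk
  have hcoe : ∀ p ∈ k.source, k p = frameCoord a b y (x p) := by
    intro p hp
    rw [hk, OpenPartialHomeomorph.trans_source] at hp
    change Θ (e p) = _
    rw [h3, hτ]
    change frameCoord a b y (x (e.symm (e p))) = _
    rw [e.left_inv hp.1]
  have hsm : ∀ w ∈ k.target, ContMDiffAt (𝓡 2) (𝓡 2) ∞ k.symm w := by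
    intro w hw
    rw [hk, OpenPartialHomeomorph.trans_target] at hw
    exact ContMDiffAt.comp (I' := 𝓡 2) (g := e.symm) (f := Θ.symm) w (contMDiffAt_chart_symm p₀ hw.2)
      (h5 w hw.1).contMDiffAt
  refine ⟨k, ?_, hcoe, hsm, k.open_target, fun w hw => ?_, fun w hw => ?_⟩
  · rw [hk, OpenPartialHomeomorph.trans_source]
    exact ⟨mem_chart_source Plane p₀, h1⟩
  · exact (contDiffAt_form ((contDiffAt_comp_param (hx.1 _) (hsm w hw)).sub contDiffAt_const)
      contDiffAt_const).neg
  · have h := hcoe _ (k.map_target hw)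
    rw [k.right_inv hw] at h
    have w0 : w 0 = form (x (k.symm w) - y) a := by
      conv_lhs => rw [h]
      rfl
    have w1 : w 1 = form (x (k.symm w) - y) b := by
      conv_lhs => rw [h]
      rfl
    have ex := fr.expand_eq (x (k.symm w) - y)
    rw [hξ, ← w0, ← w1, zero_smul, sub_zero] at ex
    rw [neg_smul, add_assoc y, add_assoc y, ← sub_eq_add_neg, ← ex]
    abel

namespace IsGraphChart

lemma laplace_eq (h : IsGraphChart x a b ξ η y k) (hx : IsSpacelikeSurface x)
    (fr : IsLightFrame a b ξ η) {W : Type*} [NormedAddCommGroup W] [NormedSpace ℝ W] {G : M → W}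
    {w : Plane} (hw : w ∈ k.target) (hG : ContMDiffAt (𝓡 2) 𝓘(ℝ, W) ∞ G (k.symm w)) :
    laplace x G (k.symm w) = laplaceCoord (fun w => x (k.symm w)) (fun w => G (k.symm w)) w := by
  refine laplace_param (hx.1 _) hG (h.smooth_symm w hw) ?_
  rw [h.patch.gramDet_eq_one fr hw]
  exact one_ne_zero

/-- The Gauss map in a graph chart. -/
lemma gaussMap_eq (h : IsGraphChart x a b ξ η y k) (hx : IsSpacelikeSurface x)
    (hν : IsGaussMap x ν) (fr : IsLightFrame a b ξ η) {w : Plane} (hw : w ∈ k.target) :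
    bform (ν (k.symm w)) (wedge a b) ^ 2 = 1 ∧
    ν (k.symm w) = bform (ν (k.symm w)) (wedge a b) • (wedge a b
      + pd 0 (fun w => -form (x (k.symm w) - y) η) w • wedge ξ b
      - pd 1 (fun w => -form (x (k.symm w) - y) η) w • wedge ξ a) := by
  set p := k.symm w with hp
  have hps : p ∈ k.source := k.map_target hw
  set e := chartAt Plane p with he
  have ht : e p ∈ e.target := chart_mem_target p
  set τ : Plane → Plane := fun q => k (e.symm q) with hτ
  have hτp : τ (e p) = w := by
    rw [hτ]; beta_reduce
    rw [e.left_inv (mem_chart_source Plane p), hp, k.right_inv hw]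
  have sτ : ContDiffAt ℝ ∞ τ (e p) := by
    refine (ContMDiffAt.comp (e p) ?_ (contMDiffAt_chart_symm p ht)).contDiffAt
    rw [e.left_inv (mem_chart_source Plane p)]
    exact h.smooth hx hps
  have hN := isGaussPatch_inChart hx hν p
  have hev : inChart p x =ᶠ[𝓝 (e p)] fun q => (fun w => x (k.symm w)) (τ q) := by
    have : ∀ᶠ q in 𝓝 (e p), e.symm q ∈ k.source := by
      rw [e.eventually_nhds' _ (mem_chart_source Plane p)]
      exact k.open_source.eventually_mem hps
    filter_upwards [this] with q hq
    simp only [hτ, k.left_inv hq]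
    rfl
  have dX : DifferentiableAt ℝ (fun w => x (k.symm w)) (τ (e p)) := by
    rw [hτp]; exact (h.patch.smooth_X hw).diff
  have e1 : ∀ i, pd i (inChart p x) (e p) = pd i τ (e p) 0 • pd 0 (fun w => x (k.symm w)) w
      + pd i τ (e p) 1 • pd 1 (fun w => x (k.symm w)) w := fun i => by
    rw [pd_eventuallyEq i hev, pd_comp i dX sτ.diff, hτp]
  have e2 : gramDet (inChart p x) (e p) = jac τ (e p) ^ 2 := by
    rw [gramDet, pd_eventuallyEq 0 hev, pd_eventuallyEq 1 hev]
    have := gramDet_comp dX sτ.diff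
    rw [hτp, h.patch.gramDet_eq_one fr hw, mul_one] at this
    exact this
  have e3 := hN.eq_wedge _ ht
  have e4 := hN.mu_sq _ ht
  rw [e2] at e4
  rw [inChart_apply_self, e1, e1] at e3
  set μ := gaussCoeff (inChart p x) (inChart p ν) (e p)
  -- The sign is μ times the Jacobian of the transition to the graph chart; its square is 1 because
  -- the metric is Euclidean in the graph chart.
  have e5 : ν p = (μ * jac τ (e p)) • (wedge a b
      + pd 0 (fun w => -form (x (k.symm w) - y) η) w • wedge ξ b
      - pd 1 (fun w => -form (x (k.symm w) - y) η) w • wedge ξ a) := by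
    rw [e3, ← h.patch.wedge_pd hw, mul_smul]
    congr 1
    simp only [wedge_add_left, wedge_add_right, wedge_smul_left, wedge_smul_right, wedge_self, jac,
      wedge_anti (pd 1 (fun w => x (k.symm w)) w) (pd 0 (fun w => x (k.symm w)) w)]
    module
  have e6 : bform (ν p) (wedge a b) = μ * jac τ (e p) := by
    rw [e5]
    simp only [bform_add_left, bform_sub_left, bform_smul_left, bform_wedge, form_comm ξ a,
      form_comm ξ b, fr.aa, fr.bb, fr.ab, fr.aξ, fr.bξ]
    ring
  rw [e6]
  exact ⟨by rw [mul_pow]; exact e4, e5⟩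

end IsGraphChart

/-- The sign of the Gauss map with respect to the frame is constant. -/
lemma exists_sign [ConnectedSpace M] (hx : IsSpacelikeSurface x) (hν : IsGaussMap x ν)
    (fr : IsLightFrame a b ξ η) (hξ : ∀ p, form (x p - y) ξ = 0) :
    ∃ ε : ℝ, ε ^ 2 = 1 ∧ ∀ p, bform (ν p) (wedge a b) = ε := by
  have hsq : ∀ p, bform (ν p) (wedge a b) ^ 2 = 1 := fun p => by
    obtain ⟨k, hp, hk⟩ := exists_isGraphChart hx fr hξ p
    have := (hk.gaussMap_eq hx hν fr (k.map_source hp)).1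
    rwa [k.left_inv hp] at this
  obtain ⟨p₀⟩ : Nonempty M := inferInstance
  refine ⟨_, hsq p₀, fun p => ?_⟩
  have hc : Continuous fun p => bform (ν p) (wedge a b) :=
    (bformL.continuous.comp hν.1).clm_apply continuous_const
  by_contra hne
  have hs : ∀ p, bform (ν p) (wedge a b) = 1 ∨ bform (ν p) (wedge a b) = -1 := fun p =>
    sq_eq_one_iff.1 (hsq p)
  have hpre := isPreconnected_range hc
  have h0 : (0 : ℝ) ∈ Set.range fun p => bform (ν p) (wedge a b) := by
    rcases hs p with h1 | h1 <;> rcases hs p₀ with h2 | h2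
    · exact absurd (h1.trans h2.symm) hne
    · exact hpre.ordConnected.out ⟨p₀, h2⟩ ⟨p, h1⟩ ⟨by norm_num, by norm_num⟩
    · exact hpre.ordConnected.out ⟨p, h1⟩ ⟨p₀, h2⟩ ⟨by norm_num, by norm_num⟩
    · exact absurd (h1.trans h2.symm) hne
  obtain ⟨p', hp'⟩ := h0
  have := hsq p'
  simp only at hp'
  rw [hp'] at this
  norm_num at this

end GraphChart

/-! ### The potential ψ of a graph and the relation d(Δψ) = t dψ -/

section Potential

variable {M : Type*} [TopologicalSpace M] [ChartedSpace Plane M] {a b ξ η y : E41}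
  {x : M → E41} {ν : M → Bivector} {k : OpenPartialHomeomorph M Plane} {c₁ c₂ : ℝ}

/-- The height of the graph, up to an affine function. -/
noncomputable def graphPotential (x : M → E41) (η y : E41) (k : OpenPartialHomeomorph M Plane)
    (c₁ c₂ : ℝ) (w : Plane) : ℝ :=
  -form (x (k.symm w) - y) η - c₁ * w 0 - c₂ * w 1

namespace IsGraphChart

lemma contDiffAt_potential (h : IsGraphChart x a b ξ η y k) {w : Plane} (hw : w ∈ k.target) :
    ContDiffAt ℝ ∞ (graphPotential x η y k c₁ c₂) w :=
  ((h.patch.smooth w hw).sub (contDiffAt_const.mul (contDiff_coord 0).contDiffAt)).sub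
    (contDiffAt_const.mul (contDiff_coord 1).contDiffAt)

lemma pd_potential (h : IsGraphChart x a b ξ η y k) {w : Plane} (hw : w ∈ k.target) (i : Fin 2) :
    pd i (graphPotential x η y k c₁ c₂) w
      = pd i (fun w => -form (x (k.symm w) - y) η) w - if i = 0 then c₁ else c₂ := by
  have hc : ∀ j : Fin 2, DifferentiableAt ℝ (fun w : Plane => w j) w := fun j =>
    ((contDiff_coord j).contDiffAt (x := w)).diff
  have d := (h.patch.smooth w hw).diff
  have d0 := (differentiableAt_const c₁).fun_mul (hc 0)
  have d1 := (differentiableAt_const c₂).fun_mul (hc 1)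
  have e : graphPotential x η y k c₁ c₂
    = fun w => -form (x (k.symm w) - y) η - c₁ * w 0 - c₂ * w 1 := rfl
  rw [e, pd_sub i (d.fun_sub d0) d1, pd_sub i d d0, pd_mul i (differentiableAt_const c₁) (hc 0),
    pd_mul i (differentiableAt_const c₂) (hc 1), pd_coord, pd_coord, pd_const, pd_const]
  fin_cases i <;> simp

lemma flatLaplace_potential (h : IsGraphChart x a b ξ η y k) {w : Plane} (hw : w ∈ k.target) :
    flatLaplace (graphPotential x η y k c₁ c₂) w
      = flatLaplace (fun w => -form (x (k.symm w) - y) η) w := by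
  have e : ∀ i, pd i (pd i (graphPotential x η y k c₁ c₂)) w
      = pd i (pd i (fun w => -form (x (k.symm w) - y) η)) w := by
    intro i
    rw [pd_congr i h.patch.isOpen (fun w hw => h.pd_potential hw i) hw,
      pd_sub i (contDiffAt_pd i (h.patch.smooth w hw)).diff (differentiableAt_const _), pd_const,
      sub_zero]
  rw [flatLaplace, flatLaplace, e, e]

lemma pd_flatLaplace_potential (h : IsGraphChart x a b ξ η y k) {w : Plane} (hw : w ∈ k.target)
    (i : Fin 2) : pd i (flatLaplace (graphPotential x η y k c₁ c₂)) w
      = pd i (flatLaplace (fun w => -form (x (k.symm w) - y) η)) w :=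
  pd_congr i h.patch.isOpen (fun _ hw => h.flatLaplace_potential hw) hw

lemma contDiffAt_flatLaplace_potential (h : IsGraphChart x a b ξ η y k) {w : Plane}
    (hw : w ∈ k.target) : ContDiffAt ℝ ∞ (flatLaplace (graphPotential x η y k c₁ c₂)) w :=
  (contDiffAt_pd 0 (contDiffAt_pd 0 (h.contDiffAt_potential hw))).neg.sub
    (contDiffAt_pd 1 (contDiffAt_pd 1 (h.contDiffAt_potential hw)))

variable [IsManifold (𝓡 2) ∞ M]

/-- In a graph chart Δx = (Δψ) ξ, and Δx = -2H is not zero. -/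
lemma flatLaplace_ne (h : IsGraphChart x a b ξ η y k) (hx : IsMarginallyTrapped x)
    (fr : IsLightFrame a b ξ η) {w : Plane} (hw : w ∈ k.target) :
    flatLaplace (graphPotential x η y k c₁ c₂) w ≠ 0 := by
  intro h0
  apply (hx.2 (k.symm w)).1
  rw [meanCurvature_eq, h.laplace_eq hx.1 fr hw (hx.1.1 _), h.patch.laplaceCoord_X fr hw,
    ← h.flatLaplace_potential (c₁ := c₁) (c₂ := c₂) hw, h0, zero_smul, smul_zero]

/-- Otherwise dψ would vanish on an open set, against Δψ ≠ 0. -/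
lemma frequently_pd_ne (h : IsGraphChart x a b ξ η y k) (hx : IsMarginallyTrapped x)
    (fr : IsLightFrame a b ξ η) {w : Plane} (hw : w ∈ k.target) :
    ∃ᶠ z in 𝓝 w, ∃ i, pd i (graphPotential x η y k c₁ c₂) z ≠ 0 := by
  intro hn
  apply h.flatLaplace_ne (c₁ := c₁) (c₂ := c₂) hx fr hw
  have e : ∀ i, pd i (pd i (graphPotential x η y k c₁ c₂)) w = 0 := by
    intro i
    have : pd i (graphPotential x η y k c₁ c₂) =ᶠ[𝓝 w] fun _ => 0 := by
      filter_upwards [hn] with z hz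
      push Not at hz
      exact hz i
    rw [pd_eventuallyEq i this, pd_const]
  rw [flatLaplace, e, e]
  ring

variable {ε : ℝ}

lemma laplace_gaussMap (h : IsGraphChart x a b ξ η y k) (hx : IsMarginallyTrapped x)
    (hν : IsGaussMap x ν) (fr : IsLightFrame a b ξ η) (hε : ∀ p, bform (ν p) (wedge a b) = ε)
    {w : Plane} (hw : w ∈ k.target) :
    laplace x ν (k.symm w) = ε • (pd 0 (flatLaplace (graphPotential x η y k c₁ c₂)) w • wedge ξ b
      - pd 1 (flatLaplace (graphPotential x η y k c₁ c₂)) w • wedge ξ a) := by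
  rw [h.laplace_eq hx.1 fr hw (contMDiff_gaussMap hx.1 hν _), h.pd_flatLaplace_potential hw,
    h.pd_flatLaplace_potential hw]
  refine h.patch.laplaceCoord_wedge fr hw fun z hz => ?_
  have := (h.gaussMap_eq hx.1 hν fr hz).2
  rwa [hε] at this

lemma gaussMap_potential (h : IsGraphChart x a b ξ η y k) (hx : IsMarginallyTrapped x)
    (hν : IsGaussMap x ν) (fr : IsLightFrame a b ξ η) (hε : ∀ p, bform (ν p) (wedge a b) = ε)
    {w : Plane} (hw : w ∈ k.target) :
    ν (k.symm w) = ε • (wedge a b + (pd 0 (graphPotential x η y k c₁ c₂) w + c₁) • wedge ξ b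
      - (pd 1 (graphPotential x η y k c₁ c₂) w + c₂) • wedge ξ a) := by
  have := (h.gaussMap_eq hx.1 hν fr hw).2
  rw [hε] at this
  rw [this, h.pd_potential hw, h.pd_potential hw]
  simp

/-- Pairing with η ∧ b and η ∧ a reads off the coefficients of ξ ∧ b and ξ ∧ a. The constants c₁, c₂
are those for which the corresponding components of C are absorbed into ψ. -/
lemma bform_laplace_add (h : IsGraphChart x a b ξ η y k) (hx : IsMarginallyTrapped x)
    (hν : IsGaussMap x ν) (fr : IsLightFrame a b ξ η) (hε : ∀ p, bform (ν p) (wedge a b) = ε)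
    (C : Bivector) {w : Plane} (hw : w ∈ k.target) (hε2 : ε ^ 2 = 1)
    (hc₁ : c₁ = ε * bform C (wedge η b)) (hc₂ : c₂ = -ε * bform C (wedge η a)) :
    (bform (ν (k.symm w) + C) (wedge η b) = -ε * pd 0 (graphPotential x η y k c₁ c₂) w ∧
      bform (ν (k.symm w) + C) (wedge η a) = ε * pd 1 (graphPotential x η y k c₁ c₂) w) ∧
    bform (laplace x ν (k.symm w)) (wedge η b)
        = -ε * pd 0 (flatLaplace (graphPotential x η y k c₁ c₂)) w ∧
      bform (laplace x ν (k.symm w)) (wedge η a)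
        = ε * pd 1 (flatLaplace (graphPotential x η y k c₁ c₂)) w := by
  have f1 := form_comm ξ a
  have f2 := form_comm ξ b
  have f3 := form_comm b a
  rw [fr.aξ] at f1
  rw [fr.bξ] at f2
  rw [fr.ab] at f3
  rw [h.gaussMap_potential (c₁ := c₁) (c₂ := c₂) hx hν fr hε hw,
    h.laplace_gaussMap (c₁ := c₁) (c₂ := c₂) hx hν fr hε hw]
  simp only [bform_add_left, bform_sub_left, bform_smul_left, bform_wedge, fr.aa, fr.bb, fr.ab,
    fr.aη, fr.bη, fr.ξη, f1, f2, f3]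
  refine ⟨⟨?_, ?_⟩, ?_, ?_⟩
  · rw [show bform C (wedge η b) = ε * c₁ by rw [hc₁]; linear_combination -bform C (wedge η b) * hε2]
    ring
  · rw [show bform C (wedge η a) = -ε * c₂ by rw [hc₂]; linear_combination -bform C (wedge η a) * hε2]
    ring
  · ring
  · ring

/-- If `Δν = t (ν + C)`, then the differential of the Laplacian of the potential is `t` times the
differential of the potential. -/
lemma pd_flatLaplace_eq (h : IsGraphChart x a b ξ η y k) (hx : IsMarginallyTrapped x)
    (hν : IsGaussMap x ν) (fr : IsLightFrame a b ξ η) (hε : ∀ p, bform (ν p) (wedge a b) = ε)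
    {C : Bivector} {w : Plane} (hw : w ∈ k.target) (hε2 : ε ^ 2 = 1)
    (hc₁ : c₁ = ε * bform C (wedge η b)) (hc₂ : c₂ = -ε * bform C (wedge η a)) {t : ℝ}
    (hL : laplace x ν (k.symm w) = t • (ν (k.symm w) + C)) (i : Fin 2) :
    pd i (flatLaplace (graphPotential x η y k c₁ c₂)) w
      = t * pd i (graphPotential x η y k c₁ c₂) w := by
  obtain ⟨⟨e1, e2⟩, e3, e4⟩ := h.bform_laplace_add hx hν fr hε C hw hε2 hc₁ hc₂
  rw [hL, bform_smul_left, e1] at e3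
  rw [hL, bform_smul_left, e2] at e4
  have hε0 : ε ≠ 0 := by rintro rfl; norm_num at hε2
  fin_cases i
  · exact mul_left_cancel₀ (neg_ne_zero.2 hε0) (by simp only [Fin.zero_eta]; linear_combination -e3)
  · exact mul_left_cancel₀ hε0 (by simp only [Fin.mk_one]; linear_combination -e4)

/-- Where ν + C = 0, the potential belonging to C is critical, and its critical points have no
interior. -/
lemma gaussMap_add_ne (h : IsGraphChart x a b ξ η y k) (hx : IsMarginallyTrapped x)
    (hν : IsGaussMap x ν) (fr : IsLightFrame a b ξ η) (hε : ∀ p, bform (ν p) (wedge a b) = ε)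
    (C : Bivector) {w : Plane} (hw : w ∈ k.target) (hε2 : ε ^ 2 = 1) :
    ∃ᶠ z in 𝓝 w, ν (k.symm z) + C ≠ 0 := by
  have hε0 : ε ≠ 0 := by rintro rfl; norm_num at hε2
  refine ((h.frequently_pd_ne (c₁ := ε * bform C (wedge η b))
    (c₂ := -ε * bform C (wedge η a)) hx fr hw).and_eventually
    (k.open_target.eventually_mem hw)).mono ?_
  rintro z ⟨⟨i, hi⟩, hz⟩ h0
  obtain ⟨⟨e1, e2⟩, -⟩ := h.bform_laplace_add hx hν fr hε C hz hε2 rfl rfl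
  rw [h0, bform_zero_left] at e1 e2
  apply hi
  fin_cases i
  · exact (mul_eq_zero.1 e1.symm).resolve_left (neg_ne_zero.2 hε0)
  · exact (mul_eq_zero.1 e2.symm).resolve_left hε0

end IsGraphChart

variable [IsManifold (𝓡 2) ∞ M]

lemma frequently_gaussMap_add_ne (hx : IsMarginallyTrapped x) (hν : IsGaussMap x ν)
    (fr : IsLightFrame a b ξ η) (hξ : ∀ p, form (x p - y) ξ = 0) {ε : ℝ}
    (hε : ∀ p, bform (ν p) (wedge a b) = ε) (hε2 : ε ^ 2 = 1) (C : Bivector) (p : M) :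
    ∃ᶠ p' in 𝓝 p, ν p' + C ≠ 0 := by
  obtain ⟨k, hp, hk⟩ := exists_isGraphChart hx.1 fr hξ p
  have := hk.gaussMap_add_ne hx hν fr hε C (k.map_source hp) hε2
  intro hn
  apply this
  rw [k.eventually_nhds' (fun p' => ¬ (ν p' + C ≠ 0)) hp]
  exact hn

/-- If `H` has the direction of `n`, then the surface lies in a light-like hyperplane. -/
lemma form_eq_of_meanCurvature_smul [PreconnectedSpace M] (hx : IsMarginallyTrapped x) {n : E41}
    (hn : ∀ p, ∃ t : ℝ, meanCurvature x p = t • n) (p p' : M) : form (x p) n = form (x p') n := by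
  have hs : ContMDiff (𝓡 2) 𝓘(ℝ, ℝ) ∞ (fun p => form (x p) n) :=
    (formL.flip n).contDiff.contMDiff.comp hx.1.1
  refine eq_of_pd_inChart_eq_zero hs (fun p q hq i => ?_) p p'
  have sX := contDiffAt_inChart p hq (hx.1.1 _)
  have e := pd_form i sX.diff (differentiableAt_const n)
  rw [pd_const, form_zero_right, add_zero] at e
  change pd i (fun w => form (inChart p x w) n) q = 0
  rw [e]
  obtain ⟨t, ht⟩ := hn ((chartAt Plane p).symm q)
  have hH := (hx.2 ((chartAt Plane p).symm q)).1
  have ht0 : t ≠ 0 := by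
    rintro rfl
    exact hH (by rw [ht, zero_smul])
  have e2 := form_meanCurvatureCoord_pd sX (gramDet_inChart_pos hx.1 p hq).ne' i
  rw [← meanCurvature_inChart hx.1 p hq, ht, form_smul_right] at e2
  exact (mul_eq_zero.1 e2).resolve_left ht0

/-- A surface in a light-like hyperplane has its mean curvature vector in the light-like
direction. -/
lemma meanCurvature_smul_of_form_eq (hx : IsMarginallyTrapped x) (hν : IsGaussMap x ν)
    (fr : IsLightFrame a b ξ η) {S : Set M} (hS : IsOpen S)
    (hξ : ∀ p ∈ S, form (x p - y) ξ = 0) {p : M} (hp : p ∈ S) :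
    ∃ t : ℝ, meanCurvature x p = t • ξ := by
  have h := isTrappedPatch_inChart hx hν p
  have ht := chart_mem_target p
  have hVo := (chartAt Plane p).continuousOn_symm.isOpen_inter_preimage
    (chartAt Plane p).open_target hS
  have h' := h.mono hVo Set.inter_subset_left
  have hq : chartAt Plane p p ∈ (chartAt Plane p).target ∩ (chartAt Plane p).symm ⁻¹' S :=
    ⟨ht, by simpa using hp⟩
  have e1 : ∀ w ∈ (chartAt Plane p).target ∩ (chartAt Plane p).symm ⁻¹' S, ∀ i,
      form (pd i (inChart p x) w) ξ = 0 := by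
    intro w hw i
    have e := pd_form i ((h'.smooth w hw).diff.fun_sub (differentiableAt_const y))
      (differentiableAt_const ξ)
    rw [pd_congr i hVo (F := fun w => form (inChart p x w - y) ξ) (G := fun _ => 0)
        (fun w hw => hξ _ hw.2) hw,
      pd_sub i (h'.smooth w hw).diff (differentiableAt_const y), pd_const, pd_const, pd_const,
      form_zero_right, sub_zero, add_zero] at e
    exact e.symm
  have e2 : ∀ i j, form (pd i (pd j (inChart p x)) (chartAt Plane p p)) ξ = 0 := by
    intro i j
    have e := pd_form i (contDiffAt_pd j (h'.smooth _ hq)).diff (differentiableAt_const ξ)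
    rw [pd_congr i hVo (fun w hw => e1 w hw j) hq, pd_const, pd_const, form_zero_right,
      add_zero] at e
    exact e.symm
  have e3 := trace_second_normal (h'.smooth _ hq) (h'.det_ne hq) (e1 _ hq)
  rw [e2, e2, e2] at e3
  have e4 : form (meanCurvatureCoord (inChart p x) (chartAt Plane p p)) ξ = 0 := by
    have : 2 * gramDet (inChart p x) (chartAt Plane p p)
        * form (meanCurvatureCoord (inChart p x) (chartAt Plane p p)) ξ = 0 := by linarith
    exact (mul_eq_zero.1 this).resolve_left (mul_ne_zero two_ne_zero (h'.det_ne hq))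
  obtain ⟨η', hη'⟩ := h.exists_conjugateNormal
  have fr' := h.isFrame ht (hη'.normal _ ht) (hη'.H_η _ ht)
  -- ξ is normal and orthogonal to H, so only its H-component survives in the null frame.
  have e5 := fr'.expand (hη'.null _ ht) ξ
  rw [e1 _ hq, e1 _ hq, form_comm ξ (meanCurvatureCoord _ _), e4] at e5
  have e6 : ξ = (-form ξ (η' (chartAt Plane p p))) • meanCurvature x p := by
    conv_lhs => rw [e5]
    rw [meanCurvature]
    simp
  have ht0 : -form ξ (η' (chartAt Plane p p)) ≠ 0 := by
    intro h0
    rw [h0, zero_smul] at e6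
    have := fr.ξη
    rw [e6, form_zero_left] at this
    norm_num at this
  refine ⟨(-form ξ (η' (chartAt Plane p p)))⁻¹, ?_⟩
  conv_rhs => rw [e6]
  rw [smul_smul]
  rw [← e6, inv_mul_cancel₀ ht0, one_smul]

end Potential

/-! ### Isometries and light-like frames -/

section Congruence

lemma form_vec (v : E41) (a b c d : ℝ) :
    form v ![a, b, c, d] = -(v 0 * a) + v 1 * b + v 2 * c + v 3 * d := by
  simp [form]

/-- The light-cone frame that an isometry carries to the standard one. -/
lemma IsCongruence.exists_isLightFrame {T : E41 ≃ᵃ[ℝ] E41} (hT : IsCongruence T) :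
    ∃ a b ξ η y, IsLightFrame a b ξ η ∧ ∀ v, T v 1 = form (v - y) a ∧ T v 2 = form (v - y) b ∧
      -T v 0 + T v 3 = form (v - y) ξ ∧ T v 0 + T v 3 = -2 * form (v - y) η := by
  set A := T.linear
  have hA : ∀ u v, form (A.symm u) (A.symm v) = form u v := fun u v => by
    rw [← hT (A.symm u), A.apply_symm_apply, A.apply_symm_apply]
  have hy : ∀ v, A (v - T.symm 0) = T v := fun v => by
    have := T.toAffineMap.linearMap_vsub v (T.symm 0)
    simpa using this
  have hf : ∀ v u, form (v - T.symm 0) (A.symm u) = form (T v) u := fun v u => by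
    rw [← hT, A.apply_symm_apply, hy]
  -- These are preimages of a standard frame: (1, 0, 0, 1) is the direction of the graphs, and (1/2,
  -- 0, 0, -1/2) is the null vector whose product with it is -1.
  refine ⟨A.symm ![0, 1, 0, 0], A.symm ![0, 0, 1, 0], A.symm ![1, 0, 0, 1],
    A.symm ![1 / 2, 0, 0, -1 / 2], T.symm 0, ?_, fun v => ?_⟩
  · refine ⟨⟨?_, ?_, ?_, ?_, ?_, ?_, ?_⟩, ?_, ?_, ?_, ?_⟩ <;>
      simp only [hA, form_vec] <;> simp <;> norm_num
  · simp only [hf, form_vec]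
    refine ⟨by ring, by ring, by ring, by ring⟩

/-- Two vectors of equal square are exchanged by the reflection in their difference d, if d is not
null. Here d has zero time component, so if it is null it is zero and the identity works. -/
lemma exists_linearEquiv_of_null {n : E41} (hnn : form n n = 0) :
    ∃ A : E41 ≃ₗ[ℝ] E41, (∀ u v, form (A u) (A v) = form u v) ∧ A n = n 0 • ![1, 0, 0, 1] := by
  set e : E41 := ![1, 0, 0, 1]
  have hee : form e e = 0 := by rw [form_vec]; simp [e]
  set d := n - n 0 • e with hd
  have hdn : form n d = form d d / 2 := by
    rw [hd]
    simp only [form_sub_left, form_sub_right, form_smul_left, form_smul_right, hee, hnn,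
      form_comm e n]
    ring
  by_cases hdd : form d d = 0
  · refine ⟨LinearEquiv.refl ℝ E41, fun _ _ => rfl, ?_⟩
    have d0 : d 0 = 0 := by
      change n 0 - n 0 * 1 = 0
      ring
    have hs : d 1 ^ 2 + d 2 ^ 2 + d 3 ^ 2 = 0 := by
      rw [form, d0] at hdd
      linarith
    have h1 : d 1 = 0 := by nlinarith [sq_nonneg (d 1), sq_nonneg (d 2), sq_nonneg (d 3)]
    have h2 : d 2 = 0 := by nlinarith [sq_nonneg (d 1), sq_nonneg (d 2), sq_nonneg (d 3)]
    have h3 : d 3 = 0 := by nlinarith [sq_nonneg (d 1), sq_nonneg (d 2), sq_nonneg (d 3)]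
    have : d = 0 := by
      funext i
      fin_cases i
      exacts [d0, h1, h2, h3]
    exact sub_eq_zero.1 this
  · set g : Module.Dual ℝ E41 := (2 / form d d) • (formL.flip d).toLinearMap
    have hg : ∀ v, g v = 2 / form d d * form v d := fun v => rfl
    have hgd : g d = 2 := by rw [hg, div_mul_cancel₀ _ hdd]
    refine ⟨Module.reflection hgd, fun u v => ?_, ?_⟩
    · simp only [Module.reflection_apply, hg, form_sub_left, form_sub_right, form_smul_left,
        form_smul_right, form_comm d v]
      field_simp
      ring
    · rw [Module.reflection_apply, hg, hdn, show 2 / form d d * (form d d / 2) = 1 by field_simp,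
        one_smul, hd, sub_sub_cancel]

/-- Each light-like direction is carried to the standard one by an isometry. -/
lemma exists_isCongruence_of_null {n : E41} (hn : n ≠ 0) (hnn : form n n = 0) (y : E41) :
    ∃ T : E41 ≃ᵃ[ℝ] E41, IsCongruence T ∧
      ∃ s : ℝ, ∀ v, -T v 0 + T v 3 = s * form (v - y) n := by
  obtain ⟨A, hA, hAn⟩ := exists_linearEquiv_of_null hnn
  have h0 := apply_zero_ne_of_null hnn hn
  refine ⟨(AffineEquiv.constVAdd ℝ E41 (-y)).trans A.toAffineEquiv, fun a b => ?_, (n 0)⁻¹,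
    fun v => ?_⟩
  · exact hA a b
  · have : ((AffineEquiv.constVAdd ℝ E41 (-y)).trans A.toAffineEquiv) v = A (v - y) := by
      simp [sub_eq_neg_add]
    rw [this, ← hA (v - y) n, hAn, form_smul_right, form_vec]
    field_simp
    ring

end Congruence

/-- When dH has no tangential part it is a multiple of H, since ⟨∂H, H⟩ = 0 also excludes an
η-component. So the normalization H/H₀ is locally constant. -/
lemma IsTrappedPatch.exists_H_smul {X : Plane → E41} {μ : Plane → ℝ} {N : Plane → Bivector}
    {V : Set Plane} {q : Plane} (h : IsTrappedPatch X μ N V) (hq : q ∈ V)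
    (h0 : ∀ᶠ w in 𝓝 q, ∀ i k, form (pd i (meanCurvatureCoord X) w) (pd k X w) = 0) :
    ∃ n, ∀ᶠ w in 𝓝 q, ∃ t : ℝ, meanCurvatureCoord X w = t • n := by
  obtain ⟨η, hη⟩ := h.exists_conjugateNormal
  set H := meanCurvatureCoord X with hH
  have hne : ∀ w ∈ V, H w 0 ≠ 0 := fun w hw => apply_zero_ne_of_null (h.H_null w hw) (h.H_ne w hw)
  have dH : ∀ w ∈ V, DifferentiableAt ℝ H w := fun w hw => (h.smooth_H hw).diff
  have dH0 : ∀ w ∈ V, DifferentiableAt ℝ (fun w => (H w 0)⁻¹) w := fun w hw =>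
    DifferentiableAt.fun_inv (differentiableAt_pi.1 (dH w hw) 0) (hne w hw)
  have key : ∀ᶠ w in 𝓝 q, DifferentiableAt ℝ (fun w => (H w 0)⁻¹ • H w) w ∧
      ∀ i, pd i (fun w => (H w 0)⁻¹ • H w) w = 0 := by
    filter_upwards [h0, h.isOpen.eventually_mem hq] with w hw hwV
    refine ⟨(dH0 w hwV).fun_smul (dH w hwV), fun i => ?_⟩
    have fr := h.isFrame hwV (hη.normal _ hwV) (hη.H_η _ hwV)
    have e := fr.expand (hη.null _ hwV) (pd i H w)
    have e1 : form (pd i H w) (H w) = 0 := by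
      have e := pd_form i (dH w hwV) (dH w hwV)
      rw [pd_congr i h.isOpen (fun w hw => h.H_null w hw) hwV, pd_const, form_comm (H w)] at e
      linarith
    have e2 : ∀ k, form (pd k X w) (pd i H w) = 0 := fun k => by rw [form_comm, hw]
    rw [e2, e2, e1] at e
    simp only [mul_zero, sub_zero, zero_div, zero_smul, add_zero, zero_sub] at e
    have eZ := pd_smul i (dH0 w hwV) (dH w hwV)
    rw [e, ← hH] at eZ
    -- The derivative of H/H₀ is a multiple of H, and the time component of H/H₀ is constantly 1.
    -- Hence the multiple is zero.
    have e3 := pd_apply i ((dH0 w hwV).fun_smul (dH w hwV)) 0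
    rw [pd_congr i h.isOpen (F := fun w => ((H w 0)⁻¹ • H w) 0) (G := fun _ => 1)
      (fun w hw => inv_mul_cancel₀ (hne w hw)) hwV, pd_const, eZ, smul_neg, smul_smul, ← neg_smul,
      ← add_smul, Pi.smul_apply, smul_eq_mul] at e3
    rw [eZ, smul_neg, smul_smul, ← neg_smul, ← add_smul,
      (mul_eq_zero.1 e3.symm).resolve_right (hne w hwV), zero_smul]
  refine ⟨(H q 0)⁻¹ • H q, ?_⟩
  filter_upwards [eventually_const_of_pd_eq_zero key, h.isOpen.eventually_mem hq] with w hw hwV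
  exact ⟨H w 0, by rw [← hw, smul_smul, mul_inv_cancel₀ (hne w hwV), one_smul]⟩

/-! ### From the pointwise 1-type equation to the two types -/

section Forward

variable {M : Type*} [TopologicalSpace M] [ChartedSpace Plane M] {a b ξ η y : E41}
  {x : M → E41} {ν : M → Bivector} {k : OpenPartialHomeomorph M Plane} {c₁ c₂ : ℝ}

/-- Where dψ ≠ 0, the relation d(Δψ) = f dψ makes Δψ locally a function F of ψ with F' = f, and f p
≠ 0 keeps F from being constant. -/
lemma IsGraphChart.exists_isGraphData (h : IsGraphChart x a b ξ η y k)
    (hξ : ∀ p, form (x p - y) ξ = 0) {T : E41 ≃ᵃ[ℝ] E41}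
    (hT : ∀ v, T v 1 = form (v - y) a ∧ T v 2 = form (v - y) b ∧
      -T v 0 + T v 3 = form (v - y) ξ ∧ T v 0 + T v 3 = -2 * form (v - y) η)
    {f : M → ℝ} (hf : ContMDiff (𝓡 2) 𝓘(ℝ, ℝ) ∞ f)
    (hL : ∀ w ∈ k.target, ∀ i, pd i (flatLaplace (graphPotential x η y k c₁ c₂)) w
      = f (k.symm w) * pd i (graphPotential x η y k c₁ c₂) w)
    {S : Set M} (hS : IsOpen S) {p : M} (hpS : p ∈ S) (hp : p ∈ k.source) (hfp : f p ≠ 0)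
    {j : Fin 2} (hj : pd j (graphPotential x η y k c₁ c₂) (k p) ≠ 0) :
    ∃ (U : Set M) (Ω : Set Plane) (ψ φ : Plane → ℝ) (F : ℝ → ℝ),
      IsOpen U ∧ p ∈ U ∧ U ⊆ S ∧ IsGraphData c₁ c₂ Ω ψ φ F ∧
        Set.BijOn (fun q => T (x q)) U (graphMap φ '' Ω) := by
  set ψ := graphPotential x η y k c₁ c₂ with hψ
  -- The unit ball only serves to make Ω bounded.
  have hV : IsOpen ((k.target ∩ k.symm ⁻¹' S) ∩ Metric.ball (k p) 1) :=
    (k.continuousOn_symm.isOpen_inter_preimage k.open_target hS).inter Metric.isOpen_ball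
  obtain ⟨F, Ω, hΩ, hpΩ, hΩV, hψΩ, hF, hF'⟩ := exists_function_of
    (f := fun w => f (k.symm w)) hV (fun w hw => h.contDiffAt_potential (c₁ := c₁) (c₂ := c₂) hw.1.1)
    (fun w hw => h.contDiffAt_flatLaplace_potential hw.1.1) (fun w hw => hL w hw.1.1)
    (q := k p) ⟨⟨k.map_source hp, by simpa [k.left_inv hp] using hpS⟩, Metric.mem_ball_self one_pos⟩
    hj
  have hΩt : Ω ⊆ k.target := fun w hw => (hΩV hw).1.1
  have hTx : ∀ q ∈ k.source, T (x q)
      = graphMap (fun w => -form (x (k.symm w) - y) η) (k q) := by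
    intro q hq
    obtain ⟨e1, e2, e3, e4⟩ := hT (x q)
    rw [hξ] at e3
    have hc := h.coe q hq
    funext i
    fin_cases i
    · change T (x q) 0 = -form (x (k.symm (k q)) - y) η
      rw [k.left_inv hq]
      linarith
    · change T (x q) 1 = k q 0
      rw [hc, e1]
      rfl
    · change T (x q) 2 = k q 1
      rw [hc, e2]
      rfl
    · change T (x q) 3 = -form (x (k.symm (k q)) - y) η
      rw [k.left_inv hq]
      linarith
  -- The image ψ(Ω) is open, so the derivative within it is the ordinary derivative, which is smooth
  -- because f is.
  have hd : ∀ w ∈ Ω, derivWithin F (ψ '' Ω) (ψ w) = f (k.symm w) := fun w hw =>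
    (hF' w hw).hasDerivWithinAt.derivWithin (hψΩ.uniqueDiffWithinAt ⟨w, hw, rfl⟩)
  refine ⟨k.source ∩ k ⁻¹' Ω, Ω, ψ, fun w => -form (x (k.symm w) - y) η, F,
    k.isOpen_inter_preimage hΩ, ⟨hp, hpΩ⟩, fun q hq => ?_, ?_, fun q hq => ?_, fun q hq q' hq' he => ?_,
    ?_⟩
  · have := (hΩV hq.2).1.2
    rwa [Set.mem_preimage, k.left_inv hq.1] at this
  · refine ⟨hΩ, Metric.isBounded_ball.subset fun w hw => (hΩV hw).2,
      fun w hw => (h.contDiffAt_potential (hΩt hw)).contDiffWithinAt,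
      fun w hw => (h.patch.smooth w (hΩt hw)).contDiffWithinAt, ?_, ?_, ?_, hF, fun w _ => ?_⟩
    · rintro _ ⟨w, hw, rfl⟩
      exact (hF' w hw).differentiableAt.differentiableWithinAt
    · by_contra! hc
      have e : F =ᶠ[𝓝 (ψ (k p))] fun _ => F (ψ (k p)) := by
        filter_upwards [hψΩ.mem_nhds ⟨_, hpΩ, rfl⟩] with s hs
        exact hc s hs _ ⟨_, hpΩ, rfl⟩
      have := ((hF' _ hpΩ).congr_of_eventuallyEq e.symm).unique (hasDerivAt_const _ _)
      rw [k.left_inv hp] at this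
      exact hfp this
    · refine ContDiffOn.congr (fun w hw => ?_) hd
      exact ((hf _).comp w (h.smooth_symm w (hΩt hw))).contDiffAt.contDiffWithinAt
    · rw [hψ, graphPotential]
      ring
  · exact ⟨k q, hq.2, (hTx q hq.1).symm⟩
  · refine k.injOn hq.1 hq'.1 ?_
    rw [h.coe q hq.1, h.coe q' hq'.1, T.injective he]
  · rintro _ ⟨w, hw, rfl⟩
    refine ⟨k.symm w, ⟨k.map_target (hΩt hw), ?_⟩, ?_⟩
    · rwa [Set.mem_preimage, k.right_inv (hΩt hw)]
    · change T (x (k.symm w)) = _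
      rw [hTx _ (k.map_target (hΩt hw)), k.right_inv (hΩt hw)]

variable [IsManifold (𝓡 2) ∞ M] [ConnectedSpace M]

/-- A surface with pointwise 1-type Gauss map and with `H` of constant direction is locally a graph
over a plane whose potential has its Laplacian as a function of itself. -/
theorem isLocallyGraph_of_meanCurvature_smul (hx : IsMarginallyTrapped x) (hν : IsGaussMap x ν)
    {f : M → ℝ} {C : Bivector} (hf : ContMDiff (𝓡 2) 𝓘(ℝ, ℝ) ∞ f)
    (hL : ∀ p, laplace x ν p = f p • (ν p + C)) {p₀ : M} (hp₀ : f p₀ ≠ 0) {n : E41}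
    (hn : ∀ p, ∃ t : ℝ, meanCurvature x p = t • n) :
    IsLocallyGraph x (nonHarmonicSet x ν) := by
  have hnn : n ≠ 0 ∧ form n n = 0 := by
    obtain ⟨t, ht⟩ := hn p₀
    obtain ⟨h1, h2⟩ := hx.2 p₀
    rw [ht] at h1 h2
    rw [form_smul_left, form_smul_right] at h2
    have ht0 := left_ne_zero_of_smul h1
    exact ⟨right_ne_zero_of_smul h1, by simpa [ht0] using h2⟩
  obtain ⟨T, hT, s, hs⟩ := exists_isCongruence_of_null hnn.1 hnn.2 (x p₀)
  obtain ⟨a, b, ξ, η, y, fr, hTv⟩ := hT.exists_isLightFrame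
  have hξ : ∀ p, form (x p - y) ξ = 0 := fun p => by
    rw [← (hTv (x p)).2.2.1, hs, form_sub_left, form_eq_of_meanCurvature_smul hx hn p p₀, sub_self,
      mul_zero]
  obtain ⟨ε, hε2, hε⟩ := exists_sign hx.1 hν fr hξ
  refine ⟨?_, T, ε * bform C (wedge η b), -ε * bform C (wedge η a), hT, fun p hp => ?_⟩
  -- ν + C is non-zero at points arbitrarily close to p₀, and f ≠ 0 near p₀.
  · obtain ⟨p, hp1, hp2⟩ := ((frequently_gaussMap_add_ne hx hν fr hξ hε hε2 C p₀).and_eventually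
      (hf.continuous.continuousAt.eventually_ne hp₀)).exists
    refine ⟨p, ?_⟩
    rw [nonHarmonicSet, Set.mem_ofPred_eq, hL]
    exact smul_ne_zero hp2 hp1
  · obtain ⟨k, hpk, hk⟩ := exists_isGraphChart hx.1 fr hξ p
    have hfp : f p ≠ 0 := by
      intro h0
      apply hp
      rw [hL, h0, zero_smul]
    have hpd := fun w hw => hk.pd_flatLaplace_eq hx hν fr hε (C := C) hw hε2 rfl rfl (hL (k.symm w))
    -- If dψ were zero at p, then d(Δψ) = f dψ and with it Δν would vanish there.
    have hj : ∃ j, pd j (graphPotential x η y k (ε * bform C (wedge η b))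
        (-ε * bform C (wedge η a))) (k p) ≠ 0 := by
      by_contra! h0
      apply hp
      have := hk.laplace_gaussMap (c₁ := ε * bform C (wedge η b)) (c₂ := -ε * bform C (wedge η a))
        hx hν fr hε (k.map_source hpk)
      rw [hpd _ (k.map_source hpk), hpd _ (k.map_source hpk), h0, h0, k.left_inv hpk] at this
      simpa using this
    obtain ⟨j, hj⟩ := hj
    exact hk.exists_isGraphData hξ hTv hf hpd (isOpen_nonHarmonicSet hx.1 hν) hp hpk hfp hj

/-- The alternative is whether ⟨∂H, ∂X⟩ is non-zero somewhere on the part of a chart with f ≠ 0. If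
not, H has constant direction near p₀, and unique continuation spreads this over the surface. -/
theorem IsPointwiseOneType.isNonflatInQuadric_or_isLocallyGraph (hx : IsMarginallyTrapped x)
    (hν : IsGaussMap x ν) (h : IsPointwiseOneType x ν) :
    IsNonflatInQuadric x (nonHarmonicSet x ν) ∨ IsLocallyGraph x (nonHarmonicSet x ν) := by
  obtain ⟨f, C, hf, ⟨p₀, hp₀⟩, hL⟩ := h
  by_cases hc : ∃ q ∈ (chartAt Plane p₀).target, f ((chartAt Plane p₀).symm q) ≠ 0 ∧
      ∃ i k, form (pd i (meanCurvatureCoord (inChart p₀ x)) q) (pd k (inChart p₀ x) q) ≠ 0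
  · obtain ⟨q, hq, hfq, i, k, hne⟩ := hc
    exact Or.inl (isNonflatInQuadric_of_pd_ne hx hν hf hL hq hfq hne)
  · push Not at hc
    have ht := chart_mem_target p₀
    have hev : ∀ᶠ q in 𝓝 (chartAt Plane p₀ p₀), f ((chartAt Plane p₀).symm q) ≠ 0 := by
      rw [(chartAt Plane p₀).eventually_nhds' (fun p => f p ≠ 0) (mem_chart_source Plane p₀)]
      exact hf.continuous.continuousAt.eventually_ne hp₀
    obtain ⟨n, hn⟩ := (isTrappedPatch_inChart hx hν p₀).exists_H_smul ht (by
      filter_upwards [hev, (chartAt Plane p₀).open_target.eventually_mem ht] with w hw hwt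
      exact hc w hwt hw)
    refine Or.inr (isLocallyGraph_of_meanCurvature_smul hx hν hf hL hp₀
      (meanCurvature_smul_of_eventually hx hν (n := n) (p₀ := p₀) ?_))
    rw [← (chartAt Plane p₀).eventually_nhds' _ (mem_chart_source Plane p₀)]
    filter_upwards [hn, (chartAt Plane p₀).open_target.eventually_mem ht] with q hq hqt
    rwa [meanCurvature_inChart hx.1 p₀ hqt]

end Forward

/-! ### From local graphs back to the pointwise 1-type equation -/

section Backward

variable {M : Type*} [TopologicalSpace M] [ChartedSpace Plane M] {a b ξ η y : E41}
  {x : M → E41} {ν : M → Bivector} {k : OpenPartialHomeomorph M Plane} {c₁ c₂ : ℝ}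

/-- Local smooth factors of proportionality fit together. -/
lemma exists_contMDiff_factor {W : Type*} [NormedAddCommGroup W] [NormedSpace ℝ W] {A B : M → W}
    (hB : ∀ p, ∃ᶠ p' in 𝓝 p, B p' ≠ 0)
    (h : ∀ p, ∃ g : M → ℝ, ∀ᶠ p' in 𝓝 p, ContMDiffAt (𝓡 2) 𝓘(ℝ, ℝ) ∞ g p' ∧ A p' = g p' • B p') :
    ∃ f : M → ℝ, ContMDiff (𝓡 2) 𝓘(ℝ, ℝ) ∞ f ∧ ∀ p, A p = f p • B p := by
  choose g hg using h
  -- Two local factors agree where B ≠ 0, hence on a dense set, hence by continuity wherever both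
  -- are defined. So the diagonal choice coincides locally with a smooth one.
  refine ⟨fun p => g p p, fun p => ?_, fun p => (hg p).self_of_nhds.2⟩
  refine (hg p).self_of_nhds.1.congr_of_eventuallyEq ?_
  filter_upwards [(hg p).eventually_nhds] with p' hp'
  refine eq_of_frequently_eq (hg p').self_of_nhds.1.continuousAt
    hp'.self_of_nhds.1.continuousAt ?_
  refine ((hB p').and_eventually ((hg p').and hp')).mono ?_
  rintro p'' ⟨hne, ⟨-, h1⟩, -, h2⟩
  exact smul_left_injective ℝ hne (h1.symm.trans h2)

variable [IsManifold (𝓡 2) ∞ M]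

/-- Near a point with Δν ≠ 0 the potential is the given ψ and the factor is F'(ψ). Where Δν = 0 the
differential of Δψ vanishes, and the factor 0 works. Its smoothness is obtained separately from
`exists_smooth_ratio`. -/
lemma IsGraphChart.exists_factor (h : IsGraphChart x a b ξ η y k) (hx : IsMarginallyTrapped x)
    (hν : IsGaussMap x ν) (fr : IsLightFrame a b ξ η) {ε : ℝ} (hε2 : ε ^ 2 = 1)
    (hε : ∀ p, bform (ν p) (wedge a b) = ε) (hξ : ∀ p, form (x p - y) ξ = 0)
    {T : E41 ≃ᵃ[ℝ] E41} (hT : ∀ v, T v 1 = form (v - y) a ∧ T v 2 = form (v - y) b ∧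
      -T v 0 + T v 3 = form (v - y) ξ ∧ T v 0 + T v 3 = -2 * form (v - y) η)
    (hloc : ∀ p ∈ nonHarmonicSet x ν, ∃ (U : Set M) (Ω : Set Plane) (ψ φ : Plane → ℝ) (F : ℝ → ℝ),
      IsOpen U ∧ p ∈ U ∧ U ⊆ nonHarmonicSet x ν ∧ IsGraphData c₁ c₂ Ω ψ φ F ∧
        Set.BijOn (fun q => T (x q)) U (graphMap φ '' Ω)) {w : Plane} (hw : w ∈ k.target) :
    ∃ t : ℝ, ∀ i, pd i (flatLaplace (graphPotential x η y k c₁ c₂)) w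
      = t * pd i (graphPotential x η y k c₁ c₂) w := by
  by_cases hS : k.symm w ∈ nonHarmonicSet x ν
  swap
  · refine ⟨0, fun i => ?_⟩
    -- The equation is read with t = 0 and C = 0; the potential belonging to this C may differ from
    -- the given one by an affine function, which its Laplacian does not see.
    have h0 : laplace x ν (k.symm w) = (0 : ℝ) • (ν (k.symm w) + 0) := by
      rw [zero_smul]
      exact not_not.1 hS
    have e : ∀ i, pd i (flatLaplace fun w => -form (x (k.symm w) - y) η) w = 0 := fun i => by
      have := h.pd_flatLaplace_eq hx hν fr hε hw hε2 rfl rfl h0 i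
      rwa [h.pd_flatLaplace_potential hw, zero_mul] at this
    rw [h.pd_flatLaplace_potential hw, e, zero_mul]
  obtain ⟨U, Ω, ψ, φ, F, hU, hpU, -, hd, hbij⟩ := hloc _ hS
  have hW := k.continuousOn_symm.isOpen_inter_preimage k.open_target hU
  have hwW : w ∈ k.target ∩ k.symm ⁻¹' U := ⟨hw, hpU⟩
  have key : ∀ z ∈ k.target ∩ k.symm ⁻¹' U, z ∈ Ω ∧
      graphPotential x η y k c₁ c₂ z = ψ z := by
    intro z hz
    obtain ⟨z', hz', he⟩ := hbij.mapsTo hz.2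
    obtain ⟨t1, t2, t3, t4⟩ := hT (x (k.symm z))
    rw [hξ] at t3
    beta_reduce at he
    have hc := h.coe _ (k.map_target hz.1)
    rw [k.right_inv hz.1] at hc
    have e0 : φ z' = T (x (k.symm z)) 0 := congrFun he 0
    have e1 : z' 0 = T (x (k.symm z)) 1 := congrFun he 1
    have e2 : z' 1 = T (x (k.symm z)) 2 := congrFun he 2
    -- The graph map and the chart share the coordinates (u, v), so the parameter point is z itself.
    have ez : z' = z := by
      rw [hc]
      ext i
      fin_cases i
      · exact e1.trans t1
      · exact e2.trans t2
    rw [ez] at hz' e0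
    refine ⟨hz', ?_⟩
    have := hd.phi_eq z hz'
    rw [graphPotential]
    linarith
  have hΩ := hd.isOpen.mem_nhds (key w hwW).1
  have eL : ∀ z ∈ k.target ∩ k.symm ⁻¹' U,
      flatLaplace (graphPotential x η y k c₁ c₂) z = F (ψ z) := by
    intro z hz
    rw [← hd.laplace_eq z (key z hz).1, flatLaplace, flatLaplace]
    have e : ∀ i, pd i (pd i (graphPotential x η y k c₁ c₂)) z = pd i (pd i ψ) z := fun i =>
      pd_congr i hW (fun z hz => pd_congr i hW (fun z hz => (key z hz).2) hz) hz
    rw [e, e]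
  have hψ : DifferentiableAt ℝ ψ w := (hd.smooth_psi.contDiffAt hΩ).diff
  have hFd := (hd.differentiable (ψ w) ⟨w, (key w hwW).1, rfl⟩).hasDerivWithinAt
  have hFψ := (hFd.comp_hasFDerivWithinAt (s := Ω) w hψ.hasFDerivAt.hasFDerivWithinAt
    (Set.mapsTo_image ψ Ω)).hasFDerivAt hΩ
  refine ⟨derivWithin F (ψ '' Ω) (ψ w), fun i => ?_⟩
  rw [pd_congr i hW eL hwW, pd_congr i hW (fun z hz => (key z hz).2) hwW]
  change fderiv ℝ (F ∘ ψ) w _ = _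
  rw [hFψ.fderiv]
  rfl

variable [ConnectedSpace M]

/-- The graph pieces put H along ξ near p₀, and unique continuation spreads this over the surface.
So all of it lies in one null hyperplane, and graph charts exist also where Δν = 0. -/
theorem IsLocallyGraph.isPointwiseOneType (hx : IsMarginallyTrapped x) (hν : IsGaussMap x ν)
    (h : IsLocallyGraph x (nonHarmonicSet x ν)) : IsPointwiseOneType x ν := by
  obtain ⟨⟨p₀, hp₀⟩, T, c₁, c₂, hT, hloc⟩ := h
  obtain ⟨a, b, ξ, η, y, fr, hTv⟩ := hT.exists_isLightFrame
  have hS := isOpen_nonHarmonicSet hx.1 hν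
  have hξS : ∀ p ∈ nonHarmonicSet x ν, form (x p - y) ξ = 0 := by
    intro p hp
    obtain ⟨U, Ω, ψ, φ, F, -, hpU, -, -, hbij⟩ := hloc p hp
    obtain ⟨z, -, he⟩ := hbij.mapsTo hpU
    have e0 : φ z = T (x p) 0 := congrFun he 0
    have e3 : φ z = T (x p) 3 := congrFun he 3
    rw [← (hTv (x p)).2.2.1]
    linarith
  have hH := meanCurvature_smul_of_eventually hx hν (n := ξ) (p₀ := p₀) (by
    filter_upwards [hS.mem_nhds hp₀] with p hp
    exact meanCurvature_smul_of_form_eq hx hν fr hS hξS hp)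
  have hξ : ∀ p, form (x p - y) ξ = 0 := fun p => by
    rw [← hξS p₀ hp₀, form_sub_left, form_sub_left, form_eq_of_meanCurvature_smul hx hH p p₀]
  obtain ⟨ε, hε2, hε⟩ := exists_sign hx.1 hν fr hξ
  -- This C cancels the constant part of ν and leaves ν + C = ε(ψ_u ξ∧b - ψ_v ξ∧a).
  set C := -ε • (wedge a b + c₁ • wedge ξ b - c₂ • wedge ξ a) with hC
  obtain ⟨f, hf, hL⟩ := exists_contMDiff_factor (A := laplace x ν) (B := fun p => ν p + C)
    (frequently_gaussMap_add_ne hx hν fr hξ hε hε2 C) (fun p => by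
      obtain ⟨k, hpk, hk⟩ := exists_isGraphChart hx.1 fr hξ p
      have hpt := k.map_source hpk
      have hne := hk.flatLaplace_ne (c₁ := c₁) (c₂ := c₂) hx fr hpt
      -- The pointwise factors can be chosen smooth across the critical points of ψ because Δψ ≠ 0.
      obtain ⟨g, hg⟩ := exists_smooth_ratio k.open_target
        (fun w hw => hk.contDiffAt_potential (c₁ := c₁) (c₂ := c₂) hw)
        (fun w hw => hk.contDiffAt_flatLaplace_potential hw)
        (fun w hw => hk.exists_factor hx hν fr hε2 hε hξ hTv hloc hw) hpt (by
          rw [flatLaplace] at hne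
          intro h0
          exact hne (by linarith))
      refine ⟨fun p' => g (k p'), ?_⟩
      filter_upwards [k.continuousAt hpk |>.eventually hg, k.open_source.mem_nhds hpk]
        with p' hp' hps
      refine ⟨(hp'.1.contMDiffAt).comp p' (hk.smooth hx.1 hps), ?_⟩
      have hpt' := k.map_source hps
      have e1 := hk.laplace_gaussMap (c₁ := c₁) (c₂ := c₂) hx hν fr hε hpt'
      have e2 := hk.gaussMap_potential (c₁ := c₁) (c₂ := c₂) hx hν fr hε hpt'
      rw [k.left_inv hps] at e1 e2
      rw [e1, e2, hp'.2, hp'.2, hC]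
      module)
  refine ⟨f, C, hf, ⟨p₀, fun h0 => hp₀ ?_⟩, hL⟩
  rw [hL, h0, zero_smul]

end Backward

end MinkSurf

theorem mainTheorem1 {M : Type*} [TopologicalSpace M] [T2Space M] [SecondCountableTopology M]
    [ConnectedSpace M] [ChartedSpace MinkSurf.Plane M] [IsManifold (𝓡 2) ∞ M]
    (x : M → MinkSurf.E41) (hx : MinkSurf.IsMarginallyTrapped x)
    (ν : M → MinkSurf.Bivector) (hν : MinkSurf.IsGaussMap x ν) :
    IsOpen (MinkSurf.nonHarmonicSet x ν) ∧
      (MinkSurf.IsPointwiseOneType x ν ↔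
        MinkSurf.IsNonflatInQuadric x (MinkSurf.nonHarmonicSet x ν) ∨
          MinkSurf.IsLocallyGraph x (MinkSurf.nonHarmonicSet x ν)) :=
  ⟨MinkSurf.isOpen_nonHarmonicSet hx.1 hν,
    MinkSurf.IsPointwiseOneType.isNonflatInQuadric_or_isLocallyGraph hx hν,
    fun h => h.elim (MinkSurf.isPointwiseOneType_of_isNonflatInQuadric hx hν)
      (MinkSurf.IsLocallyGraph.isPointwiseOneType hx hν)⟩
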